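/- **Setting.** Let $L=a_r\partial^r+\dots+a_1\partial+a_0$ with $a_i\in\mathbb Q[x]$ and $a_r(x)\ne0$ for $x\in[-1,1]$. Let $\ell_0,\dots,\ell_{r-1}\in\mathbb Q$, and let $y$ be the solution on $[-1,1]$ of $L\cdot y=0$, $y^{(j)}(0)=\ell_j$ $(0\le j<r)$. Let $p=\sum_{n=-d}^{d}c_{|n|}T_n$ ($c_n\in\mathbb Q$) be a polynomial of degree at most $d$ written on the Chebyshev basis, with $T_{-n}=T_n$, and let $\varepsilon>0$ be rational. Write $\|f\|_\infty=\sup_{[-1,1]}|f|$. All polynomials below are represented by their symmetric Chebyshev coefficients. Operations in $\mathbb Q$ (field operations, comparisons, absolute values) are counted, while control and indexing are free. **Validation algorithm.** 1. Find $\alpha_j\in\mathbb Q[x]$ with $L=\partial^r\alpha_r+\dots+\partial\alpha_1+\alpha_0$. Put $K(x,t)=-\sum_{k<r}\frac{(x-t)^k}{k!}\alpha_{r-1-k}(t)=\sum_{j<r}\beta_j(t)x^j$ and $g(x)=\sum_{k<r}\sum_{j\le k}\sum_{i=j}^{k}\binom ij\alpha_{r-k+i}^{(i-j)}(0)\,\ell_j\frac{x^k}{k!}$.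 2. Find $A\in\mathbb Q$ with $|\alpha_r(x)^{-1}K(x,t)|\le A$ whenever $0\le t\le x\le1$ or $-1\le x\le t\le0$. Let $i$ be the least integer with $A^i/i!\le\frac12$, and put $\gamma_i=\sum_{j\ge0}A^{ij}/(ij)!$. 3. Set $p_0=p$. For $k=0,\dots,i-1$ compute $q_{k+1}(x)=g(x)+\sum_{j<r}x^j\int_0^x\beta_j(t)p_k(t)\,dt$, and then an approximation $p_{k+1}$ of $\alpha_r^{-1}q_{k+1}$ with uniform error at most $\varepsilon$, by the expansion procedure below. 4. Let $\delta$ be the sum of the absolute values of the symmetric Chebyshev coefficients of $p-p_i$. Return $B=\gamma_i(\delta+e^A\varepsilon)$. **Expansion procedure** for $f/b$, where $b=\alpha_r$, $m=\deg b$, with target error $\varepsilon$. Divide $f=bq+\varrho$, $\deg \varrho<m$, in the Chebyshev basis. Let $\beta(z)=z^mb(\frac{z+z^{-1}}2)$, and for a root $\zeta$ of $\beta$ of multiplicity $\mu_\zeta$ let $h_j(\zeta)$ be the coefficient of $(\zeta-z)^{-j}$ in the partial fraction decomposition of $z^m\varrho(\frac{z+z^{-1}}2)/\beta(z)$; it is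 given by a rational function $h_j$, namely $(-1)^j$ times the coefficient of $t^{\mu_\zeta-j}$ in the quotient of the Taylor expansion of the numerator at $z$ by $t^{-\mu_\zeta}$ times the part of order $\ge\mu_\zeta$ of that of $\beta$. From $b$ alone, one has determined the number and the multiplicities of the roots with $|\zeta|>1$, disks of a common radius around these roots with a starting point in each disk for a simplified Newton iteration that halves the distance to the root there, bounds $1<\rho_-\le|z|\le\rho_+$ on the disks, and a bound $S$ on the disks for $|h_j'(z)|+|z^{-1}h_j(z)|$ when $\varrho=T_0$ or $\varrho=2T_s$, $0<s<m$. With $\varrho_s$ the symmetric Chebyshev coefficients of $\varrho$ and $\Sigma=\sum_{s<m}|\varrho_s|$, find the first $d'\ge\max(\deg f-m,0)$ (where $\deg f$ is the nominal degree of the representation) with $\sum_{|\zeta|>1}\sum_{j\le\mu_\zeta}\rho_+S\Sigma\,\frac{(d'+2)^{j-1}}{(\rho_--1)^j}\rho_-^{-d'-1}\le\frac\varepsilon4$. Iterate Newton's method until the guaranteed error $\varepsilon'$ on the roots satisfies $M\varepsilon'\le(1-\rho_-^{-1})^{m+1}\frac\varepsilon4$, where $M=\sum_{|\zeta|>1}\sum_{j\le\mu_\zeta}jS\Sigma\rho_-^{-j}$.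 Return $\sum_{n=-d'}^{d'}\tilde y_{|n|}T_n$ with $\tilde y_n=q_n+\operatorname{Re}\sum_{|\zeta|>1}\sum_{j\le\mu_\zeta}\binom{n+j-1}{j-1}h_j(\tilde\zeta)\tilde\zeta^{-n-j}$, where the $\tilde\zeta$ are the approximate roots. **Theorem.** The quantities that the algorithm requires from $L$ alone ($\alpha_j$, $A$, $i$, and the data attached to $b=\alpha_r$) exist. For every admissible choice of them, and whatever the number of operations spent on computing them: (a) *Correctness.* The algorithm terminates and its output satisfies $B>0$ and $\|y-p\|_\infty\le B$. (b) *Tightness and complexity.* For fixed $L$ (with the above data) and every $R$ there is a constant $C$ such that, for all initial values with $|\ell_j|\le R$, all $d\ge 0$, all $p$ as above and all $\varepsilon\in(0,\frac12]$, $$B\le C\,(\|y-p\|_\infty+\varepsilon)\,(d+\ln\varepsilon^{-1})^{1/2},$$ and the algorithm performs at most $$C\,\bigl(d+\ln\varepsilon^{-1}+\ln(1+\|y-p\|_\infty)\bigr)$$ arithmetic operations. In particular it performs $O(d+\ln\varepsilon^{-1})$ operations as long as $\|y-p\|_\infty$ stays bounded. -/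

import Mathlib

open Polynomial

noncomputable section

namespace ChebValid

/-! ### The arithmetic cost model

A computation carries its value and the number of field operations (including comparisons and
absolute values) in `ℚ` it performs. Index manipulation, copying and memory access are free. -/

/-- A value together with the number of arithmetic operations spent on it; `⊤` is used for a
computation that does not terminate. -/
structure Counted (α : Type) where
  val : α
  ops : ℕ∞

instance : Monad Counted where
  pure a := ⟨a, 0⟩
  bind m f := ⟨(f m.val).val, m.ops + (f m.val).ops⟩

def addC (x y : ℚ) : Counted ℚ := ⟨x + y, 1⟩
def subC (x y : ℚ) : Counted ℚ := ⟨x - y, 1⟩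
def mulC (x y : ℚ) : Counted ℚ := ⟨x * y, 1⟩
def divC (x y : ℚ) : Counted ℚ := ⟨x / y, 1⟩
def absC (x : ℚ) : Counted ℚ := ⟨|x|, 1⟩
def leC (x y : ℚ) : Counted Bool := ⟨decide (x ≤ y), 1⟩

/-- `for t = 0, …, n - 1 do s ← step t s`. -/
def forLoop {σ : Type} (n : ℕ) (step : ℕ → σ → Counted σ) (s : σ) : Counted σ :=
  match n with
  | 0 => pure s
  | n + 1 => do
      let s' ← forLoop n step s
      step n s'

open Classical in
/-- `while not (finished s) do s ← step s`. -/
def repeatUntil {σ : Type} (finished : σ → Counted Bool) (step : σ → Counted σ) (s : σ) :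
    Counted σ :=
  let state : ℕ → σ := fun t => (fun u => (step u).val)^[t] s
  if h : ∃ t, (finished (state t)).val = true then
    ⟨state (Nat.find h),
      ∑ t ∈ Finset.range (Nat.find h + 1), (finished (state t)).ops
        + ∑ t ∈ Finset.range (Nat.find h), (step (state t)).ops⟩
  else ⟨s, ⊤⟩

/-- Sum of a finite family: each term is computed and then added to an accumulator. -/
def sumC {ι : Type} (s : Finset ι) (f : ι → Counted ℚ) : Counted ℚ :=
  ⟨∑ i ∈ s, (f i).val, ∑ i ∈ s, ((f i).ops + 1)⟩

/-- Compute all entries of a finite family. -/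
def familyC {ι α : Type} [Fintype ι] (f : ι → Counted α) : Counted (ι → α) :=
  ⟨fun i => (f i).val, ∑ i, (f i).ops⟩

/-- `x ^ n` by repeated multiplication. -/
def powC (x : ℚ) (n : ℕ) : Counted ℚ := forLoop n (fun _ acc => mulC acc x) 1

/-- The binomial coefficient `(n + j - 1).choose (j - 1)` as `∏_{t = 1}^{j-1} (n + t) / t`. -/
def binomC (n j : ℕ) : Counted ℚ :=
  forLoop (j - 1) (fun t acc => do
    let x ← addC n (t + 1)
    let y ← mulC acc x
    divC y (t + 1)) 1

/-! ### Gaussian rationals -/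

/-- `re + im * i` with rational `re`, `im`. -/
structure GaussRat where
  re : ℚ
  im : ℚ

def GaussRat.toComplex (z : GaussRat) : ℂ := ⟨(z.re : ℝ), (z.im : ℝ)⟩

def GaussRat.subC (u v : GaussRat) : Counted GaussRat := do
  let x ← ChebValid.subC u.re v.re
  let y ← ChebValid.subC u.im v.im
  pure ⟨x, y⟩

def GaussRat.mulC (u v : GaussRat) : Counted GaussRat := do
  let a ← ChebValid.mulC u.re v.re
  let b ← ChebValid.mulC u.im v.im
  let c ← ChebValid.mulC u.re v.im
  let d ← ChebValid.mulC u.im v.re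
  let x ← ChebValid.subC a b
  let y ← ChebValid.addC c d
  pure ⟨x, y⟩

def GaussRat.invC (u : GaussRat) : Counted GaussRat := do
  let a ← ChebValid.mulC u.re u.re
  let b ← ChebValid.mulC u.im u.im
  let n ← ChebValid.addC a b
  let x ← ChebValid.divC u.re n
  let y ← ChebValid.divC u.im n
  let y' ← ChebValid.subC 0 y
  pure ⟨x, y'⟩

/-- Horner evaluation of `∑_{i < n} co i * z ^ i`. -/
def hornerC (n : ℕ) (co : ℕ → ℚ) (z : GaussRat) : Counted GaussRat :=
  forLoop n (fun t acc => do
    let a ← acc.mulC z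
    let x ← addC a.re (co (n - 1 - t))
    pure ⟨x, a.im⟩) ⟨0, 0⟩

/-- The coefficient of `(X - z) ^ l` in the Taylor expansion at `z` of the polynomial
`∑_{i ≤ n} co i * X ^ i`. -/
def taylorC (n : ℕ) (co : ℕ → ℚ) (l : ℕ) (z : GaussRat) : Counted GaussRat := do
  let co' ← familyC fun i : Fin (n + 1 - l) => mulC ((i + l).choose l : ℕ) (co (i + l))
  hornerC (n + 1 - l) (fun i => if h : i < n + 1 - l then co' ⟨i, h⟩ else 0) z

/-! ### Polynomials written on the Chebyshev basis -/

/-- Symmetric Chebyshev coefficients `c_0, …, c_deg` of the polynomial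
`∑_{n = -deg}^{deg} c_{|n|} T_n`. -/
structure ChebVec where
  deg : ℕ
  coeff : ℕ → ℚ

def ChebVec.toPoly (u : ChebVec) : ℚ[X] :=
  ∑ n ∈ Finset.Icc (-(u.deg : ℤ)) (u.deg : ℤ),
    C (u.coeff n.natAbs) * Polynomial.Chebyshev.T ℚ n

/-- The vector with prescribed coefficients `c_0, …, c_d`, and zeros afterwards. -/
def ChebVec.ofFin {d : ℕ} (c : Fin (d + 1) → ℚ) : ChebVec :=
  ⟨d, fun n => if h : n < d + 1 then c ⟨n, h⟩ else 0⟩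

/-- Compute the coefficients `c_0, …, c_d` one after the other. -/
def buildC (d : ℕ) (f : ℕ → Counted ℚ) : Counted ChebVec := do
  let c ← familyC fun n : Fin (d + 1) => f n
  pure (ChebVec.ofFin c)

/-- The `n`-th symmetric Chebyshev coefficient of a polynomial given on the monomial basis, from
`x ^ k = 2⁻ᵏ ∑_j (k.choose j) T_{k - 2j}`. -/
def chebCoeff (f : ℚ[X]) (n : ℕ) : ℚ :=
  ∑ k ∈ Finset.range (f.natDegree + 1),
    if n ≤ k ∧ Even (k - n) then f.coeff k * (k.choose ((k - n) / 2) : ℚ) / 2 ^ k else 0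

/-- Conversion of a (fixed) polynomial to the Chebyshev basis. -/
def ChebVec.ofPoly (f : ℚ[X]) : ChebVec := ⟨f.natDegree, chebCoeff f⟩

def ChebVec.addC (u v : ChebVec) : Counted ChebVec :=
  buildC (max u.deg v.deg) fun n => ChebValid.addC (u.coeff n) (v.coeff n)

def ChebVec.subC (u v : ChebVec) : Counted ChebVec :=
  buildC (max u.deg v.deg) fun n => ChebValid.subC (u.coeff n) (v.coeff n)

/-- Product: `(u v)_n = ∑_{i = -deg u}^{deg u} u_{|i|} v_{|n - i|}`. -/
def ChebVec.mulC (u v : ChebVec) : Counted ChebVec :=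
  buildC (u.deg + v.deg) fun n =>
    sumC (Finset.Icc (-(u.deg : ℤ)) (u.deg : ℤ)) fun i =>
      ChebValid.mulC (u.coeff i.natAbs) (v.coeff ((n : ℤ) - i).natAbs)

/-- The antiderivative vanishing at `0`: `2 n F_n = u_{n-1} - u_{n+1}` for `n ≥ 1`, and the
constant coefficient is `F_0 = -2 ∑_{k ≥ 1} (-1)^k F_{2k}`. -/
def ChebVec.intC (u : ChebVec) : Counted ChebVec := do
  let F ← buildC (u.deg + 1) fun n =>
    if n = 0 then pure 0 else do
      let x ← ChebValid.subC (u.coeff (n - 1)) (u.coeff (n + 1))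
      let y ← ChebValid.mulC 2 n
      divC x y
  let s ← sumC (Finset.Icc 1 ((u.deg + 1) / 2)) fun k =>
    ChebValid.mulC ((-1) ^ k) (F.coeff (2 * k))
  let c ← ChebValid.mulC (-2) s
  pure ⟨F.deg, Function.update F.coeff 0 c⟩

/-- The upper bound `∑_{n = -deg}^{deg} |u_{|n|}|` for the uniform norm on `[-1, 1]`. -/
def ChebVec.boundC (u : ChebVec) : Counted ℚ :=
  sumC (Finset.Icc (-(u.deg : ℤ)) (u.deg : ℤ)) fun n => absC (u.coeff n.natAbs)

/-- Quotient and remainder during a Euclidean division on the Chebyshev basis. -/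
structure DivState where
  quo : ℕ → ℚ
  rem : ℕ → ℚ

/-- One step of the Euclidean division by `b`: with `k = n - deg b`, the coefficient of `T_n` in
the current remainder is cancelled by subtracting `q_k (T_k + T_{-k}) b` (or `q_0 b` when `k = 0`),
where `q_k = rem_n / b_{deg b}`. -/
def divStep (b : ChebVec) (n : ℕ) (st : DivState) : Counted DivState := do
  let k := n - b.deg
  let q ← divC (st.rem n) (b.coeff b.deg)
  let rem' ← forLoop (n + 1 - (k - b.deg)) (fun t rem => do
    let j := (k - b.deg) + t
    let s ← if k = 0 then pure (b.coeff j)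
      else addC (b.coeff ((j : ℤ) - k).natAbs) (b.coeff (j + k))
    let v ← mulC q s
    let w ← subC (rem j) v
    pure (Function.update rem j w)) st.rem
  pure ⟨Function.update st.quo k q, rem'⟩

/-- Euclidean division of `f` by `b` on the Chebyshev basis. -/
def divModC (f b : ChebVec) : Counted DivState :=
  forLoop (f.deg + 1 - b.deg) (fun t st => divStep b (f.deg - t) st) ⟨fun _ => 0, f.coeff⟩

/-! ### Chebyshev expansion of `f / b` for a fixed polynomial `b` without zero in `[-1, 1]` -/

/-- The coefficients of `z ^ m * u ((z + z⁻¹) / 2)`, where `u` has symmetric Chebyshev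
coefficients `c` and degree at most `m`. -/
def liftCoeff (m : ℕ) (c : ℕ → ℚ) (i : ℕ) : ℚ := c ((i : ℤ) - m).natAbs

/-- `β(z) = z ^ (deg b) * b ((z + z⁻¹) / 2)`, as a complex polynomial. -/
def liftPoly (b : ℚ[X]) : ℂ[X] :=
  ∑ i ∈ Finset.range (2 * b.natDegree + 1),
    C ((liftCoeff b.natDegree (chebCoeff b) i : ℚ) : ℂ) * X ^ i

/-- `z ^ m * u ((z + z⁻¹) / 2)` for the basis vectors `u = T_0` (`s = 0`) and `u = 2 T_s`
(`s > 0`), whose only nonzero symmetric Chebyshev coefficients are `c_{±s} = 1`. -/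
def basisNum (m s : ℕ) : ℂ[X] := if s = 0 then X ^ m else X ^ (m + s) + X ^ (m - s)

/-- The rational function `h_j` whose value at a root `ζ` of multiplicity `μ` of `β` is the
coefficient of `(ζ - z) ^ (-j)` in the partial fraction decomposition of `N / β`: it is `(-1) ^ j`
times the coefficient of `t ^ (μ - j)` in `N (z + t) / (t ^ (-μ) β (z + t))`, where the terms of
degree less than `μ` of `β (z + t)` (they vanish if `z = ζ`) are dropped. -/
def pfNum (β N : ℂ[X]) (μ j : ℕ) (z : ℂ) : ℂ :=
  (-1) ^ j * PowerSeries.coeff (μ - j)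
    (((taylor z N : ℂ[X]) : PowerSeries ℂ) *
      (PowerSeries.mk fun l => (taylor z β).coeff (μ + l))⁻¹)

/-- What the expansion algorithm computes from the denominator `b` alone: the number of distinct
roots `ζ` of `β` outside the closed unit disk and their multiplicities, an isolating disk and a
starting point for each, bounds `1 < ρ₋ ≤ |z| ≤ ρ₊` valid on these disks, and a bound for the
partial fraction coefficients and their derivatives. The roots themselves are not available to the
algorithm: they only occur in the specification. -/
structure ExpansionData (b : ℚ[X]) where
  numRoots : ℕ
  root : Fin numRoots → ℂ
  root_injective : Function.Injective root
  mem_range_root : ∀ z : ℂ, z ∈ Set.range root ↔ (liftPoly b).IsRoot z ∧ 1 < ‖z‖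
  mult : Fin numRoots → ℕ
  mult_eq : ∀ k, mult k = (liftPoly b).rootMultiplicity (root k)
  /-- common radius of the isolating disks -/
  rad : ℚ
  rad_pos : 0 < rad
  start : Fin numRoots → GaussRat
  start_mem : ∀ k, ‖(start k).toComplex - root k‖ ≤ rad
  /-- an approximate inverse of the derivative, for the simplified Newton iteration -/
  slope : Fin numRoots → GaussRat
  newton : ∀ k, ∀ z : ℂ, ‖z - root k‖ ≤ rad →
    ‖z - (slope k).toComplex * (taylor z (liftPoly b)).coeff (mult k - 1) - root k‖
      ≤ ‖z - root k‖ / 2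
  coeff_ne_zero : ∀ k, ∀ z : ℂ, ‖z - root k‖ ≤ rad → (taylor z (liftPoly b)).coeff (mult k) ≠ 0
  rhoLow : ℚ
  rhoHigh : ℚ
  one_lt_rhoLow : 1 < rhoLow
  annulus : ∀ k, ∀ z : ℂ, ‖z - root k‖ ≤ rad → (rhoLow : ℝ) ≤ ‖z‖ ∧ ‖z‖ ≤ (rhoHigh : ℝ)
  pfBound : ℚ
  pfBound_spec : ∀ k, ∀ j ∈ Finset.Icc 1 (mult k), ∀ s < b.natDegree, ∀ z : ℂ,
    ‖z - root k‖ ≤ rad →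
      ‖deriv (pfNum (liftPoly b) (basisNum b.natDegree s) (mult k) j) z‖
        + ‖z⁻¹ * pfNum (liftPoly b) (basisNum b.natDegree s) (mult k) j z‖ ≤ (pfBound : ℝ)

/-- Approximations of the roots, with a common bound for their errors. -/
structure RootState (n : ℕ) where
  rad : ℚ
  pt : Fin n → GaussRat

/-- The truncation order `d'` reached so far, with the value of `ρ₋ ^ (-d' - 1)`. -/
structure TailState where
  deg : ℕ
  pow : ℚ

namespace ExpansionData

variable {b : ℚ[X]} (E : ExpansionData b)

/-- Given `R = ∑_s |r_s|`, find the first `d' ≥ d₀` such that the bound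
`∑_ζ ∑_j ρ₊ S R (d' + 2) ^ (j - 1) (ρ₋ - 1) ^ (-j) ρ₋ ^ (-d' - 1)` for the tail
`‖∑_{n > d'} w_n T_n‖` is at most `ε / 4`, where `S = pfBound`. -/
def truncC (d₀ : ℕ) (R ε : ℚ) : Counted ℕ := do
  let x ← divC 1 E.rhoLow
  let p₀ ← powC x (d₀ + 1)
  let e ← subC E.rhoLow 1
  let h ← mulC E.rhoHigh E.pfBound
  let h' ← mulC h R
  let ε' ← divC ε 4
  let res ← repeatUntil
    (fun st : TailState => do
      let s ← sumC Finset.univ fun k => sumC (Finset.Icc 1 (E.mult k)) fun j => do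
        let y ← addC st.deg 2
        let u ← powC y (j - 1)
        let v ← powC e j
        divC u v
      let t ← mulC h' s
      let t' ← mulC t st.pow
      leC t' ε')
    (fun st => do
      let p ← mulC st.pow x
      pure ⟨st.deg + 1, p⟩)
    ⟨d₀, p₀⟩
  pure res.deg

/-- One step of the simplified Newton iteration for all roots simultaneously. A root of
multiplicity `μ` of `β` is computed as a simple root of the `(μ - 1)`-st derivative. -/
def newtonStep (st : RootState E.numRoots) : Counted (RootState E.numRoots) := do
  let r ← divC st.rad 2
  let pt ← familyC fun k => do
    let v ← taylorC (2 * b.natDegree) (liftCoeff b.natDegree (chebCoeff b)) (E.mult k - 1) (st.pt k)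
    let w ← (E.slope k).mulC v
    (st.pt k).subC w
  pure ⟨r, pt⟩

/-- Approximations of the roots with error at most `ε'`, where
`M ε' ≤ (1 - ρ₋⁻¹) ^ (deg b + 1) ε / 4` and `M = ∑_ζ ∑_j j S R ρ₋ ^ (-j)`. -/
def rootsC (R ε : ℚ) : Counted (RootState E.numRoots) := do
  let x ← divC 1 E.rhoLow
  let s ← sumC Finset.univ fun k => sumC (Finset.Icc 1 (E.mult k)) fun j => do
    let u ← powC x j
    mulC j u
  let h ← mulC E.pfBound R
  let M ← mulC h s
  let y ← subC 1 x
  let y' ← powC y (b.natDegree + 1)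
  let z ← mulC y' ε
  let z' ← divC z 4
  repeatUntil (fun st => do
      let u ← mulC M st.rad
      leC u z')
    E.newtonStep ⟨E.rad, E.start⟩

/-- The coefficients `c_0, …, c_{μ-1}` of the power series `N (z + t) / (t ^ (-μ) β (z + t))`, by
power series division; `num` are the coefficients of `N`. -/
def seriesC (num : ℕ → ℚ) (μ : ℕ) (z : GaussRat) : Counted (ℕ → GaussRat) := do
  let m := b.natDegree
  let g₀ ← taylorC (2 * m) (liftCoeff m (chebCoeff b)) μ z
  let inv ← g₀.invC
  forLoop μ (fun l c => do
    let a ← taylorC (2 * m) num l z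
    let a' ← forLoop l (fun s acc => do
      let g ← taylorC (2 * m) (liftCoeff m (chebCoeff b)) (μ + (s + 1)) z
      let t ← g.mulC (c (l - (s + 1)))
      acc.subC t) a
    let v ← a'.mulC inv
    pure (Function.update c l v)) (fun _ => ⟨0, 0⟩)

/-- The powers `u ^ 0, …, u ^ n`, computed incrementally. -/
def powersC (u : GaussRat) (n : ℕ) : Counted (ℕ → GaussRat) :=
  forLoop n (fun t pw => do
    let v ← (pw t).mulC u
    pure (Function.update pw (t + 1) v)) (fun _ => ⟨1, 0⟩)

/-- Chebyshev coefficients of an approximation of `f / b` with uniform error at most `ε` on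
`[-1, 1]`: Euclidean division `f = b q + r`, then truncation of the Chebyshev expansion of
`w = r / b`, whose coefficients `w_n = ∑_ζ ∑_j ((n + j - 1).choose (j - 1)) h_j(ζ) ζ ^ (-n - j)`
are evaluated at approximate roots. -/
def expandC (f : ChebVec) (ε : ℚ) : Counted ChebVec := do
  let m := b.natDegree
  let qr ← divModC f (ChebVec.ofPoly b)
  let R ← sumC (Finset.range m) fun s => absC (qr.rem s)
  let d' ← E.truncC (f.deg - m) R ε
  let roots ← E.rootsC R ε
  let num : ℕ → ℚ := liftCoeff m fun s => if s < m then qr.rem s else 0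
  let ser ← familyC fun k => seriesC (b := b) num (E.mult k) (roots.pt k)
  let pw ← familyC fun k => do
    let u ← (roots.pt k).invC
    powersC u (d' + m)
  buildC d' fun n => do
    let w ← sumC Finset.univ fun k => sumC (Finset.Icc 1 (E.mult k)) fun j => do
      let c ← binomC n j
      let c' ← mulC ((-1) ^ j) c
      let v ← (ser k (E.mult k - j)).mulC (pw k (n + j))
      mulC c' v.re
    addC (qr.quo n) w

end ExpansionData

/-! ### The validation algorithm -/

/-- A linear differential operator `L = a_r ∂^r + ⋯ + a_1 ∂ + a_0` with rational polynomial
coefficients whose leading coefficient does not vanish on `[-1, 1]`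
(only `a_0, …, a_r` are relevant). -/
structure DiffOp where
  order : ℕ
  coeff : ℕ → ℚ[X]
  lead_ne_zero : ∀ x ∈ Set.Icc (-1 : ℝ) 1, aeval x (coeff order) ≠ 0

/-- `y` is `r` times continuously differentiable on `[-1, 1]`, solves `L ⋅ y = 0` there and
satisfies the initial conditions `y^{(j)}(0) = ℓ_j` for `j < r`. -/
structure IsSolution (L : DiffOp) (ell : Fin L.order → ℚ) (y : ℝ → ℝ) : Prop where
  contDiffOn : ContDiffOn ℝ L.order y (Set.Icc (-1) 1)
  eq_zero : ∀ x ∈ Set.Icc (-1 : ℝ) 1, ∑ i ∈ Finset.range (L.order + 1),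
    aeval x (L.coeff i) * iteratedDerivWithin i y (Set.Icc (-1) 1) x = 0
  initial : ∀ j : Fin L.order, iteratedDerivWithin j y (Set.Icc (-1) 1) 0 = (ell j : ℝ)

/-- The kernel `K(x, t) = -∑_{k < r} (x - t)^k / k! * α_{r-1-k}(t)`. -/
def kernel (r : ℕ) (α : ℕ → ℚ[X]) (x t : ℝ) : ℝ :=
  -∑ k ∈ Finset.range r, (x - t) ^ k / (k.factorial : ℝ) * aeval t (α (r - 1 - k))

/-- The polynomials `β_j` with `K(x, t) = ∑_{j < r} β_j(t) x^j`. -/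
def kernelCoeff (r : ℕ) (α : ℕ → ℚ[X]) (j : ℕ) : ℚ[X] :=
  ∑ i ∈ Finset.range (r - j),
    C ((-1) ^ (i + 1) / ((i.factorial : ℚ) * (j.factorial : ℚ))) * X ^ i * α (r - 1 - j - i)

/-- The coefficient of `ℓ_j` in
`g(x) = ∑_{k < r} ∑_{j ≤ k} ∑_{i = j}^k (i.choose j) α_{r-k+i}^{(i-j)}(0) ℓ_j x^k / k!`. -/
def initPoly (r : ℕ) (α : ℕ → ℚ[X]) (j : ℕ) : ℚ[X] :=
  ∑ k ∈ Finset.Ico j r, ∑ i ∈ Finset.Icc j k,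
    C ((i.choose j : ℚ) * (derivative^[i - j] (α (r - k + i))).eval 0 / (k.factorial : ℚ)) * X ^ k

/-- The steps of the algorithm whose input is the operator `L` alone, together with the number
`cost` of arithmetic operations spent on them: the coefficients `α_j` with
`L = ∂^r α_r + ⋯ + ∂ α_1 + α_0`, a bound `A` for `|α_r(x)⁻¹ K(x, t)|` (`t` between `0` and `x`),
the least `i` with `A^i / i! ≤ 1/2`, and the preparation of the expansions with denominator
`α_r`. -/
structure Preparation (L : DiffOp) where
  cost : ℕ
  α : ℕ → ℚ[X]
  α_spec : ∀ f : ℚ[X], ∑ i ∈ Finset.range (L.order + 1), L.coeff i * derivative^[i] f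
    = ∑ j ∈ Finset.range (L.order + 1), derivative^[j] (α j * f)
  A : ℚ
  A_spec : ∀ x t : ℝ, (0 ≤ t ∧ t ≤ x ∧ x ≤ 1) ∨ (-1 ≤ x ∧ x ≤ t ∧ t ≤ 0) →
    |(aeval x (α L.order))⁻¹ * kernel L.order α x t| ≤ (A : ℝ)
  i : ℕ
  i_spec : IsLeast {i : ℕ | A ^ i / (i.factorial : ℚ) ≤ 1 / 2} i
  expansion : ExpansionData (α L.order)

namespace Preparation

variable {L : DiffOp} (P : Preparation L)

/-- The polynomial `g`. -/
def gC (ell : Fin L.order → ℚ) : Counted ChebVec :=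
  buildC L.order fun n => sumC Finset.univ fun j =>
    mulC (ell j) ((ChebVec.ofPoly (initPoly L.order P.α j)).coeff n)

/-- `q(x) = g(x) + ∑_{j < r} x^j ∫_0^x β_j(t) p(t) dt`. -/
def volterraC (g p : ChebVec) : Counted ChebVec :=
  forLoop L.order (fun j acc => do
    let u ← (ChebVec.ofPoly (kernelCoeff L.order P.α j)).mulC p
    let v ← u.intC
    let w ← (ChebVec.ofPoly (X ^ j)).mulC v
    acc.addC w) g

/-- The successive polynomials `p_0 = p`, `p_{k+1} ≈ α_r⁻¹ q_{k+1}`. -/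
def iterC (g p : ChebVec) (ε : ℚ) (k : ℕ) : Counted ChebVec :=
  forLoop k (fun _ pk => do
    let q ← P.volterraC g pk
    P.expansion.expandC q ε) p

/-- `γ_i = ∑_j A^(ij) / (ij)!`. -/
def gamma (A : ℝ) (i : ℕ) : ℝ := ∑' j : ℕ, A ^ (i * j) / ((i * j).factorial : ℝ)

/-- The validation algorithm: it returns `B = γ_i (δ + e^A ε)`, where `δ` is the sum of the
absolute values of the symmetric Chebyshev coefficients of `p - p_i`. -/
def validate (ell : Fin L.order → ℚ) (p : ChebVec) (ε : ℚ) : Counted ℝ := do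
  let _ ← (⟨(), P.cost⟩ : Counted Unit)
  let g ← P.gC ell
  let pi ← P.iterC g p ε P.i
  let diff ← p.subC pi
  let δ ← diff.boundC
  -- one addition and two multiplications
  (⟨gamma P.A P.i * (δ + Real.exp P.A * ε), 3⟩ : Counted ℝ)

end Preparation

/-- The uniform norm on `[-1, 1]`. -/
def supNorm (f : ℝ → ℝ) : ℝ := sSup ((fun x => |f x|) '' Set.Icc (-1) 1)

end ChebValid

end

noncomputable section

namespace ChebValid

/-! ### Values and operation counts of the basic combinators -/

/-! Integral equation. With `L = ∑ ∂^j α_j`, the initial value problem is equivalent to integrating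
`r` times, and a solution satisfies the Volterra equation `α_r y = g + ∫_0^x K(x,t) y(t) dt`
(`Preparation.volterra_eq`). So `y` is fixed by the affine map `p ↦ α_r⁻¹ (g + ∫ K p)`, and one pass
of the algorithm applies this map up to a uniform error `ε`. Hence `D_k = y - p_k` satisfies
`|D_{k+1} - ∫ κ D_k| ≤ ε` with `κ = α_r⁻¹ K`, `|κ| ≤ A` (`Preparation.iterC_error`). Writing `D_0 =
(D_0 - D_i) + D_i`, where `|D_0 - D_i| ≤ δ` and `D_i` is the result of `i` perturbed Volterra steps,
and feeding the bound for `D_0` back into itself produces the series `γ_i`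
(`KernelBound.abs_le_gamma`). This is correctness.

Expansion of `f / b`. Under `x = (z + z⁻¹)/2` a Chebyshev series becomes a symmetric Laurent series
on the unit circle. Partial fractions of the remainder over `b` split into poles outside the disk,
which give the nonnegative powers of `z`, and poles inside, which give the negative ones. By
symmetry the outer poles determine all the coefficients (`hasSum_laurentCoeff`). The coefficients
decay geometrically, so truncation and Newton errors sum to closed forms, and both loops stop after
`O(1 + log R + log(1 + ε⁻¹))` steps, `R` being the size of the remainder
(`ExpansionData.exists_steps`). The error is controlled in `ℓ¹` of the coefficients
(`ExpansionData.expandC_error`), which is stronger than the uniform norm.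

Tightness. Let `η = ‖y - p‖`. The difference `p - p_i` is `O(η + ε)` uniformly, but `δ` is an `ℓ¹`
norm. Bessel and Cauchy–Schwarz bound the coefficients with `|n| ≤ N` by `(2N+1)^{1/2}` times the
uniform norm (`ChebVec.boundC_le`). For the rest, multiplication, integration and division by `b`
are bounded on weighted `ℓ¹` spaces, uniformly over all weights whose growth is at most `Θ^{|k|}`
for a shift by `k` (`Preparation.exists_wnorm_iterC`). The weight is taken equal to `1` up to `d`,
then geometric, then capped at `Θ^m` (`stepWeight`). The cap is needed because expansion errors are
only known in plain `ℓ¹`. Choosing `Θ^m ≥ (2d+1)/ε` makes the coefficients beyond `N = d + m` sum to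
`O(η + ε)`, with `m = O(d + log ε⁻¹)`.

Complexity. An expansion costs a constant times the degree plus the number of loop steps. Remainders
of a division may grow exponentially in the degree, but only their logarithm matters, so one pass is
linear in the degree, the logarithm of the coefficient size, and `log(1 + ε⁻¹)`. The number of
passes is fixed by `L`, so the total is linear too (`Preparation.exists_iterC_cost`). Coefficients
of `p` are bounded by `‖p‖ ≤ η + Z`, where `Z` bounds all solutions with initial values at most `R`;
this is the source of the term `log(1 + η)`.

Existence of the prepared data is continuity near finitely many roots together with compactness of
`[-1,1]²` (`nonempty_preparation`). -/

@[simp] lemma bind_val {α β : Type} (m : Counted α) (f : α → Counted β) :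
    (m >>= f).val = (f m.val).val := rfl

@[simp] lemma bind_ops {α β : Type} (m : Counted α) (f : α → Counted β) :
    (m >>= f).ops = m.ops + (f m.val).ops := rfl

@[simp] lemma pure_val {α : Type} (a : α) : (pure a : Counted α).val = a := rfl
@[simp] lemma pure_ops {α : Type} (a : α) : (pure a : Counted α).ops = 0 := rfl

@[simp] lemma addC_val (x y : ℚ) : (addC x y).val = x + y := rfl
@[simp] lemma subC_val (x y : ℚ) : (subC x y).val = x - y := rfl
@[simp] lemma mulC_val (x y : ℚ) : (mulC x y).val = x * y := rfl
@[simp] lemma divC_val (x y : ℚ) : (divC x y).val = x / y := rfl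
@[simp] lemma absC_val (x : ℚ) : (absC x).val = |x| := rfl
@[simp] lemma leC_val (x y : ℚ) : (leC x y).val = decide (x ≤ y) := rfl
@[simp] lemma addC_ops (x y : ℚ) : (addC x y).ops = 1 := rfl
@[simp] lemma subC_ops (x y : ℚ) : (subC x y).ops = 1 := rfl
@[simp] lemma mulC_ops (x y : ℚ) : (mulC x y).ops = 1 := rfl
@[simp] lemma divC_ops (x y : ℚ) : (divC x y).ops = 1 := rfl
@[simp] lemma absC_ops (x : ℚ) : (absC x).ops = 1 := rfl
@[simp] lemma leC_ops (x y : ℚ) : (leC x y).ops = 1 := rfl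

@[simp] lemma sumC_val {ι : Type} (s : Finset ι) (f : ι → Counted ℚ) :
    (sumC s f).val = ∑ i ∈ s, (f i).val := rfl
@[simp] lemma familyC_val {ι α : Type} [Fintype ι] (f : ι → Counted α) :
    (familyC f).val = fun i => (f i).val := rfl

@[simp] lemma forLoop_zero {σ : Type} (step : ℕ → σ → Counted σ) (s : σ) :
    forLoop 0 step s = pure s := rfl

lemma forLoop_succ_val {σ : Type} (n : ℕ) (step : ℕ → σ → Counted σ) (s : σ) :
    (forLoop (n + 1) step s).val = (step n (forLoop n step s).val).val := rfl
lemma forLoop_succ_ops {σ : Type} (n : ℕ) (step : ℕ → σ → Counted σ) (s : σ) :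
    (forLoop (n + 1) step s).ops
      = (forLoop n step s).ops + (step n (forLoop n step s).val).ops := rfl

/-- An invariant of a `for` loop. -/
lemma forLoop_induct {σ : Type} (Inv : ℕ → σ → Prop) (n : ℕ) (step : ℕ → σ → Counted σ) (s : σ)
    (h0 : Inv 0 s) (hs : ∀ t < n, ∀ u, Inv t u → Inv (t + 1) (step t u).val) :
    Inv n (forLoop n step s).val := by
  induction n with
  | zero => exact h0
  | succ n ih => exact hs n n.lt_succ_self _ (ih fun t ht => hs t (ht.trans n.lt_succ_self))

lemma forLoop_ops_le {σ : Type} (n : ℕ) (step : ℕ → σ → Counted σ) (s : σ) (c : ℕ∞)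
    (hs : ∀ t < n, ∀ u, (step t u).ops ≤ c) : (forLoop n step s).ops ≤ n * c := by
  induction n with
  | zero => simp
  | succ n ih =>
    rw [forLoop_succ_ops, Nat.cast_add, Nat.cast_one, add_mul, one_mul]
    exact add_le_add (ih fun t ht => hs t (ht.trans n.lt_succ_self)) (hs n n.lt_succ_self _)

lemma sumC_ops_le {ι : Type} (s : Finset ι) (f : ι → Counted ℚ) (c : ℕ∞)
    (hf : ∀ i ∈ s, (f i).ops ≤ c) : (sumC s f).ops ≤ s.card * (c + 1) := by
  refine (Finset.sum_le_card_nsmul s _ (c + 1) fun i hi => ?_).trans_eq (nsmul_eq_mul _ _)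
  gcongr; exact hf i hi

lemma familyC_ops_le {ι α : Type} [Fintype ι] (f : ι → Counted α) (c : ℕ∞)
    (hf : ∀ i, (f i).ops ≤ c) : (familyC f).ops ≤ Fintype.card ι * c := by
  refine (Finset.sum_le_card_nsmul Finset.univ _ c fun i _ => hf i).trans_eq ?_
  simp

/-- A loop whose termination test succeeds after `T` steps. -/
lemma repeatUntil_spec {σ : Type} (finished : σ → Counted Bool) (step : σ → Counted σ) (s : σ)
    (T : ℕ) (hT : (finished ((fun u => (step u).val)^[T] s)).val = true) :
    ∃ t ≤ T, (repeatUntil finished step s).val = (fun u => (step u).val)^[t] s ∧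
      (finished ((fun u => (step u).val)^[t] s)).val = true ∧
      ∀ cf cs : ℕ∞, (∀ u, (finished u).ops ≤ cf) → (∀ u, (step u).ops ≤ cs) →
        (repeatUntil finished step s).ops ≤ (T + 1) * cf + T * cs := by
  classical
  have h : ∃ t, (finished ((fun u => (step u).val)^[t] s)).val = true := ⟨T, hT⟩
  -- Any known exit time `T` is enough: the loop stops at the first success, and the two cost terms
  -- are monotone in the number of passes.
  have hle : Nat.find h ≤ T := Nat.find_min' h hT
  refine ⟨Nat.find h, hle, ?_, Nat.find_spec h, fun cf cs hf hs => ?_⟩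
  · simp only [repeatUntil]
    rw [dif_pos h]
  · simp only [repeatUntil]
    rw [dif_pos h]
    have hle' : ((Nat.find h : ℕ) : ℕ∞) ≤ T := by exact_mod_cast hle
    refine add_le_add ?_ ?_
    · refine (Finset.sum_le_card_nsmul _ _ cf fun t _ => hf _).trans ?_
      rw [Finset.card_range, nsmul_eq_mul, Nat.cast_add, Nat.cast_one]
      gcongr
    · refine (Finset.sum_le_card_nsmul _ _ cs fun t _ => hs _).trans ?_
      rw [Finset.card_range, nsmul_eq_mul]
      gcongr

lemma powC_val (x : ℚ) (n : ℕ) : (powC x n).val = x ^ n := by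
  induction n with
  | zero => simp [powC]
  | succ n ih =>
    rw [powC, forLoop_succ_val, mulC_val, pow_succ, ← ih, powC]

lemma powC_ops_le (x : ℚ) (n : ℕ) : (powC x n).ops ≤ n := by
  simpa [powC] using forLoop_ops_le n (fun _ acc => mulC acc x) 1 1 fun _ _ _ => le_rfl

lemma binomC_val (n j : ℕ) (hj : 1 ≤ j) : (binomC n j).val = ((n + j - 1).choose (j - 1) : ℕ) := by
  obtain ⟨j, rfl⟩ : ∃ i, j = i + 1 := ⟨j - 1, by omega⟩
  simp only [Nat.add_sub_cancel, ← add_assoc, binomC]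
  induction j with
  | zero => simp
  | succ j ih =>
    rw [forLoop_succ_val, ih (by omega)]
    simp only [bind_val, addC_val, mulC_val, divC_val]
    -- The absorption identity is what one pass of the loop computes, with an exact division by `j +
    -- 1`.
    have h := Nat.add_one_mul_choose_eq (n + j) j
    have h' : ((n + j + 1 : ℕ) : ℚ) * ((n + j).choose j : ℕ)
        = ((n + j + 1).choose (j + 1) : ℕ) * ((j + 1 : ℕ) : ℚ) := by exact_mod_cast h
    have : ((j : ℚ) + 1) ≠ 0 := by positivity
    rw [div_eq_iff this]
    push_cast at h' ⊢
    rw [← add_assoc n j 1, ← h']; ring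

lemma binomC_ops_le (n j : ℕ) : (binomC n j).ops ≤ (j - 1 : ℕ) * 3 := by
  refine forLoop_ops_le _ _ _ 3 fun _ _ _ => ?_
  simp; norm_num

/-! ### Gaussian rationals -/

namespace GaussRat

@[simp] lemma toComplex_subC (u v : GaussRat) :
    (u.subC v).val.toComplex = u.toComplex - v.toComplex := by
  apply Complex.ext <;> simp [toComplex, GaussRat.subC]

@[simp] lemma toComplex_mulC (u v : GaussRat) :
    (u.mulC v).val.toComplex = u.toComplex * v.toComplex := by
  apply Complex.ext <;> simp [toComplex, GaussRat.mulC]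

-- No condition `u ≠ 0` is needed: division by zero gives `0` in `ℚ`, matching `0⁻¹ = 0` in `ℂ`.
@[simp] lemma toComplex_invC (u : GaussRat) : u.invC.val.toComplex = u.toComplex⁻¹ := by
  apply Complex.ext <;> simp [toComplex, GaussRat.invC, Complex.normSq, neg_div]

lemma subC_ops (u v : GaussRat) : (u.subC v).ops = 2 := by
  simp [GaussRat.subC]; norm_num
lemma mulC_ops (u v : GaussRat) : (u.mulC v).ops = 6 := by
  simp [GaussRat.mulC]; norm_num
lemma invC_ops (u : GaussRat) : u.invC.ops = 6 := by
  simp [GaussRat.invC]; norm_num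

lemma toComplex_zero : (⟨0, 0⟩ : GaussRat).toComplex = 0 := by
  apply Complex.ext <;> simp [toComplex]
lemma toComplex_one : (⟨1, 0⟩ : GaussRat).toComplex = 1 := by
  apply Complex.ext <;> simp [toComplex]
lemma toComplex_re (u : GaussRat) : u.toComplex.re = u.re := rfl

end GaussRat

lemma hornerC_val (n : ℕ) (co : ℕ → ℚ) (z : GaussRat) :
    (hornerC n co z).val.toComplex = ∑ i ∈ Finset.range n, (co i : ℂ) * z.toComplex ^ i := by
  -- After `k` passes the accumulator is the polynomial built from the `k` top coefficients, hence
  -- the index shift `n - k`.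
  suffices H : ∀ k ≤ n, (forLoop k (fun t acc => do
      let a ← acc.mulC z
      let x ← addC a.re (co (n - 1 - t))
      pure ⟨x, a.im⟩) (⟨0, 0⟩ : GaussRat)).val.toComplex
        = ∑ i ∈ Finset.range k, (co (n - k + i) : ℂ) * z.toComplex ^ i by
    simpa [hornerC] using H n le_rfl
  intro k hk
  induction k with
  | zero => simp [GaussRat.toComplex_zero]
  | succ k ih =>
    have hv : ∀ (a : GaussRat) (x : ℚ), (⟨a.re + x, a.im⟩ : GaussRat).toComplex
        = a.toComplex + (x : ℂ) := fun a x => by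
      apply Complex.ext <;> simp [GaussRat.toComplex]
    rw [forLoop_succ_val]
    simp only [bind_val, addC_val, pure_val]
    rw [hv, GaussRat.toComplex_mulC, ih (by omega), Finset.sum_range_succ', Finset.sum_mul]
    congr 1
    · refine Finset.sum_congr rfl fun i _ => ?_
      rw [show n - (k + 1) + (i + 1) = n - k + i by omega, pow_succ, mul_assoc]
    · rw [show n - 1 - k = n - (k + 1) + 0 by omega]; simp

lemma hornerC_ops_le (n : ℕ) (co : ℕ → ℚ) (z : GaussRat) : (hornerC n co z).ops ≤ n * 7 := by
  refine forLoop_ops_le _ _ _ 7 fun _ _ _ => ?_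
  simp [GaussRat.mulC_ops]; norm_num

/-- A Taylor coefficient is a value of a Hasse derivative, whose coefficients are `(i.choose l) * co
i`. Terms with `i < l` disappear with the binomial, which absorbs the truncated subtractions. -/
lemma taylorC_val (n : ℕ) (co : ℕ → ℚ) (l : ℕ) (z : GaussRat) :
    (taylorC n co l z).val.toComplex
      = (taylor z.toComplex (∑ i ∈ Finset.range (n + 1), C (co i : ℂ) * X ^ i)).coeff l := by
  simp only [taylorC, bind_val, familyC_val, mulC_val, hornerC_val, map_sum]
  rw [finsetSum_coeff]
  have h1 : ∀ i, (taylor z.toComplex (C (co i : ℂ) * X ^ i)).coeff l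
      = (i.choose l : ℂ) * co i * z.toComplex ^ (i - l) := by
    intro i
    rw [taylor_coeff, C_mul_X_pow_eq_monomial, hasseDeriv_monomial, eval_monomial]
  simp only [h1]
  rcases le_or_gt l (n + 1) with hl | hl
  · obtain ⟨k, hk⟩ := Nat.exists_eq_add_of_le hl
    rw [show n + 1 - l = k by omega, hk, Finset.sum_range_add]
    have h0 : ∑ i ∈ Finset.range l, (i.choose l : ℂ) * co i * z.toComplex ^ (i - l) = 0 :=
      Finset.sum_eq_zero fun i hi => by
        rw [Nat.choose_eq_zero_of_lt (Finset.mem_range.1 hi)]; simp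
    rw [h0, zero_add]
    refine Finset.sum_congr rfl fun i hi => ?_
    rw [dif_pos (Finset.mem_range.1 hi)]
    simp [add_comm]
  · rw [show n + 1 - l = 0 by omega, Finset.sum_range_zero, Finset.sum_eq_zero]
    intro i hi
    rw [Nat.choose_eq_zero_of_lt ((Finset.mem_range.1 hi).trans hl)]; simp

lemma taylorC_ops_le (n : ℕ) (co : ℕ → ℚ) (l : ℕ) (z : GaussRat) :
    (taylorC n co l z).ops ≤ ((n + 1) * 8 : ℕ) := by
  simp only [taylorC, bind_ops]
  refine (add_le_add (familyC_ops_le _ 1 fun _ => le_rfl) (hornerC_ops_le _ _ _)).trans ?_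
  have : n + 1 - l ≤ n + 1 := Nat.sub_le _ _
  simp only [Fintype.card_fin]
  norm_cast
  omega

/-! ### Sums over symmetric intervals -/

/-- Sums over all of `ℤ` forget the nominal degree and are invariant under shifts, so identities
between vectors of different degrees are proved there. -/
lemma sum_Icc_eq_finsum {M : Type*} [AddCommMonoid M] (f : ℤ → M) (D : ℕ)
    (h : ∀ n : ℤ, D < n.natAbs → f n = 0) :
    ∑ n ∈ Finset.Icc (-(D : ℤ)) D, f n = ∑ᶠ n, f n := by
  refine (finsum_eq_sum_of_support_subset f fun n hn => ?_).symm
  have : ¬ D < n.natAbs := fun h' => hn (h n h')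
  simp only [Finset.coe_Icc, Set.mem_Icc]; omega

lemma finite_support_of_natAbs {M : Type*} [AddCommMonoid M] (f : ℤ → M) (D : ℕ)
    (h : ∀ n : ℤ, D < n.natAbs → f n = 0) : (Function.support f).Finite := by
  refine (Finset.Icc (-(D : ℤ)) D).finite_toSet.subset fun n hn => ?_
  have : ¬ D < n.natAbs := fun h' => hn (h n h')
  simp only [Finset.coe_Icc, Set.mem_Icc]; omega

lemma finsum_sub_right {M : Type*} [AddCommMonoid M] (f : ℤ → M) (k : ℤ) :
    ∑ᶠ n, f (n - k) = ∑ᶠ n, f n :=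
  finsum_comp_equiv (Equiv.subRight k)

/-! ### Chebyshev vectors -/

namespace ChebVec

/-- The coefficients beyond the nominal degree vanish. -/
def WF (u : ChebVec) : Prop := ∀ n, u.deg < n → u.coeff n = 0

lemma ofFin_wf {d : ℕ} (c : Fin (d + 1) → ℚ) : (ofFin c).WF := fun n hn => by
  simp only [ofFin] at hn ⊢
  rw [dif_neg (by omega)]

lemma buildC_val_coeff (d : ℕ) (f : ℕ → Counted ℚ) (n : ℕ) :
    (buildC d f).val.coeff n = if n ≤ d then (f n).val else 0 := by
  simp only [buildC, bind_val, pure_val, ofFin, familyC_val, Nat.lt_succ_iff]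
  split_ifs <;> rfl

lemma buildC_wf (d : ℕ) (f : ℕ → Counted ℚ) : (buildC d f).val.WF := ofFin_wf _

lemma buildC_ops_le (d : ℕ) (f : ℕ → Counted ℚ) (c : ℕ∞) (hf : ∀ n ≤ d, (f n).ops ≤ c) :
    (buildC d f).ops ≤ (d + 1 : ℕ) * c := by
  simp only [buildC, bind_ops, pure_ops, add_zero]
  exact (familyC_ops_le (fun n : Fin (d + 1) => f n) c fun n => hf n (by omega)).trans_eq (by simp)

lemma toPoly_eq_finsum {u : ChebVec} (hu : u.WF) :
    u.toPoly = ∑ᶠ n : ℤ, C (u.coeff n.natAbs) * Chebyshev.T ℚ n :=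
  sum_Icc_eq_finsum _ _ fun n hn => by simp [hu _ hn]

lemma toPoly_eq_sum {u : ChebVec} (hu : u.WF) {N : ℕ} (hN : u.deg ≤ N) :
    u.toPoly = ∑ n ∈ Finset.Icc (-(N : ℤ)) N, C (u.coeff n.natAbs) * Chebyshev.T ℚ n := by
  rw [toPoly_eq_finsum hu, sum_Icc_eq_finsum]
  exact fun n hn => by simp [hu _ (hN.trans_lt hn)]

lemma addC_wf (u v : ChebVec) : (u.addC v).val.WF := buildC_wf _ _
lemma mulC_wf (u v : ChebVec) : (u.mulC v).val.WF := buildC_wf _ _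
lemma addC_deg (u v : ChebVec) : (u.addC v).val.deg = max u.deg v.deg := rfl
lemma subC_deg (u v : ChebVec) : (u.subC v).val.deg = max u.deg v.deg := rfl
lemma mulC_deg (u v : ChebVec) : (u.mulC v).val.deg = u.deg + v.deg := rfl

lemma addC_coeff {u v : ChebVec} (hu : u.WF) (hv : v.WF) (n : ℕ) :
    (u.addC v).val.coeff n = u.coeff n + v.coeff n := by
  rw [ChebVec.addC, buildC_val_coeff]
  split_ifs with h
  · rfl
  · rw [hu n (by omega), hv n (by omega), add_zero]

lemma subC_coeff {u v : ChebVec} (hu : u.WF) (hv : v.WF) (n : ℕ) :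
    (u.subC v).val.coeff n = u.coeff n - v.coeff n := by
  rw [ChebVec.subC, buildC_val_coeff]
  split_ifs with h
  · rfl
  · rw [hu n (by omega), hv n (by omega), sub_zero]

lemma mulC_coeff {u v : ChebVec} (hv : v.WF) (n : ℕ) :
    (u.mulC v).val.coeff n
      = ∑ i ∈ Finset.Icc (-(u.deg : ℤ)) u.deg, u.coeff i.natAbs * v.coeff ((n : ℤ) - i).natAbs := by
  rw [ChebVec.mulC, buildC_val_coeff]
  split_ifs with h
  · rfl
  · refine (Finset.sum_eq_zero fun i hi => ?_).symm
    rw [Finset.mem_Icc] at hi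
    rw [hv _ (by omega), mul_zero]

/-- For negative `n` substitute `i ↦ -i`, which does not change `|i|`. The convolution formula is
thereby available at every integer index. -/
lemma sum_conv_natAbs {R : Type*} [NonUnitalNonAssocSemiring R] (m : ℕ) (b v : ℕ → R) (n : ℤ) :
    ∑ i ∈ Finset.Icc (-(m : ℤ)) m, b i.natAbs * v ((n.natAbs : ℤ) - i).natAbs
      = ∑ i ∈ Finset.Icc (-(m : ℤ)) m, b i.natAbs * v (n - i).natAbs := by
  rcases Int.natAbs_eq n with h | h
  · rw [← h]
  · refine Finset.sum_nbij' (fun i => -i) (fun i => -i) ?_ ?_ ?_ ?_ ?_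
    · intro i hi; simp only [Finset.mem_Icc] at *; omega
    · intro i hi; simp only [Finset.mem_Icc] at *; omega
    · intro i _; simp
    · intro i _; simp
    · intro i _
      rw [Int.natAbs_neg]
      congr 2
      omega

lemma mulC_coeff_natAbs {u v : ChebVec} (hv : v.WF) (n : ℤ) :
    (u.mulC v).val.coeff n.natAbs
      = ∑ i ∈ Finset.Icc (-(u.deg : ℤ)) u.deg, u.coeff i.natAbs * v.coeff (n - i).natAbs := by
  rw [mulC_coeff hv, sum_conv_natAbs]

lemma addC_toPoly {u v : ChebVec} (hu : u.WF) (hv : v.WF) :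
    (u.addC v).val.toPoly = u.toPoly + v.toPoly := by
  rw [toPoly_eq_sum hu (le_max_left u.deg v.deg), toPoly_eq_sum hv (le_max_right u.deg v.deg),
    toPoly, addC_deg, ← Finset.sum_add_distrib]
  exact Finset.sum_congr rfl fun n _ => by rw [addC_coeff hu hv, C_add, add_mul]

lemma subC_toPoly {u v : ChebVec} (hu : u.WF) (hv : v.WF) :
    (u.subC v).val.toPoly = u.toPoly - v.toPoly := by
  rw [toPoly_eq_sum hu (le_max_left u.deg v.deg), toPoly_eq_sum hv (le_max_right u.deg v.deg),
    toPoly, subC_deg, ← Finset.sum_sub_distrib]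
  exact Finset.sum_congr rfl fun n _ => by rw [subC_coeff hu hv, C_sub, sub_mul]

/-- Averaging the indices `j` and `-j` and using `2 T_i T_j = T_{i+j} + T_{i-j}` gives `∑_j v_{|j|}
T_{i+j} = T_i ∑_j v_{|j|} T_j`. So with symmetric coefficients multiplication is plain convolution
on `ℤ`. -/
lemma mulC_toPoly {u v : ChebVec} (hv : v.WF) :
    (u.mulC v).val.toPoly = u.toPoly * v.toPoly := by
  set I := Finset.Icc (-(u.deg : ℤ)) u.deg
  have h1 : (u.mulC v).val.toPoly = ∑ i ∈ I, ∑ᶠ n : ℤ,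
      C (u.coeff i.natAbs) * (C (v.coeff (n - i).natAbs) * Chebyshev.T ℚ n) := by
    rw [toPoly_eq_finsum (mulC_wf u v), ← finsum_sum_comm]
    · refine finsum_congr fun n => ?_
      rw [mulC_coeff_natAbs hv, map_sum, Finset.sum_mul]
      exact Finset.sum_congr rfl fun i _ => by rw [C_mul, mul_assoc]
    · intro i hi
      refine finite_support_of_natAbs _ (u.deg + v.deg) fun n hn => ?_
      rw [Finset.mem_Icc] at hi
      rw [hv _ (by omega)]; simp
  have h2 : ∀ i : ℤ, ∑ᶠ n : ℤ, C (u.coeff i.natAbs) * (C (v.coeff (n - i).natAbs) * Chebyshev.T ℚ n)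
      = C (u.coeff i.natAbs) * ∑ j ∈ Finset.Icc (-(v.deg : ℤ)) v.deg,
          C (v.coeff j.natAbs) * Chebyshev.T ℚ (j + i) := by
    intro i
    rw [sum_Icc_eq_finsum _ _ fun n hn => by simp [hv _ hn], mul_finsum,
      ← finsum_sub_right (fun j => C (u.coeff i.natAbs) *
        (C (v.coeff j.natAbs) * Chebyshev.T ℚ (j + i))) i]
    simp only [sub_add_cancel]
  have h3 : ∀ i : ℤ, ∑ j ∈ Finset.Icc (-(v.deg : ℤ)) v.deg,
          C (v.coeff j.natAbs) * Chebyshev.T ℚ (j + i) = Chebyshev.T ℚ i * v.toPoly := by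
    intro i
    have h4 : ∑ j ∈ Finset.Icc (-(v.deg : ℤ)) v.deg, C (v.coeff j.natAbs) * Chebyshev.T ℚ (j + i)
        = ∑ j ∈ Finset.Icc (-(v.deg : ℤ)) v.deg, C (v.coeff j.natAbs) * Chebyshev.T ℚ (i - j) := by
      refine Finset.sum_nbij' (fun i => -i) (fun i => -i) ?_ ?_ ?_ ?_ ?_
      · intro i hi; simp only [Finset.mem_Icc] at *; omega
      · intro i hi; simp only [Finset.mem_Icc] at *; omega
      · intro i _; simp
      · intro i _; simp
      · intro j _
        rw [Int.natAbs_neg, sub_neg_eq_add, add_comm i]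
    have h5 : (2 : ℚ[X]) * ∑ j ∈ Finset.Icc (-(v.deg : ℤ)) v.deg,
        C (v.coeff j.natAbs) * Chebyshev.T ℚ (j + i) = 2 * (Chebyshev.T ℚ i * v.toPoly) := by
      rw [two_mul]
      nth_rw 2 [h4]
      rw [← Finset.sum_add_distrib, toPoly, Finset.mul_sum, Finset.mul_sum]
      refine Finset.sum_congr rfl fun j _ => ?_
      rw [← mul_add, add_comm j i, ← Chebyshev.T_mul_T]; ring
    exact mul_left_cancel₀ two_ne_zero h5
  rw [h1]
  simp only [h2, h3]
  rw [show u.toPoly = ∑ i ∈ I, C (u.coeff i.natAbs) * Chebyshev.T ℚ i from rfl, Finset.sum_mul]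
  exact Finset.sum_congr rfl fun i _ => by ring

end ChebVec

/-! ### Integration on the Chebyshev basis -/

namespace ChebVec

lemma intC_deg (u : ChebVec) : u.intC.val.deg = u.deg + 1 := rfl

lemma intC_coeff_pos {u : ChebVec} (hu : u.WF) {n : ℕ} (hn : 1 ≤ n) :
    u.intC.val.coeff n = (u.coeff (n - 1) - u.coeff (n + 1)) / (2 * n) := by
  simp only [intC, bind_val, pure_val]
  rw [Function.update_of_ne (by omega), buildC_val_coeff]
  split_ifs with h h0
  · omega
  · simp
  · rw [hu _ (by omega), hu _ (by omega)]; simp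

lemma intC_coeff_zero (u : ChebVec) :
    u.intC.val.coeff 0
      = -2 * ∑ k ∈ Finset.Icc 1 ((u.deg + 1) / 2), (-1) ^ k * u.intC.val.coeff (2 * k) := by
  simp only [intC, bind_val, pure_val, Function.update_self, mulC_val, sumC_val]
  congr 1
  refine Finset.sum_congr rfl fun k hk => ?_
  rw [Function.update_of_ne]
  have := (Finset.mem_Icc.1 hk).1
  omega

lemma intC_wf {u : ChebVec} (hu : u.WF) : u.intC.val.WF := fun n hn => by
  rw [intC_deg] at hn
  rw [intC_coeff_pos hu (by omega), hu _ (by omega), hu _ (by omega)]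
  simp

/-- The two-sided form of `2 n F_n = u_{n-1} - u_{n+1}`. It also holds at `n = 0`, where both sides
vanish by symmetry, so the termwise differentiation needs no exceptional index. -/
lemma intC_coeff_mul {u : ChebVec} (hu : u.WF) (n : ℤ) :
    u.intC.val.coeff n.natAbs * n = (u.coeff (n - 1).natAbs - u.coeff (n + 1).natAbs) / 2 := by
  rcases lt_trichotomy n 0 with h | h | h
  · obtain ⟨k, rfl⟩ : ∃ k : ℕ, n = -((k : ℤ) + 1) := ⟨n.natAbs - 1, by omega⟩
    rw [show (-((k : ℤ) + 1)).natAbs = k + 1 by omega, intC_coeff_pos hu (by omega),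
      show (-((k : ℤ) + 1) - 1).natAbs = k + 2 by omega,
      show (-((k : ℤ) + 1) + 1).natAbs = k by omega]
    have : (k : ℚ) + 1 ≠ 0 := by positivity
    push_cast
    field_simp
    ring
  · subst h; simp
  · obtain ⟨k, rfl⟩ : ∃ k : ℕ, n = (k : ℤ) + 1 := ⟨n.natAbs - 1, by omega⟩
    rw [show ((k : ℤ) + 1).natAbs = k + 1 by omega, intC_coeff_pos hu (by omega),
      show ((k : ℤ) + 1 - 1).natAbs = k by omega,
      show ((k : ℤ) + 1 + 1).natAbs = k + 2 by omega]
    have : (k : ℚ) + 1 ≠ 0 := by positivity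
    push_cast
    field_simp

/-- Use `T_n' = n U_{n-1}`, then shift the two halves of the sum in opposite directions: the
coefficient `u_n / 2` is left with `U_n - U_{n-2} = 2 T_n`. -/
lemma derivative_intC_toPoly {u : ChebVec} (hu : u.WF) :
    derivative u.intC.val.toPoly = u.toPoly := by
  have hfin : ∀ (k j : ℤ), (Function.support fun n : ℤ =>
      C (u.coeff (n + k).natAbs / 2) * Chebyshev.U ℚ (n + j)).Finite := fun k j => by
    refine finite_support_of_natAbs _ (u.deg + k.natAbs) fun n hn => ?_
    rw [hu _ (by omega)]; simp
  have h1 : derivative u.intC.val.toPoly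
      = ∑ᶠ n : ℤ, (C (u.coeff (n + -1).natAbs / 2) * Chebyshev.U ℚ (n + -1)
          - C (u.coeff (n + 1).natAbs / 2) * Chebyshev.U ℚ (n + -1)) := by
    rw [toPoly, derivative_sum, sum_Icc_eq_finsum]
    · refine finsum_congr fun n => ?_
      rw [derivative_C_mul, Chebyshev.T_derivative_eq_U, ← mul_assoc, ← sub_mul, ← C_sub,
        ← sub_div]
      congr 1
      rw [← sub_eq_add_neg, ← intC_coeff_mul hu, C_mul]
      simp
    · intro n hn
      rw [intC_wf hu _ hn]; simp
  rw [h1, finsum_sub_distrib (hfin _ _) (hfin _ _), toPoly_eq_finsum hu]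
  have h2 := finsum_sub_right (fun n : ℤ => C (u.coeff n.natAbs / 2) * Chebyshev.U ℚ n) 1
  have h3 := finsum_sub_right (fun n : ℤ => C (u.coeff n.natAbs / 2) * Chebyshev.U ℚ (n - 2)) (-1)
  simp only [sub_eq_add_neg, neg_neg] at h2 h3
  simp only [add_assoc] at h3
  norm_num at h3
  rw [h2, h3, ← finsum_sub_distrib]
  · refine finsum_congr fun n => ?_
    rw [← mul_sub]
    have := Chebyshev.two_mul_T_eq_U_sub_U ℚ (n - 2)
    rw [sub_add_cancel] at this
    rw [← sub_eq_add_neg, ← this, div_eq_mul_inv, C_mul, mul_assoc, ← mul_assoc (C (2⁻¹ : ℚ)),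
      show (C (2⁻¹ : ℚ)) * 2 = 1 by rw [← C_ofNat, ← C_mul]; norm_num, one_mul]
  · simpa only [add_zero] using! hfin 0 0
  · simpa only [add_zero] using! hfin 0 (-2)

/-- At `0` the odd `T_n` vanish and `T_{2k}` equals `(-1)^k`; the constant coefficient was chosen to
cancel the remaining alternating sum. -/
lemma eval_zero_intC_toPoly (u : ChebVec) : u.intC.val.toPoly.eval 0 = 0 := by
  set F := u.intC.val
  have he : (fun n : ℤ => F.coeff n.natAbs * (Chebyshev.T ℚ n).eval 0).Even := fun n => by
    simp [Chebyshev.T_neg]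
  have h1 : F.toPoly.eval 0
      = ∑ n ∈ Finset.Icc (-((u.deg + 1 : ℕ) : ℤ)) ((u.deg + 1 : ℕ) : ℤ),
        F.coeff n.natAbs * (Chebyshev.T ℚ n).eval 0 := by
    rw [toPoly, eval_finsetSum]
    simp only [eval_mul, eval_C]
    rfl
  have h2 : ∑ n ∈ Finset.range (u.deg + 1 + 1), F.coeff n * (Chebyshev.T ℚ n).eval 0
      = F.coeff 0 + ∑ k ∈ Finset.Icc 1 ((u.deg + 1) / 2), (-1) ^ k * F.coeff (2 * k) := by
    rw [Finset.sum_range_succ']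
    rw [add_comm]
    congr 1
    · simp
    · symm
      -- The index `0` was split off by `sum_range_succ'`, which shifts the others by one, so
      -- `T_{2k}` sits at position `2k - 1`.
      refine Finset.sum_of_injOn (fun k => 2 * k - 1) ?_ ?_ ?_ ?_
      · intro a ha b hb hab
        simp only [Finset.coe_Icc, Set.mem_Icc] at ha hb
        simp only at hab
        omega
      · intro k hk
        simp only [Finset.coe_Icc, Set.mem_Icc, Finset.coe_range, Set.mem_Iio] at hk ⊢
        omega
      · intro n hn hn'
        rw [Finset.mem_range] at hn
        rcases Nat.even_or_odd n with h | h
        · rw [Chebyshev.T_eval_zero_of_odd, mul_zero]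
          exact_mod_cast h.add_one
        · exfalso
          refine hn' ⟨(n + 1) / 2, ?_, ?_⟩
          · simp only [Finset.coe_Icc, Set.mem_Icc]; obtain ⟨k, hk⟩ := h; omega
          · obtain ⟨k, hk⟩ := h
            simp only; omega
      · intro k hk
        have hk1 := (Finset.mem_Icc.1 hk).1
        rw [show 2 * k - 1 + 1 = 2 * k by omega]
        push_cast
        rw [Chebyshev.T_eval_two_mul_zero]
        simp [mul_comm, Int.negOnePow]
  rw [h1, Finset.sum_Icc_of_even_eq_range he]
  simp only [Int.natAbs_natCast, h2]
  have h3 := intC_coeff_zero u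
  change F.coeff 0 = _ at h3
  simp only [nsmul_eq_mul, Int.natAbs_zero, Chebyshev.T_zero, eval_one]
  change _ = -2 * ∑ k ∈ Finset.Icc 1 ((u.deg + 1) / 2), (-1) ^ k * F.coeff (2 * k) at h3
  push_cast
  linarith

/-- `intC` computes the antiderivative vanishing at `0`. -/
lemma aeval_intC {u : ChebVec} (hu : u.WF) (x : ℝ) :
    aeval x u.intC.val.toPoly = ∫ t in (0 : ℝ)..x, aeval t u.toPoly := by
  have h := intervalIntegral.integral_eq_sub_of_hasDerivAt (a := 0) (b := x)
    (f := fun t => aeval t u.intC.val.toPoly) (f' := fun t => aeval t u.toPoly)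
    (fun t _ => by
      rw [← derivative_intC_toPoly hu]
      exact Polynomial.hasDerivAt_aeval _ _)
    ((Polynomial.continuous_aeval _).intervalIntegrable _ _)
  rw [h]
  have h0 : aeval (0 : ℝ) u.intC.val.toPoly = 0 := by
    have := congrArg (algebraMap ℚ ℝ) (eval_zero_intC_toPoly u)
    rw [map_zero] at this
    rwa [← aeval_algebraMap_apply_eq_algebraMap_eval, map_zero] at this
  rw [h0, sub_zero]

end ChebVec

/-! ### Conversion from the monomial basis -/

/-- This is the binomial expansion of `((z + z⁻¹)/2)^k`, proved by induction from `X T_n = (T_{n+1}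
+ T_{n-1})/2` and Pascal's rule. -/
lemma X_pow_eq_sum_T (k : ℕ) :
    (X : ℚ[X]) ^ k = ∑ j ∈ Finset.range (k + 1),
      C ((k.choose j : ℚ) / 2 ^ k) * Chebyshev.T ℚ ((k : ℤ) - 2 * j) := by
  have hX : ∀ n : ℤ, X * Chebyshev.T ℚ n
      = C (1 / 2) * (Chebyshev.T ℚ (n + 1) + Chebyshev.T ℚ (n - 1)) := by
    intro n
    rw [Chebyshev.T_add_one, sub_add_cancel, ← mul_assoc, ← mul_assoc,
      show C (1 / 2 : ℚ) * 2 = 1 by rw [← C_ofNat, ← C_mul]; norm_num, one_mul]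
  induction k with
  | zero => simp
  | succ k ih =>
    rw [pow_succ', ih, Finset.mul_sum]
    have h1 : ∀ j : ℕ, X * (C ((k.choose j : ℚ) / 2 ^ k) * Chebyshev.T ℚ ((k : ℤ) - 2 * j))
        = C ((k.choose j : ℚ) / 2 ^ (k + 1)) * Chebyshev.T ℚ (((k + 1 : ℕ) : ℤ) - 2 * j)
          + C ((k.choose j : ℚ) / 2 ^ (k + 1)) * Chebyshev.T ℚ (((k + 1 : ℕ) : ℤ) - 2 * (j + 1 : ℕ)) := by
      intro j
      rw [mul_left_comm, hX, ← mul_assoc, ← C_mul, ← mul_add]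
      rw [show (k : ℤ) - 2 * j + 1 = ((k + 1 : ℕ) : ℤ) - 2 * j by push_cast; ring,
        show (k : ℤ) - 2 * j - 1 = ((k + 1 : ℕ) : ℤ) - 2 * (j + 1 : ℕ) by push_cast; ring]
      congr 2
      rw [pow_succ]
      field_simp
    simp only [h1]
    rw [Finset.sum_add_distrib, Finset.sum_range_succ' _ (k + 1)]
    have h2 : ∀ j : ℕ, C (((k + 1).choose (j + 1) : ℚ) / 2 ^ (k + 1))
          * Chebyshev.T ℚ (((k + 1 : ℕ) : ℤ) - 2 * (j + 1 : ℕ))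
        = C ((k.choose j : ℚ) / 2 ^ (k + 1)) * Chebyshev.T ℚ (((k + 1 : ℕ) : ℤ) - 2 * (j + 1 : ℕ))
        + C ((k.choose (j + 1) : ℚ) / 2 ^ (k + 1))
          * Chebyshev.T ℚ (((k + 1 : ℕ) : ℤ) - 2 * (j + 1 : ℕ)) := by
      intro j
      rw [Nat.choose_succ_succ, Nat.cast_add, add_div, C_add, add_mul]
    simp only [h2]
    rw [Finset.sum_add_distrib, add_comm, add_assoc]
    congr 1
    rw [Finset.sum_range_succ', Finset.sum_range_succ _ k]
    simp

lemma chebCoeff_eq_zero (f : ℚ[X]) {n : ℕ} (hn : f.natDegree < n) : chebCoeff f n = 0 :=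
  Finset.sum_eq_zero fun k hk => by
    rw [if_neg]; rw [Finset.mem_range] at hk; omega

lemma chebCoeff_natDegree (f : ℚ[X]) :
    chebCoeff f f.natDegree = f.leadingCoeff / 2 ^ f.natDegree := by
  rw [chebCoeff, Finset.sum_eq_single f.natDegree]
  · simp
  · intro k hk hk'
    rw [if_neg]; rw [Finset.mem_range] at hk; omega
  · simp

lemma ChebVec.ofPoly_wf (f : ℚ[X]) : (ofPoly f).WF := fun _ hn => chebCoeff_eq_zero f hn

lemma ChebVec.ofPoly_toPoly (f : ℚ[X]) : (ofPoly f).toPoly = f := by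
  have h1 : (ofPoly f).toPoly = ∑ k ∈ Finset.range (f.natDegree + 1),
      ∑ n ∈ Finset.Icc (-(f.natDegree : ℤ)) f.natDegree,
        if n.natAbs ≤ k ∧ Even (k - n.natAbs) then
          C (f.coeff k * (k.choose ((k - n.natAbs) / 2) : ℚ) / 2 ^ k) * Chebyshev.T ℚ n else 0 := by
    rw [Finset.sum_comm, toPoly]
    refine Finset.sum_congr rfl fun n _ => ?_
    simp only [ofPoly, chebCoeff, map_sum, Finset.sum_mul]
    refine Finset.sum_congr rfl fun k _ => ?_
    split_ifs <;> simp
  rw [h1]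
  conv_rhs => rw [f.as_sum_range_C_mul_X_pow]
  refine Finset.sum_congr rfl fun k hk => ?_
  rw [Finset.mem_range] at hk
  rw [X_pow_eq_sum_T, Finset.mul_sum]
  symm
  refine Finset.sum_of_injOn (fun j : ℕ => (k : ℤ) - 2 * j) ?_ ?_ ?_ ?_
  · intro a _ b _ hab
    simp only at hab
    omega
  · intro j hj
    simp only [Finset.coe_range, Set.mem_Iio, Finset.coe_Icc, Set.mem_Icc] at hj ⊢
    omega
  · intro n _ hn'
    rw [if_neg]
    rintro ⟨h2, h3⟩
    obtain ⟨e, he⟩ := h3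
    refine hn' ⟨(((k : ℤ) - n) / 2).toNat, ?_, ?_⟩
    · simp only [Finset.coe_range, Set.mem_Iio]; omega
    · simp only; omega
  · intro j hj
    rw [Finset.mem_range] at hj
    have hev : Even (k - ((k : ℤ) - 2 * j).natAbs) := by
      rcases le_total (2 * j) k with h | h
      · exact ⟨j, by omega⟩
      · exact ⟨k - j, by omega⟩
    rw [← mul_assoc, ← C_mul, if_pos ⟨by omega, hev⟩]
    congr 2
    -- When `2j > k` the index `k - 2j` is negative and `chebCoeff` reads the binomial at `k - j`;
    -- the two agree by symmetry of the binomials.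
    rcases le_total (2 * j) k with h | h
    · rw [show (k - ((k : ℤ) - 2 * j).natAbs) / 2 = j by omega]; ring
    · rw [show (k - ((k : ℤ) - 2 * j).natAbs) / 2 = k - j by omega, Nat.choose_symm (by omega)]
      ring

/-! ### Evaluation on the unit circle -/

lemma T_eval_joukowski {z : ℂ} (hz : z ≠ 0) (n : ℤ) :
    (Chebyshev.T ℂ n).eval ((z + z⁻¹) / 2) = (z ^ n + z ^ (-n)) / 2 := by
  induction n using Polynomial.Chebyshev.induct' with
  | zero => simp
  | one => simp
  | add_two n ih1 ih2 =>
    rw [Chebyshev.T_add_two]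
    simp only [eval_sub, eval_mul, eval_X, eval_ofNat, ih1, ih2]
    rw [neg_add, neg_add, zpow_add₀ hz, zpow_add₀ hz, zpow_add₀ hz, zpow_add₀ hz]
    simp only [zpow_neg, zpow_natCast, zpow_ofNat]
    field_simp
    ring
  | neg n ih => rw [Chebyshev.T_neg, ih, neg_neg, add_comm]

/-- Turns a Chebyshev expansion into a symmetric Laurent polynomial, so that questions on `[-1, 1]`
become Fourier analysis on the unit circle. -/
lemma ChebVec.aeval_joukowski (u : ChebVec) {z : ℂ} (hz : z ≠ 0) :
    aeval ((z + z⁻¹) / 2) u.toPoly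
      = ∑ n ∈ Finset.Icc (-(u.deg : ℤ)) u.deg, (u.coeff n.natAbs : ℂ) * z ^ n := by
  have h : ∀ s : ℤ, ∑ n ∈ Finset.Icc (-(u.deg : ℤ)) u.deg, (u.coeff n.natAbs : ℂ) * z ^ (-n)
      = ∑ n ∈ Finset.Icc (-(u.deg : ℤ)) u.deg, (u.coeff n.natAbs : ℂ) * z ^ n := by
    intro s
    refine Finset.sum_nbij' (fun i => -i) (fun i => -i) ?_ ?_ ?_ ?_ ?_
    · intro i hi; simp only [Finset.mem_Icc] at *; omega
    · intro i hi; simp only [Finset.mem_Icc] at *; omega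
    · intro i _; simp
    · intro i _; simp
    · intro i _; rw [Int.natAbs_neg]
  rw [toPoly, map_sum]
  have h2 : ∀ n : ℤ, aeval ((z + z⁻¹) / 2) (C (u.coeff n.natAbs) * Chebyshev.T ℚ n)
      = (1 / 2 : ℂ) * ((u.coeff n.natAbs : ℂ) * z ^ n + (u.coeff n.natAbs : ℂ) * z ^ (-n)) := by
    intro n
    rw [map_mul, aeval_C, Chebyshev.aeval_T, T_eval_joukowski hz, eq_ratCast]
    ring
  simp only [h2]
  rw [← Finset.mul_sum, Finset.sum_add_distrib, h 0]
  ring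

lemma ChebVec.hasSum_joukowski {u : ChebVec} (hu : u.WF) {z : ℂ} (hz : z ≠ 0) :
    HasSum (fun n : ℤ => (u.coeff n.natAbs : ℂ) * z ^ n) (aeval ((z + z⁻¹) / 2) u.toPoly) := by
  rw [u.aeval_joukowski hz]
  refine hasSum_sum_of_ne_finset_zero fun n hn => ?_
  rw [Finset.mem_Icc] at hn
  rw [hu _ (by omega)]; simp

lemma exists_joukowski {x : ℝ} (hx : x ∈ Set.Icc (-1 : ℝ) 1) :
    ∃ z : ℂ, ‖z‖ = 1 ∧ (z + z⁻¹) / 2 = x := by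
  refine ⟨Complex.exp (Real.arccos x * Complex.I), Complex.norm_exp_ofReal_mul_I _, ?_⟩
  rw [← Complex.exp_neg, ← neg_mul, ← Complex.cos, ← Complex.ofReal_cos,
    Real.cos_arccos hx.1 hx.2]

lemma joukowski_eq_re {z : ℂ} (hz : ‖z‖ = 1) : (z + z⁻¹) / 2 = (z.re : ℂ) := by
  rw [Complex.inv_eq_conj hz, Complex.add_conj]
  simp

lemma re_mem_Icc {z : ℂ} (hz : ‖z‖ = 1) : z.re ∈ Set.Icc (-1 : ℝ) 1 :=
  abs_le.1 (hz ▸ Complex.abs_re_le_norm z)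

lemma ne_zero_of_norm_one {z : ℂ} (hz : ‖z‖ = 1) : z ≠ 0 := by
  rintro rfl; simp at hz

lemma aeval_ofReal (f : ℚ[X]) (x : ℝ) : aeval (x : ℂ) f = ((aeval x f : ℝ) : ℂ) :=
  (aeval_algebraMap_apply ℂ x f)

/-! ### Euclidean division on the Chebyshev basis -/

/-- The coefficients of `(T_k + T_{-k}) b` for `k > 0`, and of `b` for `k = 0`. -/
def shiftCoeff (b : ChebVec) (k j : ℕ) : ℚ :=
  if k = 0 then b.coeff j else b.coeff ((j : ℤ) - k).natAbs + b.coeff (j + k)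

/-- Each pass reads and writes only its own position `a + t`, so the passes do not interact and the
loop is a pointwise map on the window. -/
lemma forLoop_update_val (N a : ℕ) (F : ℕ → ℚ → ℚ) (step : ℕ → (ℕ → ℚ) → Counted (ℕ → ℚ))
    (hstep : ∀ t r, (step t r).val = Function.update r (a + t) (F (a + t) (r (a + t))))
    (r : ℕ → ℚ) (j : ℕ) :
    (forLoop N step r).val j = if a ≤ j ∧ j < a + N then F j (r j) else r j := by
  induction N with
  | zero => rw [if_neg (by omega)]; rfl
  | succ N ih =>
    rw [forLoop_succ_val, hstep]
    by_cases hj : j = a + N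
    · subst hj
      rw [Function.update_self, ih, if_neg (by omega), if_pos (by omega)]
    · rw [Function.update_of_ne hj, ih]
      by_cases h : a ≤ j ∧ j < a + N
      · rw [if_pos h, if_pos (by omega)]
      · rw [if_neg h, if_neg (by omega)]

lemma divStep_quo (b : ChebVec) (n : ℕ) (st : DivState) :
    (divStep b n st).val.quo
      = Function.update st.quo (n - b.deg) (st.rem n / b.coeff b.deg) := rfl

lemma divStep_rem {b : ChebVec} (hb : b.WF) {n : ℕ} (hn : b.deg ≤ n) (st : DivState) (j : ℕ) :
    (divStep b n st).val.rem j
      = st.rem j - st.rem n / b.coeff b.deg * shiftCoeff b (n - b.deg) j := by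
  set k := n - b.deg with hk
  set q := st.rem n / b.coeff b.deg
  have h1 := forLoop_update_val (n + 1 - (k - b.deg)) (k - b.deg)
    (fun j x => x - q * shiftCoeff b k j)
    (fun t rem => do
      let j := (k - b.deg) + t
      let s ← if k = 0 then pure (b.coeff j)
        else addC (b.coeff ((j : ℤ) - k).natAbs) (b.coeff (j + k))
      let v ← mulC q s
      let w ← subC (rem j) v
      pure (Function.update rem j w))
    (fun t r => by
      rw [shiftCoeff]
      split_ifs <;> rfl)
    st.rem j
  refine Eq.trans h1 ?_
  split_ifs with h
  · rfl
  · have : shiftCoeff b k j = 0 := by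
      rw [shiftCoeff]
      split_ifs with h0
      · exact hb _ (by omega)
      · rw [hb _ (by omega), hb _ (by omega), add_zero]
    rw [this, mul_zero, sub_zero]

lemma divStep_ops_le (b : ChebVec) (n : ℕ) (st : DivState) :
    (divStep b n st).ops ≤ (1 + (2 * b.deg + 1) * 3 : ℕ) := by
  simp only [divStep, bind_ops, divC_ops, pure_ops, add_zero, divC_val, Nat.cast_add, Nat.cast_one]
  gcongr
  refine (forLoop_ops_le _ _ _ 3 fun t _ r => ?_).trans ?_
  · split_ifs <;> simp <;> norm_num
  · norm_cast
    gcongr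
    omega

/-- Setting the entry `k` of the quotient changes the two-sided sequence at `k` and at `-k`, which
adds `q (b_{n-k} + b_{n+k})`; for `k = 0` the two positions coincide. -/
lemma sum_conv_update {b : ChebVec} (hb : b.WF) (quo : ℕ → ℚ) (k : ℕ) (q : ℚ) (hk : quo k = 0)
    (n : ℕ) :
    ∑ i ∈ Finset.Icc (-(b.deg : ℤ)) b.deg,
        b.coeff i.natAbs * Function.update quo k q ((n : ℤ) - i).natAbs
      = ∑ i ∈ Finset.Icc (-(b.deg : ℤ)) b.deg, b.coeff i.natAbs * quo ((n : ℤ) - i).natAbs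
        + q * shiftCoeff b k n := by
  have hsplit : ∀ j, Function.update quo k q j = quo j + if j = k then q else 0 := by
    intro j
    by_cases h : j = k
    · subst h; simp [hk]
    · simp [h]
  simp only [hsplit, mul_add, Finset.sum_add_distrib, add_right_inj, mul_ite, mul_zero]
  have hone : ∀ l : ℤ, ∑ i ∈ Finset.Icc (-(b.deg : ℤ)) b.deg,
      (if i = l then b.coeff i.natAbs * q else 0) = b.coeff l.natAbs * q := by
    intro l
    rw [Finset.sum_ite_eq']
    split_ifs with h
    · rfl
    · rw [Finset.mem_Icc] at h
      rw [hb _ (by omega), zero_mul]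
  rw [shiftCoeff]
  split_ifs with h0
  · rw [mul_comm q, ← Int.natAbs_natCast n, ← hone n]
    refine Finset.sum_congr rfl fun i _ => ?_
    congr 1
    apply propext
    simp only [Int.natAbs_natCast]
    omega
  · rw [mul_comm q, add_mul, ← hone, show n + k = ((n : ℤ) + k).natAbs by omega, ← hone,
      ← Finset.sum_add_distrib]
    refine Finset.sum_congr rfl fun i _ => ?_
    by_cases h1 : i = (n : ℤ) - k
    · rw [if_pos (by omega), if_pos h1, if_neg (by omega), add_zero]
    · by_cases h2 : i = (n : ℤ) + k
      · rw [if_pos (by omega), if_neg h1, if_pos h2, zero_add]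
      · rw [if_neg (by omega), if_neg h1, if_neg h2, zero_add]

lemma shiftCoeff_diag {b : ChebVec} (hb : b.WF) {n : ℕ} (hn : b.deg ≤ n) :
    shiftCoeff b (n - b.deg) n = b.coeff b.deg := by
  rw [shiftCoeff]
  split_ifs with h
  · rw [show n = b.deg by omega]
  · rw [show ((n : ℤ) - (n - b.deg : ℕ)).natAbs = b.deg by omega, hb (n + (n - b.deg)) (by omega),
      add_zero]

lemma shiftCoeff_eq_zero {b : ChebVec} (hb : b.WF) {k j : ℕ} (hj : k + b.deg < j) :
    shiftCoeff b k j = 0 := by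
  rw [shiftCoeff]
  split_ifs with h
  · exact hb _ (by omega)
  · rw [hb _ (by omega), hb _ (by omega), add_zero]

/-- Specification of the Euclidean division. -/
lemma divModC_spec {f b : ChebVec} (hf : f.WF) (hb : b.WF) (hlead : b.coeff b.deg ≠ 0)
    {β M : ℚ} (hβ : ∀ j, |b.coeff j| ≤ β) (hM : ∀ j, |f.coeff j| ≤ M) :
    (∀ n : ℕ, f.coeff n = ∑ i ∈ Finset.Icc (-(b.deg : ℤ)) b.deg,
        b.coeff i.natAbs * (divModC f b).val.quo ((n : ℤ) - i).natAbs
        + (divModC f b).val.rem n) ∧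
    (∀ j, (divModC f b).val.quo j ≠ 0 → j + b.deg ≤ f.deg) ∧
    (∀ j, b.deg ≤ j → (divModC f b).val.rem j = 0) ∧
    (∀ j, |(divModC f b).val.rem j| ≤ (1 + 2 * β / |b.coeff b.deg|) ^ (f.deg + 1 - b.deg) * M) := by
  set κ := 1 + 2 * β / |b.coeff b.deg| with hκ
  have hlead' : 0 < |b.coeff b.deg| := abs_pos.2 hlead
  have hβ0 : 0 ≤ β := (abs_nonneg _).trans (hβ 0)
  -- Besides `f = b * quo + rem`, the invariant records that the quotient is filled only at the
  -- degrees already treated (so the entry about to be written is `0`), that the remainder vanishes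
  -- above the current degree, and that a step multiplies its size by at most `κ`. This growth is
  -- exponential, but only its logarithm enters the cost.
  have H := forLoop_induct (fun t (st : DivState) =>
    (∀ n : ℕ, f.coeff n = ∑ i ∈ Finset.Icc (-(b.deg : ℤ)) b.deg,
        b.coeff i.natAbs * st.quo ((n : ℤ) - i).natAbs + st.rem n) ∧
    (∀ j, st.quo j ≠ 0 → j + b.deg ≤ f.deg ∧ f.deg < j + b.deg + t) ∧
    (∀ j, f.deg < j + t → st.rem j = 0) ∧
    (∀ j, |st.rem j| ≤ κ ^ t * M)) (f.deg + 1 - b.deg)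
    (fun t st => divStep b (f.deg - t) st) ⟨fun _ => 0, f.coeff⟩ ?_ ?_
  · obtain ⟨h1, h2, h3, h4⟩ := H
    refine ⟨h1, fun j hj => (h2 j hj).1, fun j hj => h3 j ?_, h4⟩
    omega
  · exact ⟨by simp, by simp, fun j hj => hf j (by simpa using hj), by simpa using hM⟩
  · rintro t ht st ⟨h1, h2, h3, h4⟩
    have hn : b.deg ≤ f.deg - t := by omega
    have hq0 : st.quo (f.deg - t - b.deg) = 0 := by
      by_contra h
      have := h2 _ h
      omega
    refine ⟨fun n => ?_, fun j hj => ?_, fun j hj => ?_, fun j => ?_⟩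
    · rw [divStep_quo, divStep_rem hb hn, sum_conv_update hb _ _ _ hq0, h1 n]
      ring
    · rw [divStep_quo] at hj
      by_cases hjk : j = f.deg - t - b.deg
      · omega
      · rw [Function.update_of_ne hjk] at hj
        have := h2 j hj
        omega
    · rw [divStep_rem hb hn]
      by_cases hjn : j = f.deg - t
      · subst hjn
        rw [shiftCoeff_diag hb hn, div_mul_cancel₀ _ hlead, sub_self]
      · rw [h3 j (by omega), shiftCoeff_eq_zero hb (by omega), mul_zero, sub_zero]
    · rw [divStep_rem hb hn]
      have hs : |shiftCoeff b (f.deg - t - b.deg) j| ≤ 2 * β := by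
        rw [shiftCoeff]
        split_ifs
        · linarith [hβ j]
        · have h5 := hβ (((j : ℤ) - (f.deg - t - b.deg : ℕ)).natAbs)
          have h6 := hβ (j + (f.deg - t - b.deg))
          exact (abs_add_le _ _).trans (by linarith)
      calc |st.rem j - st.rem (f.deg - t) / b.coeff b.deg * shiftCoeff b (f.deg - t - b.deg) j|
          ≤ |st.rem j| + |st.rem (f.deg - t)| / |b.coeff b.deg|
              * |shiftCoeff b (f.deg - t - b.deg) j| := by
            rw [← abs_div, ← abs_mul]; exact abs_sub _ _
        _ ≤ κ ^ t * M + κ ^ t * M / |b.coeff b.deg| * (2 * β) := by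
            gcongr
            · exact h4 j
            · exact div_nonneg ((abs_nonneg _).trans (h4 0)) hlead'.le
            · exact h4 _
        _ = κ ^ (t + 1) * M := by rw [pow_succ, hκ]; ring

lemma divModC_ops_le (f b : ChebVec) :
    (divModC f b).ops ≤ ((f.deg + 1) * (1 + (2 * b.deg + 1) * 3) : ℕ) := by
  refine (forLoop_ops_le _ _ _ _ fun t _ st => divStep_ops_le b _ st).trans ?_
  norm_cast
  gcongr
  omega

/-! ### Operation counts for Chebyshev vectors -/

namespace ChebVec

lemma addC_ops_le (u v : ChebVec) : (u.addC v).ops ≤ (max u.deg v.deg + 1 : ℕ) := by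
  simpa [ChebVec.addC] using buildC_ops_le (max u.deg v.deg) (fun n => ChebValid.addC (u.coeff n) (v.coeff n)) 1
    fun _ _ => le_rfl

lemma subC_ops_le (u v : ChebVec) : (u.subC v).ops ≤ (max u.deg v.deg + 1 : ℕ) := by
  simpa [ChebVec.subC] using buildC_ops_le (max u.deg v.deg) (fun n => ChebValid.subC (u.coeff n) (v.coeff n)) 1
    fun _ _ => le_rfl

lemma mulC_ops_le (u v : ChebVec) :
    (u.mulC v).ops ≤ ((u.deg + v.deg + 1) * ((2 * u.deg + 1) * 2) : ℕ) := by
  refine (buildC_ops_le _ _ ((2 * u.deg + 1) * 2 : ℕ) fun n _ => ?_).trans_eq (by push_cast; ring)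
  refine (sumC_ops_le _ _ 1 fun _ _ => le_rfl).trans_eq ?_
  rw [Int.card_Icc, show ((u.deg : ℤ) + 1 - -(u.deg : ℤ)).toNat = 2 * u.deg + 1 by omega]
  push_cast; norm_num

lemma intC_ops_le (u : ChebVec) : u.intC.ops ≤ ((u.deg + 2) * 5 + 1 : ℕ) := by
  simp only [intC, bind_ops, pure_ops, add_zero, mulC_ops]
  have h1 := buildC_ops_le (u.deg + 1) (fun n =>
    if n = 0 then pure 0 else do
      let x ← ChebValid.subC (u.coeff (n - 1)) (u.coeff (n + 1))
      let y ← ChebValid.mulC 2 n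
      divC x y) 3 (fun n _ => by split_ifs <;> simp; norm_num)
  refine (add_le_add h1 (add_le_add (sumC_ops_le _ _ 1 fun _ _ => le_rfl) le_rfl)).trans ?_
  rw [Nat.card_Icc]
  norm_num
  norm_cast
  omega

lemma boundC_ops_le (u : ChebVec) : u.boundC.ops ≤ ((2 * u.deg + 1) * 2 : ℕ) := by
  refine (sumC_ops_le _ _ 1 fun _ _ => le_rfl).trans_eq ?_
  rw [Int.card_Icc, show ((u.deg : ℤ) + 1 - -(u.deg : ℤ)).toNat = 2 * u.deg + 1 by omega]
  push_cast; norm_num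

end ChebVec

/-! ### Fourier coefficients on the unit circle -/

lemma integral_exp_zpow (n : ℤ) :
    ∫ θ in (0 : ℝ)..(2 * Real.pi), Complex.exp (θ * Complex.I) ^ n
      = if n = 0 then (2 * Real.pi : ℂ) else 0 := by
  split_ifs with h
  · subst h; simp
  · have h1 : ∀ θ : ℝ, Complex.exp (θ * Complex.I) ^ n = Complex.exp ((n * Complex.I) * θ) :=
      fun θ => by rw [← Complex.exp_int_mul]; ring_nf
    have hc : (n * Complex.I : ℂ) ≠ 0 := mul_ne_zero (by exact_mod_cast h) Complex.I_ne_zero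
    simp only [h1]
    rw [integral_exp_mul_complex hc]
    have : Complex.exp (n * Complex.I * (2 * Real.pi : ℝ)) = 1 := by
      rw [← Complex.exp_int_mul_two_pi_mul_I n]
      congr 1; push_cast; ring
    rw [this]; simp

/-- An absolutely convergent Laurent series vanishing on the unit circle is zero. -/
lemma eq_zero_of_hasSum_circle {u : ℤ → ℂ} (hu : Summable fun n => ‖u n‖)
    (h : ∀ z : ℂ, ‖z‖ = 1 → HasSum (fun n : ℤ => u n * z ^ n) 0) (k : ℤ) : u k = 0 := by
  -- Multiplying by `z ^ (-k)` and integrating over the circle isolates `u k`; absolute summability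
  -- allows the exchange of sum and integral.
  let f : ℤ → C(ℝ, ℂ) := fun n =>
    ⟨fun θ => u n * Complex.exp (θ * Complex.I) ^ (n - k), by
      have : ∀ θ : ℝ, Complex.exp (θ * Complex.I) ≠ 0 := fun θ => Complex.exp_ne_zero _
      refine continuous_const.mul (Continuous.zpow₀ (by fun_prop) _ fun θ => Or.inl (this θ))⟩
  have hf : Summable fun n => ‖(f n).restrict
      (⟨Set.uIcc 0 (2 * Real.pi), isCompact_uIcc⟩ : TopologicalSpace.Compacts ℝ)‖ := by
    refine hu.of_nonneg_of_le (fun _ => norm_nonneg _) fun n => ?_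
    rw [ContinuousMap.norm_le _ (norm_nonneg _)]
    intro θ
    simp [f, Complex.norm_exp_ofReal_mul_I]
  have h1 := intervalIntegral.hasSum_intervalIntegral_of_summable_norm hf
  have h2 : ∀ θ : ℝ, ∑' n, f n θ = 0 := by
    intro θ
    have hz : ‖Complex.exp (θ * Complex.I)‖ = 1 := Complex.norm_exp_ofReal_mul_I θ
    have h3 := (h _ hz).mul_right (Complex.exp (θ * Complex.I) ^ (-k))
    rw [zero_mul] at h3
    refine (h3.congr_fun fun n => ?_).tsum_eq
    simp only [f, ContinuousMap.coe_mk]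
    rw [sub_eq_add_neg, zpow_add₀ (Complex.exp_ne_zero _), mul_assoc]
  simp only [h2, intervalIntegral.integral_zero] at h1
  have h3 : ∀ n, ∫ θ in (0 : ℝ)..(2 * Real.pi), f n θ = if n = k then u k * (2 * Real.pi) else 0 := by
    intro n
    simp only [f, ContinuousMap.coe_mk]
    rw [intervalIntegral.integral_const_mul, integral_exp_zpow]
    by_cases hn : n = k
    · subst hn; simp
    · rw [if_neg (sub_ne_zero.2 hn), if_neg hn, mul_zero]
  simp only [h3] at h1
  have h4 := (hasSum_ite_eq k (u k * (2 * Real.pi : ℂ))).unique h1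
  have hpi : (2 * Real.pi : ℂ) ≠ 0 := by
    have := Real.pi_ne_zero
    exact mul_ne_zero two_ne_zero (by exact_mod_cast this)
  exact (mul_eq_zero.1 h4).resolve_right hpi

/-- Bessel's inequality for a polynomial bounded on `[-1, 1]`. -/
lemma ChebVec.sum_sq_le (u : ChebVec) {S : ℝ}
    (hS : ∀ x ∈ Set.Icc (-1 : ℝ) 1, |aeval x u.toPoly| ≤ S) :
    ∑ n ∈ Finset.Icc (-(u.deg : ℤ)) u.deg, (u.coeff n.natAbs : ℝ) ^ 2 ≤ S ^ 2 := by
  set I := Finset.Icc (-(u.deg : ℤ)) u.deg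
  set G : ℝ → ℝ := fun θ => aeval (Real.cos θ) u.toPoly with hG
  set e : ℝ → ℂ := fun θ => Complex.exp (θ * Complex.I) with he
  have he0 : ∀ θ, e θ ≠ 0 := fun θ => Complex.exp_ne_zero _
  have hJ : ∀ θ, (e θ + (e θ)⁻¹) / 2 = (Real.cos θ : ℝ) := fun θ => by
    rw [joukowski_eq_re (Complex.norm_exp_ofReal_mul_I θ), Complex.exp_ofReal_mul_I_re]
  have hJ' : ∀ θ, ((e θ)⁻¹ + (e θ)⁻¹⁻¹) / 2 = (Real.cos θ : ℝ) := fun θ => by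
    rw [← hJ, inv_inv, add_comm]
  have h1 : ∀ θ, (G θ : ℂ) = ∑ n ∈ I, (u.coeff n.natAbs : ℂ) * e θ ^ n := fun θ => by
    rw [← u.aeval_joukowski (he0 θ), hJ, aeval_ofReal]
  have h2 : ∀ θ, (G θ : ℂ) = ∑ n ∈ I, (u.coeff n.natAbs : ℂ) * (e θ)⁻¹ ^ n := fun θ => by
    rw [← u.aeval_joukowski (inv_ne_zero (he0 θ)), hJ', aeval_ofReal]
  -- One factor is expanded in `e^{iθ}` and the other in `e^{-iθ}`, both giving the same real value,
  -- so that orthogonality keeps the diagonal terms only.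
  have h3 : ∀ θ, ((G θ ^ 2 : ℝ) : ℂ)
      = ∑ n ∈ I, ∑ k ∈ I, (u.coeff n.natAbs : ℂ) * u.coeff k.natAbs * e θ ^ (n - k) := fun θ => by
    push_cast
    rw [sq]
    nth_rw 1 [h1]
    rw [h2, Finset.sum_mul_sum]
    refine Finset.sum_congr rfl fun n _ => Finset.sum_congr rfl fun k _ => ?_
    rw [sub_eq_add_neg, zpow_add₀ (he0 θ), zpow_neg, inv_zpow]
    ring
  have hInt : ∀ n : ℤ, IntervalIntegrable (fun θ : ℝ => e θ ^ n) MeasureTheory.volume 0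
      (2 * Real.pi) := fun n => by
    refine Continuous.intervalIntegrable ?_ _ _
    exact Continuous.zpow₀ (by fun_prop) _ fun θ => Or.inl (he0 θ)
  have h4 : ((∫ θ in (0 : ℝ)..(2 * Real.pi), G θ ^ 2 : ℝ) : ℂ)
      = ∑ n ∈ I, (u.coeff n.natAbs : ℂ) ^ 2 * (2 * Real.pi) := by
    rw [← intervalIntegral.integral_ofReal]
    simp only [h3]
    rw [intervalIntegral.integral_finsetSum]
    · refine Finset.sum_congr rfl fun n hn => ?_
      rw [intervalIntegral.integral_finsetSum]
      · have : ∀ k : ℤ, ∫ θ in (0 : ℝ)..(2 * Real.pi),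
            (u.coeff n.natAbs : ℂ) * u.coeff k.natAbs * e θ ^ (n - k)
            = if n = k then (u.coeff n.natAbs : ℂ) ^ 2 * (2 * Real.pi) else 0 := by
          intro k
          rw [intervalIntegral.integral_const_mul, integral_exp_zpow]
          by_cases hk : n = k
          · subst hk; simp [sq]
          · rw [if_neg (sub_ne_zero.2 hk), if_neg hk, mul_zero]
        simp only [this]
        rw [Finset.sum_ite_eq, if_pos hn]
      · intro k _
        exact (hInt _).const_mul _
    · intro n _
      have := IntervalIntegrable.sum I (f := fun k θ =>
        (u.coeff n.natAbs : ℂ) * u.coeff k.natAbs * e θ ^ (n - k)) fun k _ => (hInt _).const_mul _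
      rwa [Finset.sum_fn] at this
  have h5 : ∫ θ in (0 : ℝ)..(2 * Real.pi), G θ ^ 2
      = (∑ n ∈ I, (u.coeff n.natAbs : ℝ) ^ 2) * (2 * Real.pi) := by
    rw [Finset.sum_mul]
    exact_mod_cast h4
  have h6 : ∫ θ in (0 : ℝ)..(2 * Real.pi), G θ ^ 2 ≤ ∫ _ in (0 : ℝ)..(2 * Real.pi), S ^ 2 := by
    refine intervalIntegral.integral_mono_on (by positivity) ?_ (by simp) fun θ _ => ?_
    · refine Continuous.intervalIntegrable ?_ _ _
      exact ((Polynomial.continuous_aeval _).comp Real.continuous_cos).pow 2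
    · rw [← sq_abs]
      exact pow_le_pow_left₀ (abs_nonneg _) (hS _ ⟨Real.neg_one_le_cos θ, Real.cos_le_one θ⟩) 2
  rw [h5, intervalIntegral.integral_const, smul_eq_mul, sub_zero, mul_comm _ (S ^ 2)] at h6
  exact le_of_mul_le_mul_right h6 (by positivity)

/-! ### Partial fractions -/

section PartialFractions

variable (β N : ℂ[X])

/-- The Taylor coefficients at `ζ` of the quotient of `N` by `β / (X - ζ) ^ μ`. -/
def quotCoeff (μ : ℕ) (ζ : ℂ) (l : ℕ) : ℂ :=
  PowerSeries.coeff l (((taylor ζ N : ℂ[X]) : PowerSeries ℂ) *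
      (PowerSeries.mk fun l => (taylor ζ β).coeff (μ + l))⁻¹)

lemma pfNum_eq (μ j : ℕ) (ζ : ℂ) : pfNum β N μ j ζ = (-1) ^ j * quotCoeff β N μ ζ (μ - j) := rfl

/-- The polynomial `β` times the polar part at `ζ` of `N / β`. -/
def polarPart (ζ : ℂ) : ℂ[X] :=
  (β /ₘ (X - C ζ) ^ β.rootMultiplicity ζ) *
    ∑ l ∈ Finset.range (β.rootMultiplicity ζ),
      C (quotCoeff β N (β.rootMultiplicity ζ) ζ l) * (X - C ζ) ^ l

variable {β}

lemma taylor_eq_X_pow_mul (ζ : ℂ) :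
    taylor ζ β = X ^ β.rootMultiplicity ζ *
      taylor ζ (β /ₘ (X - C ζ) ^ β.rootMultiplicity ζ) := by
  conv_lhs => rw [← pow_mul_divByMonic_rootMultiplicity_eq β ζ]
  rw [taylor_mul, taylor_pow]
  simp [taylor_apply]

lemma taylor_coeff_rootMultiplicity_ne_zero (hβ : β ≠ 0) (ζ : ℂ) :
    (taylor ζ β).coeff (β.rootMultiplicity ζ) ≠ 0 := by
  rw [taylor_eq_X_pow_mul, coeff_X_pow_mul', if_pos le_rfl, Nat.sub_self, taylor_coeff_zero]
  exact eval_divByMonic_pow_rootMultiplicity_ne_zero ζ hβ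

/-- Translate `ζ` to `0`: there `β = t^μ γ` with `γ(0) ≠ 0`, and truncating the series `N / γ` at
order `μ` and multiplying back by `γ` leaves an error `O(t^μ)`. -/
lemma dvd_sub_polarPart (hβ : β ≠ 0) (ζ : ℂ) :
    (X - C ζ) ^ β.rootMultiplicity ζ ∣ N - polarPart β N ζ := by
  set μ := β.rootMultiplicity ζ with hμ
  set γ := β /ₘ (X - C ζ) ^ μ with hγ
  set B : PowerSeries ℂ := PowerSeries.mk fun l => (taylor ζ β).coeff (μ + l) with hB
  have hB0 : PowerSeries.constantCoeff B ≠ 0 := by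
    rw [← PowerSeries.coeff_zero_eq_constantCoeff_apply, hB, PowerSeries.coeff_mk, add_zero]
    exact taylor_coeff_rootMultiplicity_ne_zero hβ ζ
  have hBγ : B = ((taylor ζ γ : ℂ[X]) : PowerSeries ℂ) := by
    ext l
    rw [hB, PowerSeries.coeff_mk, taylor_eq_X_pow_mul, ← hμ, ← hγ, Polynomial.coeff_coe,
      coeff_X_pow_mul', if_pos (by omega), Nat.add_sub_cancel_left]
  set Q : PowerSeries ℂ := ((taylor ζ N : ℂ[X]) : PowerSeries ℂ) * B⁻¹ with hQ
  have hQB : Q * B = ((taylor ζ N : ℂ[X]) : PowerSeries ℂ) := by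
    rw [hQ, mul_assoc, PowerSeries.inv_mul_cancel _ hB0, mul_one]
  have key : X ^ μ ∣ taylor ζ (N - polarPart β N ζ) := by
    rw [X_pow_dvd_iff]
    intro n hn
    have h1 : taylor ζ (polarPart β N ζ)
        = taylor ζ γ * ∑ l ∈ Finset.range μ, C (quotCoeff β N μ ζ l) * X ^ l := by
      rw [polarPart, taylor_mul, map_sum, ← hμ]
      congr 1
      refine Finset.sum_congr rfl fun l _ => ?_
      rw [taylor_mul, taylor_C, taylor_pow]
      simp [taylor_apply]
    rw [map_sub, coeff_sub, h1, sub_eq_zero, ← Polynomial.coeff_coe, ← hQB, PowerSeries.coeff_mul,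
      mul_comm (taylor ζ γ), Polynomial.coeff_mul]
    refine Finset.sum_congr rfl fun x hx => ?_
    have hx1 : x.1 < μ := by
      have := Finset.HasAntidiagonal.mem_antidiagonal.1 hx
      omega
    rw [hBγ, Polynomial.coeff_coe, finsetSum_coeff]
    congr 1
    simp only [coeff_C_mul, coeff_X_pow, mul_ite, mul_one, mul_zero]
    rw [Finset.sum_ite_eq, if_pos (Finset.mem_range.2 hx1)]
    rfl
  obtain ⟨q, hq⟩ := key
  refine ⟨taylor (-ζ) q, ?_⟩
  apply taylor_injective ζ
  rw [hq, taylor_mul, taylor_pow, taylor_taylor]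
  simp [taylor_apply]

lemma degree_polarPart_lt (hβ : β ≠ 0) (ζ : ℂ) : (polarPart β N ζ).degree < β.degree := by
  set μ := β.rootMultiplicity ζ with hμ
  set γ := β /ₘ (X - C ζ) ^ μ with hγ
  have hfac : (X - C ζ) ^ μ * γ = β := pow_mul_divByMonic_rootMultiplicity_eq β ζ
  have hγ0 : γ ≠ 0 := by rintro h; rw [h, mul_zero] at hfac; exact hβ hfac.symm
  have hdeg : β.degree = μ + γ.degree := by
    rw [← hfac, degree_mul, degree_pow, degree_X_sub_C, nsmul_one]
  rw [polarPart, degree_mul, hdeg, add_comm (μ : WithBot ℕ)]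
  refine WithBot.add_lt_add_left (degree_ne_bot.2 hγ0) ?_
  rw [← mem_degreeLT]
  refine Submodule.sum_mem _ fun l hl => ?_
  rw [mem_degreeLT]
  rw [← smul_eq_C_mul]
  refine (degree_smul_le _ _).trans_lt ?_
  rw [degree_pow, degree_X_sub_C, nsmul_one]
  exact_mod_cast Finset.mem_range.1 hl

lemma dvd_polarPart_of_ne {ζ ζ' : ℂ} (h : ζ' ≠ ζ) :
    (X - C ζ') ^ β.rootMultiplicity ζ' ∣ polarPart β N ζ := by
  refine Dvd.dvd.mul_right ?_ _
  have h1 : (X - C ζ') ^ β.rootMultiplicity ζ' ∣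
      (X - C ζ) ^ β.rootMultiplicity ζ * (β /ₘ (X - C ζ) ^ β.rootMultiplicity ζ) := by
    rw [pow_mul_divByMonic_rootMultiplicity_eq]
    exact pow_rootMultiplicity_dvd β ζ'
  exact ((pairwise_coprime_X_sub_C Function.injective_id h).pow).dvd_of_dvd_mul_left h1

/-- Partial fraction decomposition. -/
lemma eq_sum_polarPart (hβ : β ≠ 0) (hN : N.degree < β.degree) :
    N = ∑ ζ ∈ β.roots.toFinset, polarPart β N ζ := by
  rw [← sub_eq_zero]
  set D := N - ∑ ζ ∈ β.roots.toFinset, polarPart β N ζ with hD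
  -- Near one root the difference is divisible by the full power of its factor, since the polar
  -- parts at the other roots contain that factor. Coprimality combines all roots, and the degree is
  -- too small for a nonzero multiple of `β`.
  have hdvd : ∏ ζ ∈ β.roots.toFinset, (X - C ζ) ^ β.rootMultiplicity ζ ∣ D := by
    refine Finset.prod_dvd_of_coprime ?_ fun ζ hζ => ?_
    · intro ζ _ ζ' _ h
      exact (pairwise_coprime_X_sub_C Function.injective_id h).pow
    · have : D = (N - polarPart β N ζ)
          - ∑ ζ' ∈ β.roots.toFinset.erase ζ, polarPart β N ζ' := by
        rw [hD, ← Finset.add_sum_erase _ _ hζ]; ring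
      rw [this]
      refine dvd_sub (dvd_sub_polarPart N hβ ζ) (Finset.dvd_sum fun ζ' hζ' => ?_)
      exact dvd_polarPart_of_ne N (Finset.ne_of_mem_erase hζ').symm
  have hprod : ∏ ζ ∈ β.roots.toFinset, (X - C ζ) ^ β.rootMultiplicity ζ
      = (β.roots.map fun a => X - C a).prod := by
    rw [Finset.prod_multiset_map_count]
    simp only [count_roots]
  have hβD : β ∣ D := by
    rw [(IsAlgClosed.splits β).eq_prod_roots, ← hprod]
    exact (isUnit_C.2 (leadingCoeff_ne_zero.2 hβ).isUnit).mul_left_dvd.2 hdvd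
  refine Polynomial.eq_zero_of_dvd_of_degree_lt hβD ?_
  rw [degree_eq_natDegree hβ, ← mem_degreeLT] at hN ⊢
  refine Submodule.sub_mem _ hN (Submodule.sum_mem _ fun ζ _ => ?_)
  rw [mem_degreeLT, ← degree_eq_natDegree hβ]
  exact degree_polarPart_lt N hβ ζ

lemma eval_polarPart_div {ζ z : ℂ} (hz : β.eval z ≠ 0) (hζ : ζ ≠ z) :
    (polarPart β N ζ).eval z / β.eval z
      = ∑ j ∈ Finset.Icc 1 (β.rootMultiplicity ζ),
          pfNum β N (β.rootMultiplicity ζ) j ζ * ((ζ - z)⁻¹) ^ j := by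
  set μ := β.rootMultiplicity ζ with hμ
  set γ := β /ₘ (X - C ζ) ^ μ with hγ
  have hfac : (X - C ζ) ^ μ * γ = β := pow_mul_divByMonic_rootMultiplicity_eq β ζ
  have h1 : β.eval z = (z - ζ) ^ μ * γ.eval z := by
    conv_lhs => rw [← hfac]
    simp
  have hγz : γ.eval z ≠ 0 := fun h => hz (by rw [h1, h, mul_zero])
  have hzζ : z - ζ ≠ 0 := sub_ne_zero.2 hζ.symm
  rw [h1, polarPart, ← hμ, ← hγ, eval_mul, eval_finsetSum, mul_comm (γ.eval z),
    mul_div_mul_right _ _ hγz, Finset.sum_div]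
  refine Finset.sum_nbij' (fun l => μ - l) (fun j => μ - j) ?_ ?_ ?_ ?_ ?_
  · intro l hl; simp only [Finset.mem_range, Finset.mem_Icc] at *; omega
  · intro l hl; simp only [Finset.mem_range, Finset.mem_Icc] at *; omega
  · intro l hl; simp only [Finset.mem_range] at *; omega
  · intro l hl; simp only [Finset.mem_Icc] at *; omega
  · intro l hl
    have hl' := Finset.mem_range.1 hl
    rw [pfNum_eq, show μ - (μ - l) = l by omega]
    simp only [eval_mul, eval_C, eval_pow, eval_sub, eval_X]
    rw [show (ζ - z)⁻¹ = -(z - ζ)⁻¹ by rw [← inv_neg, neg_sub], neg_pow ((z - ζ)⁻¹),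
      mul_mul_mul_comm, ← mul_pow, neg_one_mul, neg_neg, one_pow, one_mul, mul_div_assoc]
    congr 1
    rw [inv_pow, ← one_div, div_eq_div_iff (pow_ne_zero _ hzζ) (pow_ne_zero _ hzζ), one_mul,
      ← pow_add, show l + (μ - l) = μ by omega]

/-- The expansion of `(ζ - z) ^ (-j)` in the closed unit disk. -/
lemma hasSum_pos_expansion {ζ z : ℂ} (hζ : 1 < ‖ζ‖) (hz : ‖z‖ = 1) {j : ℕ} (hj : 1 ≤ j) :
    HasSum (fun n : ℕ => ((n + j - 1).choose (j - 1) : ℂ) * ζ⁻¹ ^ (n + j) * z ^ n)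
      ((ζ - z)⁻¹ ^ j) := by
  obtain ⟨k, rfl⟩ : ∃ k, j = k + 1 := ⟨j - 1, by omega⟩
  have hζ0 : ζ ≠ 0 := by rintro rfl; simp at hζ; linarith
  have hr : ‖z / ζ‖ < 1 := by
    rw [norm_div, hz, div_lt_one (by linarith)]; exact hζ
  have h := (hasSum_choose_mul_geometric_of_norm_lt_one k hr).mul_left (ζ⁻¹ ^ (k + 1))
  have hne : ζ - z ≠ 0 := by
    intro h; rw [sub_eq_zero] at h; rw [h, hz] at hζ; exact lt_irrefl _ hζ
  have e : ζ⁻¹ ^ (k + 1) * (1 / (1 - z / ζ) ^ (k + 1)) = (ζ - z)⁻¹ ^ (k + 1) := by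
    rw [one_div, ← inv_pow, ← mul_pow]
    congr 1
    rw [← mul_inv, mul_sub, mul_one, mul_div_cancel₀ _ hζ0]
  rw [e] at h
  refine h.congr_fun fun n => ?_
  rw [show n + (k + 1) - 1 = n + k by omega, Nat.add_sub_cancel, pow_add ζ⁻¹ n, div_pow, inv_pow ζ n]
  field_simp

/-- The expansion of `(ζ - z) ^ (-j)` outside the open unit disk. -/
lemma exists_neg_expansion {ζ : ℂ} (hζ : ‖ζ‖ < 1) {j : ℕ} (hj : 1 ≤ j) :
    ∃ V : ℤ → ℂ, (Summable fun n => ‖V n‖) ∧ (∀ n, 0 ≤ n → V n = 0) ∧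
      ∀ z : ℂ, ‖z‖ = 1 → HasSum (fun n : ℤ => V n * z ^ n) ((ζ - z)⁻¹ ^ j) := by
  obtain ⟨k, rfl⟩ : ∃ k, j = k + 1 := ⟨j - 1, by omega⟩
  let emb : ℕ → ℤ := fun n => -((n : ℤ) + (k + 1))
  have hemb : Function.Injective emb := fun a b h => by simp only [emb] at h; omega
  let c : ℕ → ℂ := fun n => (-1) ^ (k + 1) * (((n + k).choose k : ℂ) * ζ ^ n)
  have hV0 : ∀ n, n ∉ Set.range emb → Function.extend emb c 0 n = 0 := fun n hn => by
    rw [Function.extend_apply' _ _ _ (by simpa using hn)]; rfl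
  refine ⟨Function.extend emb c 0, ?_, fun n hn => hV0 n ?_, fun z hz => ?_⟩
  · rw [← hemb.summable_iff fun n hn => by rw [hV0 n hn, norm_zero]]
    have : Summable fun n : ℕ => ‖((n + k).choose k : ℂ) * ζ ^ n‖ := by
      simpa using (summable_choose_mul_geometric_of_norm_lt_one k
        (r := (‖ζ‖ : ℝ)) (by simpa using hζ))
    refine this.congr fun n => ?_
    simp only [Function.comp_apply, hemb.extend_apply, c, norm_mul, norm_pow, norm_neg, norm_one,
      one_pow, one_mul]
  · rintro ⟨a, rfl⟩
    simp only [emb] at hn; omega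
  · have hz0 := ne_zero_of_norm_one hz
    rw [← hemb.hasSum_iff fun n hn => by rw [hV0 n hn, zero_mul]]
    have hr : ‖ζ / z‖ < 1 := by rw [norm_div, hz, div_one]; exact hζ
    have h := (hasSum_choose_mul_geometric_of_norm_lt_one k hr).mul_left ((-z)⁻¹ ^ (k + 1))
    have e : (-z)⁻¹ ^ (k + 1) * (1 / (1 - ζ / z) ^ (k + 1)) = (ζ - z)⁻¹ ^ (k + 1) := by
      rw [one_div, ← inv_pow, ← mul_pow]
      congr 1
      rw [← mul_inv, mul_sub, mul_one, neg_mul, mul_div_cancel₀ _ hz0]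
      congr 1; ring
    rw [e] at h
    refine h.congr_fun fun n => ?_
    simp only [Function.comp_apply, hemb.extend_apply, c, emb]
    rw [zpow_neg, show (n : ℤ) + ((k : ℤ) + 1) = ((n + (k + 1) : ℕ) : ℤ) by push_cast; ring,
      zpow_natCast, pow_add z, div_pow, inv_neg, neg_pow z⁻¹, inv_pow z]
    field_simp

/-- The Laurent coefficients of `N / β` on the unit circle, for nonnegative indices. -/
def laurentCoeff (β N : ℂ[X]) (S : Finset ℂ) (n : ℕ) : ℂ :=
  ∑ ζ ∈ S, ∑ j ∈ Finset.Icc 1 (β.rootMultiplicity ζ),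
    ((n + j - 1).choose (j - 1) : ℂ) * pfNum β N (β.rootMultiplicity ζ) j ζ * ζ⁻¹ ^ (n + j)

/-- Roots outside the circle contribute only nonnegative powers of `z`, roots inside only negative
ones. Invariance under `z ↦ z⁻¹` and uniqueness of absolutely convergent Laurent series make the
coefficients even in `n`, so the outer roots alone give all of them. -/
lemma hasSum_laurentCoeff (hβ : β ≠ 0) (hcircle : ∀ z, ‖z‖ = 1 → β.eval z ≠ 0)
    (hN : N.degree < β.degree)
    (hsymm : ∀ z, ‖z‖ = 1 → N.eval z⁻¹ / β.eval z⁻¹ = N.eval z / β.eval z)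
    {S : Finset ℂ} (hS : ∀ z, z ∈ S ↔ β.IsRoot z ∧ 1 < ‖z‖) :
    (Summable fun n : ℤ => ‖laurentCoeff β N S n.natAbs‖) ∧
    ∀ z : ℂ, ‖z‖ = 1 → HasSum (fun n : ℤ => laurentCoeff β N S n.natAbs * z ^ n)
      (N.eval z / β.eval z) := by
  classical
  set S' := β.roots.toFinset \ S with hS'
  have hSsub : S ⊆ β.roots.toFinset := fun z hz => by
    rw [Multiset.mem_toFinset, mem_roots hβ]; exact ((hS z).1 hz).1
  have hin : ∀ ζ ∈ S', ‖ζ‖ < 1 := fun ζ hζ => by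
    rw [hS', Finset.mem_sdiff, Multiset.mem_toFinset, mem_roots hβ, hS] at hζ
    rcases lt_trichotomy ‖ζ‖ 1 with h | h | h
    · exact h
    · exact absurd hζ.1 (hcircle ζ h)
    · exact absurd ⟨hζ.1, h⟩ hζ.2
  have hne : ∀ ζ ∈ β.roots.toFinset, ∀ z, ‖z‖ = 1 → ζ ≠ z := fun ζ hζ z hz h => by
    rw [Multiset.mem_toFinset, mem_roots hβ, h] at hζ
    exact hcircle z hz hζ
  have hdec : ∀ z, ‖z‖ = 1 → N.eval z / β.eval z = ∑ ζ ∈ β.roots.toFinset,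
      ∑ j ∈ Finset.Icc 1 (β.rootMultiplicity ζ),
        pfNum β N (β.rootMultiplicity ζ) j ζ * (ζ - z)⁻¹ ^ j := fun z hz => by
    nth_rw 1 [eq_sum_polarPart N hβ hN]
    rw [eval_finsetSum, Finset.sum_div]
    exact Finset.sum_congr rfl fun ζ hζ => eval_polarPart_div N (hcircle z hz) (hne ζ hζ z hz)
  have hV : ∀ ζ : ℂ, ∀ j : ℕ, ∃ V : ℤ → ℂ, ζ ∈ S' → 1 ≤ j →
      (Summable fun n => ‖V n‖) ∧ (∀ n, 0 ≤ n → V n = 0) ∧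
      ∀ z : ℂ, ‖z‖ = 1 → HasSum (fun n : ℤ => V n * z ^ n) ((ζ - z)⁻¹ ^ j) := fun ζ j => by
    by_cases h : ζ ∈ S' ∧ 1 ≤ j
    · obtain ⟨V, hV⟩ := exists_neg_expansion (hin ζ h.1) h.2
      exact ⟨V, fun _ _ => hV⟩
    · exact ⟨0, fun h1 h2 => absurd ⟨h1, h2⟩ h⟩
  choose V hV using hV
  let P : ℤ → ℂ := fun n => if 0 ≤ n then laurentCoeff β N S n.natAbs else 0
  let Q : ℤ → ℂ := fun n => ∑ ζ ∈ S', ∑ j ∈ Finset.Icc 1 (β.rootMultiplicity ζ),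
    pfNum β N (β.rootMultiplicity ζ) j ζ * V ζ j n
  have hQ0 : ∀ n, 0 ≤ n → Q n = 0 := fun n hn =>
    Finset.sum_eq_zero fun ζ hζ => Finset.sum_eq_zero fun j hj => by
      rw [(hV ζ j hζ (Finset.mem_Icc.1 hj).1).2.1 n hn, mul_zero]
  have hQs : Summable fun n => ‖Q n‖ := by
    refine Summable.of_nonneg_of_le (fun _ => norm_nonneg _)
      (fun n => (norm_sum_le _ _).trans (Finset.sum_le_sum fun ζ _ => norm_sum_le _ _)) ?_
    refine summable_sum fun ζ hζ => summable_sum fun j hj => ?_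
    simp only [norm_mul]
    exact (hV ζ j hζ (Finset.mem_Icc.1 hj).1).1.mul_left _
  have hQz : ∀ z, ‖z‖ = 1 → HasSum (fun n => Q n * z ^ n) (∑ ζ ∈ S',
      ∑ j ∈ Finset.Icc 1 (β.rootMultiplicity ζ),
        pfNum β N (β.rootMultiplicity ζ) j ζ * (ζ - z)⁻¹ ^ j) := fun z hz => by
    simp only [Q, Finset.sum_mul]
    refine hasSum_sum fun ζ hζ => hasSum_sum fun j hj => ?_
    simp only [mul_assoc]
    exact ((hV ζ j hζ (Finset.mem_Icc.1 hj).1).2.2 z hz).mul_left _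
  have hcast : Function.Injective (fun n : ℕ => (n : ℤ)) := Nat.cast_injective
  have hP0 : ∀ n, n ∉ Set.range (fun n : ℕ => (n : ℤ)) → P n = 0 := fun n hn => by
    refine if_neg fun h => hn ⟨n.natAbs, by simp [abs_of_nonneg h]⟩
  have hPn : ∀ n : ℕ, P n = laurentCoeff β N S n := fun n => by simp [P]
  have hPz : ∀ z, ‖z‖ = 1 → HasSum (fun n => P n * z ^ n) (∑ ζ ∈ S,
      ∑ j ∈ Finset.Icc 1 (β.rootMultiplicity ζ),
        pfNum β N (β.rootMultiplicity ζ) j ζ * (ζ - z)⁻¹ ^ j) := fun z hz => by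
    rw [← hcast.hasSum_iff fun n hn => by rw [hP0 n hn, zero_mul]]
    simp only [Function.comp_def, hPn, laurentCoeff, Finset.sum_mul, zpow_natCast]
    refine hasSum_sum fun ζ hζ => hasSum_sum fun j hj => ?_
    refine ((hasSum_pos_expansion ((hS ζ).1 hζ).2 hz (Finset.mem_Icc.1 hj).1).mul_left
      (pfNum β N (β.rootMultiplicity ζ) j ζ)).congr_fun fun n => ?_
    ring
  have hPs : Summable fun n => ‖P n‖ := by
    rw [← hcast.summable_iff fun n hn => by rw [hP0 n hn, norm_zero]]
    simp only [Function.comp_def, hPn, laurentCoeff]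
    refine Summable.of_nonneg_of_le (fun _ => norm_nonneg _)
      (fun n => (norm_sum_le _ _).trans (Finset.sum_le_sum fun ζ _ => norm_sum_le _ _)) ?_
    refine summable_sum fun ζ hζ => summable_sum fun j hj => ?_
    have h1 := (hasSum_pos_expansion ((hS ζ).1 hζ).2 norm_one (Finset.mem_Icc.1 hj).1).summable.norm
    refine (h1.mul_left ‖pfNum β N (β.rootMultiplicity ζ) j ζ‖).congr fun n => ?_
    simp only [norm_mul, norm_pow, one_pow, mul_one]
    ring
  have hUz : ∀ z, ‖z‖ = 1 → HasSum (fun n => (P n + Q n) * z ^ n) (N.eval z / β.eval z) :=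
    fun z hz => by
    rw [hdec z hz, ← Finset.sum_sdiff hSsub, add_comm]
    simpa only [add_mul] using (hPz z hz).add (hQz z hz)
  have hUs : Summable fun n => ‖P n + Q n‖ :=
    (hPs.add hQs).of_nonneg_of_le (fun _ => norm_nonneg _) fun n => norm_add_le _ _
  have hU' : ∀ z, ‖z‖ = 1 → HasSum (fun n : ℤ => (P (-n) + Q (-n)) * z ^ n)
      (N.eval z / β.eval z) := fun z hz => by
    have h := hUz z⁻¹ (by rw [norm_inv, hz, inv_one])
    rw [hsymm z hz, ← (Equiv.neg ℤ).hasSum_iff] at h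
    refine h.congr_fun fun n => ?_
    simp
  have hUeq : ∀ n, P n + Q n = laurentCoeff β N S n.natAbs := fun n => by
    rcases le_or_gt 0 n with hn | hn
    · rw [hQ0 n hn, add_zero]; exact if_pos hn
    · have h := eq_zero_of_hasSum_circle (u := fun n => (P n + Q n) - (P (-n) + Q (-n)))
        ((hUs.add ((Equiv.neg ℤ).summable_iff.2 hUs)).of_nonneg_of_le
          (fun _ => norm_nonneg _) fun n => norm_sub_le _ _)
        (fun z hz => by simpa only [sub_mul, sub_self] using (hUz z hz).sub (hU' z hz)) n
      simp only [sub_eq_zero] at h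
      rw [h, hQ0 _ (by omega), add_zero]
      have : P (-n) = laurentCoeff β N S (-n).natAbs := if_pos (by omega)
      rw [this, Int.natAbs_neg]
  simp only [hUeq] at hUs hUz
  exact ⟨hUs, hUz⟩

end PartialFractions

/-! ### The lifted polynomials -/

/-- The polynomial with coefficients `liftCoeff m c`. -/
def liftVec (m : ℕ) (c : ℕ → ℚ) : ℂ[X] :=
  ∑ i ∈ Finset.range (2 * m + 1), C ((liftCoeff m c i : ℚ) : ℂ) * X ^ i

lemma liftPoly_eq (b : ℚ[X]) : liftPoly b = liftVec b.natDegree (chebCoeff b) := rfl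

lemma liftVec_coeff (m : ℕ) (c : ℕ → ℚ) (i : ℕ) :
    (liftVec m c).coeff i = if i < 2 * m + 1 then (liftCoeff m c i : ℂ) else 0 := by
  rw [liftVec, finsetSum_coeff]
  simp only [coeff_C_mul, coeff_X_pow, mul_ite, mul_one, mul_zero]
  rw [Finset.sum_ite_eq]
  simp

lemma liftVec_eval (m : ℕ) (c : ℕ → ℚ) {z : ℂ} (hz : z ≠ 0) :
    (liftVec m c).eval z = z ^ m * ∑ n ∈ Finset.Icc (-(m : ℤ)) m, (c n.natAbs : ℂ) * z ^ n := by
  rw [liftVec, eval_finsetSum, Finset.mul_sum]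
  refine Finset.sum_nbij' (fun i : ℕ => (i : ℤ) - m) (fun n : ℤ => (n + m).toNat) ?_ ?_ ?_ ?_ ?_
  · intro i hi; simp only [Finset.mem_range, Finset.mem_Icc] at *; omega
  · intro i hi; simp only [Finset.mem_range, Finset.mem_Icc] at *; omega
  · intro i hi; simp
  · intro i hi; simp only [Finset.mem_Icc] at *; omega
  · intro i hi
    simp only [eval_mul, eval_C, eval_pow, eval_X, liftCoeff]
    rw [mul_left_comm, ← zpow_natCast z m, ← zpow_add₀ hz, add_sub_cancel, zpow_natCast]

lemma sum_symm_inv (m : ℕ) (c : ℕ → ℚ) (z : ℂ) :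
    ∑ n ∈ Finset.Icc (-(m : ℤ)) m, (c n.natAbs : ℂ) * z⁻¹ ^ n
      = ∑ n ∈ Finset.Icc (-(m : ℤ)) m, (c n.natAbs : ℂ) * z ^ n := by
  refine Finset.sum_nbij' (fun i => -i) (fun i => -i) ?_ ?_ ?_ ?_ ?_
  · intro i hi; simp only [Finset.mem_Icc] at *; omega
  · intro i hi; simp only [Finset.mem_Icc] at *; omega
  · intro i _; simp
  · intro i _; simp
  · intro i _; rw [Int.natAbs_neg, inv_zpow, zpow_neg]

lemma liftPoly_eval (b : ℚ[X]) {z : ℂ} (hz : z ≠ 0) :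
    (liftPoly b).eval z = z ^ b.natDegree * aeval ((z + z⁻¹) / 2) b := by
  rw [liftPoly_eq, liftVec_eval _ _ hz]
  conv_rhs => rw [← ChebVec.ofPoly_toPoly b]
  rw [ChebVec.aeval_joukowski _ hz, ChebVec.ofPoly_toPoly]
  rfl

/-- `b` has no zero on `[-1, 1]`. -/
def NoZero (b : ℚ[X]) : Prop := ∀ x ∈ Set.Icc (-1 : ℝ) 1, aeval x b ≠ 0

lemma NoZero.ne_zero {b : ℚ[X]} (hb : NoZero b) : b ≠ 0 := by
  rintro rfl; exact hb 0 (by norm_num) (by simp)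

lemma NoZero.aeval_joukowski_ne_zero {b : ℚ[X]} (hb : NoZero b) {z : ℂ} (hz : ‖z‖ = 1) :
    aeval ((z + z⁻¹) / 2) b ≠ 0 := by
  rw [joukowski_eq_re hz, aeval_ofReal]
  exact_mod_cast hb _ (re_mem_Icc hz)

lemma NoZero.liftPoly_eval_ne_zero {b : ℚ[X]} (hb : NoZero b) {z : ℂ} (hz : ‖z‖ = 1) :
    (liftPoly b).eval z ≠ 0 := by
  rw [liftPoly_eval b (ne_zero_of_norm_one hz)]
  exact mul_ne_zero (pow_ne_zero _ (ne_zero_of_norm_one hz)) (hb.aeval_joukowski_ne_zero hz)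

lemma chebCoeff_natDegree_ne_zero {b : ℚ[X]} (hb : b ≠ 0) : chebCoeff b b.natDegree ≠ 0 := by
  rw [chebCoeff_natDegree]
  exact div_ne_zero (leadingCoeff_ne_zero.2 hb) (by positivity)

lemma liftPoly_natDegree {b : ℚ[X]} (hb : b ≠ 0) : (liftPoly b).natDegree = 2 * b.natDegree := by
  refine natDegree_eq_of_le_of_coeff_ne_zero ?_ ?_
  · rw [natDegree_le_iff_coeff_eq_zero]
    intro i hi
    rw [liftPoly_eq, liftVec_coeff, if_neg (by omega)]
  · rw [liftPoly_eq, liftVec_coeff, if_pos (by omega), liftCoeff,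
      show (((2 * b.natDegree : ℕ) : ℤ) - b.natDegree).natAbs = b.natDegree by omega]
    exact_mod_cast chebCoeff_natDegree_ne_zero hb

lemma liftPoly_ne_zero {b : ℚ[X]} (hb : b ≠ 0) : liftPoly b ≠ 0 := by
  intro h
  have h1 := liftVec_coeff b.natDegree (chebCoeff b) 0
  rw [← liftPoly_eq, h, coeff_zero, if_pos (by omega), liftCoeff,
    show (((0 : ℕ) : ℤ) - b.natDegree).natAbs = b.natDegree by omega] at h1
  exact chebCoeff_natDegree_ne_zero hb (by exact_mod_cast h1.symm)

/-- The coefficients of the lift are symmetric about the middle degree, so it is palindromic: its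
nonzero roots come in pairs `ζ`, `ζ⁻¹`. -/
lemma liftPoly_reflect {b : ℚ[X]} : reflect (2 * b.natDegree) (liftPoly b) = liftPoly b := by
  ext i
  rw [coeff_reflect, liftPoly_eq, liftVec_coeff, liftVec_coeff]
  rcases le_or_gt i (2 * b.natDegree) with h | h
  · rw [revAt_le h, if_pos (by omega), if_pos (by omega), liftCoeff, liftCoeff]
    rw [show (((2 * b.natDegree - i : ℕ) : ℤ) - b.natDegree).natAbs
      = ((i : ℤ) - b.natDegree).natAbs by omega]
  · rw [revAt_eq_self_of_lt h]

lemma natDegree_X_sub_C_pow_le (ζ : ℂ) (n : ℕ) : ((X - C ζ) ^ n).natDegree ≤ n := by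
  rw [natDegree_pow, natDegree_X_sub_C, mul_one]

lemma reflect_X_sub_C_pow (ζ : ℂ) (n : ℕ) :
    reflect n ((X - C ζ) ^ n) = (1 - C ζ * X) ^ n := by
  induction n with
  | zero => simp
  | succ n ih =>
    rw [pow_succ, reflect_mul _ _ (natDegree_X_sub_C_pow_le ζ n) (natDegree_X_sub_C_le ζ), ih, pow_succ,
      reflect_sub, reflect_one_X, reflect_C, pow_one]

/-- As the lift is palindromic, `ζ⁻¹ ≠ ζ` is a root at least as multiple as `ζ`, and twice this
multiplicity fits into the degree `2 deg b`. This keeps the order `j` of every pole at most `deg b`.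
-/
lemma two_mul_rootMultiplicity_le {b : ℚ[X]} (hb : b ≠ 0) {ζ : ℂ} (hζ : 1 < ‖ζ‖) :
    (liftPoly b).rootMultiplicity ζ ≤ b.natDegree := by
  set β := liftPoly b
  set μ := β.rootMultiplicity ζ
  have hβ : β ≠ 0 := liftPoly_ne_zero hb
  have hζ0 : ζ ≠ 0 := by rintro rfl; simp at hζ; linarith
  have hfac : (X - C ζ) ^ μ * (β /ₘ (X - C ζ) ^ μ) = β := pow_mul_divByMonic_rootMultiplicity_eq β ζ
  set γ := β /ₘ (X - C ζ) ^ μ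
  have hγ0 : γ ≠ 0 := by intro h; rw [h, mul_zero] at hfac; exact hβ hfac.symm
  have hdeg : μ + γ.natDegree = 2 * b.natDegree := by
    rw [← liftPoly_natDegree hb, show liftPoly b = β from rfl]
    conv_rhs => rw [← hfac]
    rw [natDegree_mul (pow_ne_zero _ (X_sub_C_ne_zero ζ)) hγ0, natDegree_pow, natDegree_X_sub_C,
      mul_one]
  have h1 : (1 - C ζ * X) ^ μ ∣ β := by
    have h2 : reflect (μ + γ.natDegree) ((X - C ζ) ^ μ * γ)
        = reflect μ ((X - C ζ) ^ μ) * reflect γ.natDegree γ :=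
      reflect_mul _ _ (natDegree_X_sub_C_pow_le ζ μ) le_rfl
    rw [hfac, hdeg, liftPoly_reflect, reflect_X_sub_C_pow] at h2
    exact ⟨_, h2⟩
  have h2 : (1 - C ζ * X : ℂ[X]) = C (-ζ) * (X - C ζ⁻¹) := by
    rw [mul_sub, ← C_mul, neg_mul, mul_inv_cancel₀ hζ0]
    simp; ring
  have h3 : (X - C ζ⁻¹) ^ μ ∣ β := by
    rw [h2, mul_pow] at h1
    exact (Dvd.intro_left _ rfl).trans h1
  have hne : ζ ≠ ζ⁻¹ := by
    intro h
    have : ‖ζ‖ = ‖ζ‖⁻¹ := by rw [← norm_inv, ← h]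
    have h4 : ‖ζ‖⁻¹ < 1 := inv_lt_one_of_one_lt₀ hζ
    linarith
  have h4 : (X - C ζ) ^ μ * (X - C ζ⁻¹) ^ μ ∣ β :=
    ((pairwise_coprime_X_sub_C Function.injective_id hne).pow).mul_dvd
      (pow_rootMultiplicity_dvd β ζ) h3
  have h5 := natDegree_le_of_dvd h4 hβ
  rw [natDegree_mul (pow_ne_zero _ (X_sub_C_ne_zero ζ)) (pow_ne_zero _ (X_sub_C_ne_zero _)),
    natDegree_pow, natDegree_pow, natDegree_X_sub_C, natDegree_X_sub_C,
    show β.natDegree = 2 * b.natDegree from liftPoly_natDegree hb] at h5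
  omega

/-! ### Numerators -/

/-- The remainder with the coefficients beyond `m` set to zero. -/
def truncSeq (m : ℕ) (r : ℕ → ℚ) (s : ℕ) : ℚ := if s < m then r s else 0

lemma basisNum_coeff {m s : ℕ} (hs : s ≤ m) (i : ℕ) :
    (basisNum m s).coeff i = if ((i : ℤ) - m).natAbs = s then 1 else 0 := by
  rw [basisNum]
  split_ifs with h0 h1 h1
  · rw [coeff_X_pow, if_pos (by omega)]
  · rw [coeff_X_pow, if_neg (by omega)]
  · rw [coeff_add, coeff_X_pow, coeff_X_pow]
    by_cases h2 : i = m + s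
    · rw [if_pos h2, if_neg (by omega), add_zero]
    · rw [if_neg h2, if_pos (by omega), zero_add]
  · rw [coeff_add, coeff_X_pow, coeff_X_pow, if_neg (by omega), if_neg (by omega), add_zero]

/-- The numerator is linear in the remainder, so bounds prepared for the basis numerators from `b`
alone apply to every remainder after scaling. -/
lemma liftVec_truncSeq (m : ℕ) (r : ℕ → ℚ) :
    liftVec m (truncSeq m r) = ∑ s ∈ Finset.range m, C (r s : ℂ) * basisNum m s := by
  ext i
  rw [liftVec_coeff, finsetSum_coeff]
  have h : ∀ s ∈ Finset.range m, (C (r s : ℂ) * basisNum m s).coeff i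
      = if ((i : ℤ) - m).natAbs = s then (r s : ℂ) else 0 := fun s hs => by
    rw [coeff_C_mul, basisNum_coeff (Finset.mem_range.1 hs).le, mul_ite, mul_one, mul_zero]
  rw [Finset.sum_congr rfl h, Finset.sum_ite_eq, liftCoeff, truncSeq]
  simp only [Finset.mem_range]
  split_ifs <;> first | rfl | omega | simp

lemma degree_liftVec_truncSeq_lt {b : ℚ[X]} (hb : b ≠ 0) (r : ℕ → ℚ) :
    (liftVec b.natDegree (truncSeq b.natDegree r)).degree < (liftPoly b).degree := by
  rw [degree_eq_natDegree (liftPoly_ne_zero hb), liftPoly_natDegree hb, degree_lt_iff_coeff_zero]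
  intro i hi
  rw [liftVec_coeff]
  split_ifs
  · rw [liftCoeff, truncSeq, if_neg (by omega)]; simp
  · rfl

lemma pfNum_sum (β : ℂ[X]) (m : ℕ) (r : ℕ → ℚ) (N : ℕ → ℂ[X]) (μ j : ℕ) (z : ℂ) :
    pfNum β (∑ s ∈ Finset.range m, C (r s : ℂ) * N s) μ j z
      = ∑ s ∈ Finset.range m, (r s : ℂ) * pfNum β (N s) μ j z := by
  have h1 : ∀ (c : ℂ) (P : ℂ[X]), ((taylor z (C c * P) : ℂ[X]) : PowerSeries ℂ)
      = c • ((taylor z P : ℂ[X]) : PowerSeries ℂ) := fun c P => by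
    rw [taylor_mul, taylor_C, Polynomial.coe_mul, Polynomial.coe_C, PowerSeries.smul_eq_C_mul]
  have h2 : ((taylor z (∑ s ∈ Finset.range m, C (r s : ℂ) * N s) : ℂ[X]) : PowerSeries ℂ)
      = ∑ s ∈ Finset.range m, (r s : ℂ) • ((taylor z (N s) : ℂ[X]) : PowerSeries ℂ) := by
    rw [map_sum, ← Polynomial.coeToPowerSeries.ringHom_apply, map_sum]
    exact Finset.sum_congr rfl fun s _ => h1 _ _
  simp only [pfNum]
  rw [h2, Finset.sum_mul, map_sum, Finset.mul_sum]
  refine Finset.sum_congr rfl fun s _ => ?_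
  rw [smul_mul_assoc, map_smul, smul_eq_mul]
  ring

/-! ### Analyticity of the partial fraction coefficients -/

lemma analyticAt_taylor_coeff (P : ℂ[X]) (l : ℕ) (z₀ : ℂ) :
    AnalyticAt ℂ (fun z => (taylor z P).coeff l) z₀ := by
  simp only [taylor_coeff]
  simpa using! (AnalyticAt.aeval_polynomial (f := id) (z := z₀) (𝕜 := ℂ) analyticAt_id (hasseDeriv l P))

/-- The coefficients of an inverse series obey a recurrence that divides by the constant coefficient
only, so analyticity propagates by strong induction. -/
lemma analyticAt_coeff_inv {F : ℂ → PowerSeries ℂ} {z₀ : ℂ}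
    (hF : ∀ l, AnalyticAt ℂ (fun z => PowerSeries.coeff l (F z)) z₀)
    (h0 : PowerSeries.coeff 0 (F z₀) ≠ 0) (l : ℕ) :
    AnalyticAt ℂ (fun z => PowerSeries.coeff l (F z)⁻¹) z₀ := by
  have hinv : AnalyticAt ℂ (fun z => (PowerSeries.constantCoeff (F z))⁻¹) z₀ := by
    simpa using (hF 0).fun_inv h0
  induction l using Nat.strong_induction_on with
  | _ l ih =>
    have he : (fun z => PowerSeries.coeff l (F z)⁻¹) = fun z =>
        if l = 0 then (PowerSeries.constantCoeff (F z))⁻¹ else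
          -(PowerSeries.constantCoeff (F z))⁻¹ *
            ∑ x ∈ Finset.HasAntidiagonal.antidiagonal l, if x.2 < l then
              PowerSeries.coeff x.1 (F z) * PowerSeries.coeff x.2 (F z)⁻¹ else 0 :=
      funext fun z => PowerSeries.coeff_inv _ _
    rw [he]
    rcases eq_or_ne l 0 with rfl | hl
    · simpa using hinv
    · simp only [if_neg hl]
      refine hinv.neg.mul (Finset.analyticAt_fun_sum _ fun x _ => ?_)
      by_cases hx : x.2 < l
      · simp only [if_pos hx]
        exact (hF _).mul (ih _ hx)
      · simp only [if_neg hx]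
        exact analyticAt_const

lemma analyticAt_pfNum (β N : ℂ[X]) (μ j : ℕ) {z₀ : ℂ} (h0 : (taylor z₀ β).coeff μ ≠ 0) :
    AnalyticAt ℂ (pfNum β N μ j) z₀ := by
  have h : pfNum β N μ j = fun z => (-1) ^ j * ∑ x ∈ Finset.HasAntidiagonal.antidiagonal (μ - j),
      (taylor z N).coeff x.1 * PowerSeries.coeff x.2
        (PowerSeries.mk fun l => (taylor z β).coeff (μ + l))⁻¹ := by
    funext z
    rw [pfNum, PowerSeries.coeff_mul]
    simp only [Polynomial.coeff_coe]
  rw [h]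
  refine analyticAt_const.mul (Finset.analyticAt_fun_sum _ fun x _ => ?_)
  refine (analyticAt_taylor_coeff N _ _).mul (analyticAt_coeff_inv (fun l => ?_) ?_ _)
  · simp only [PowerSeries.coeff_mk]
    exact analyticAt_taylor_coeff β _ _
  · rwa [PowerSeries.coeff_mk, add_zero]

/-! ### Chebyshev coefficients of the remainder over `b` -/

namespace ExpansionData

variable {b : ℚ[X]} (E : ExpansionData b)

lemma root_spec (k : Fin E.numRoots) : (liftPoly b).IsRoot (E.root k) ∧ 1 < ‖E.root k‖ :=
  (E.mem_range_root _).1 ⟨k, rfl⟩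

lemma mult_pos (hb : b ≠ 0) (k : Fin E.numRoots) : 1 ≤ E.mult k := by
  rw [E.mult_eq]
  exact (rootMultiplicity_pos (liftPoly_ne_zero hb)).2 (E.root_spec k).1

lemma mult_le (hb : b ≠ 0) (k : Fin E.numRoots) : E.mult k ≤ b.natDegree := by
  rw [E.mult_eq]
  exact two_mul_rootMultiplicity_le hb (E.root_spec k).2

lemma mem_disk_root (k : Fin E.numRoots) : ‖E.root k - E.root k‖ ≤ E.rad := by
  rw [sub_self, norm_zero]; exact_mod_cast E.rad_pos.le

lemma one_lt_rhoLow_real : (1 : ℝ) < E.rhoLow := by exact_mod_cast E.one_lt_rhoLow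

/-- `pfBound` gets a sign only from its specification at an actual root; there `deg b ≥ mult ≥ 1`
makes the indices `j = 1`, `s = 0` admissible. -/
lemma pfBound_nonneg (hb : b ≠ 0) (k : Fin E.numRoots) : (0 : ℝ) ≤ E.pfBound := by
  have h1 := E.mult_pos hb k
  have h2 := E.mult_le hb k
  exact (by positivity : (0 : ℝ) ≤ _).trans (E.pfBound_spec k 1 (Finset.mem_Icc.2 ⟨le_rfl, h1⟩) 0
    (by omega) _ (E.mem_disk_root k))

lemma rhoHigh_nonneg (k : Fin E.numRoots) : (0 : ℝ) ≤ E.rhoHigh :=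
  (norm_nonneg _).trans (E.annulus k _ (E.mem_disk_root k)).2

/-- The lift of the remainder. -/
def numer (_ : ExpansionData b) (r : ℕ → ℚ) : ℂ[X] := liftVec b.natDegree (truncSeq b.natDegree r)

/-- The `j`-th partial fraction coefficient at the `k`-th root, as a function of the root. -/
def pf (r : ℕ → ℚ) (k : Fin E.numRoots) (j : ℕ) : ℂ → ℂ :=
  pfNum (liftPoly b) (E.numer r) (E.mult k) j

/-- The `n`-th Chebyshev coefficient of the remainder over `b`, as a function of the roots. -/
def wFun (r : ℕ → ℚ) (pt : Fin E.numRoots → ℂ) (n : ℕ) : ℂ :=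
  ∑ k, ∑ j ∈ Finset.Icc 1 (E.mult k),
    ((n + j - 1).choose (j - 1) : ℂ) * E.pf r k j (pt k) * (pt k)⁻¹ ^ (n + j)

lemma wFun_root_eq (r : ℕ → ℚ) (n : ℕ) :
    E.wFun r E.root n
      = laurentCoeff (liftPoly b) (E.numer r) (Finset.univ.image E.root) n := by
  rw [laurentCoeff, Finset.sum_image fun _ _ _ _ h => E.root_injective h]
  simp only [wFun, pf, E.mult_eq]

lemma pf_eq_sum (r : ℕ → ℚ) (k : Fin E.numRoots) (j : ℕ) :
    E.pf r k j = fun z => ∑ s ∈ Finset.range b.natDegree,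
      (r s : ℂ) * pfNum (liftPoly b) (basisNum b.natDegree s) (E.mult k) j z := by
  funext z
  rw [pf, numer, liftVec_truncSeq, pfNum_sum]

lemma analyticAt_pf (r : ℕ → ℚ) (k : Fin E.numRoots) (j : ℕ) {z : ℂ}
    (hz : ‖z - E.root k‖ ≤ E.rad) : AnalyticAt ℂ (E.pf r k j) z :=
  analyticAt_pfNum _ _ _ _ (E.coeff_ne_zero k z hz)

/-- The sum of the absolute values of the coefficients of the remainder. -/
def remSum (_ : ExpansionData b) (r : ℕ → ℚ) : ℚ := ∑ s ∈ Finset.range b.natDegree, |r s|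

lemma remSum_nonneg (r : ℕ → ℚ) : 0 ≤ E.remSum r := Finset.sum_nonneg fun _ _ => abs_nonneg _

lemma norm_pf_le (r : ℕ → ℚ) (k : Fin E.numRoots) {j : ℕ}
    (hj : j ∈ Finset.Icc 1 (E.mult k)) {z : ℂ} (hz : ‖z - E.root k‖ ≤ E.rad) :
    ‖deriv (E.pf r k j) z‖ + ‖z⁻¹ * E.pf r k j z‖ ≤ E.pfBound * (E.remSum r : ℝ) := by
  have hd : ∀ s, DifferentiableAt ℂ
      (pfNum (liftPoly b) (basisNum b.natDegree s) (E.mult k) j) z := fun s =>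
    (analyticAt_pfNum _ _ _ _ (E.coeff_ne_zero k z hz)).differentiableAt
  have h1 : deriv (E.pf r k j) z = ∑ s ∈ Finset.range b.natDegree,
      (r s : ℂ) * deriv (pfNum (liftPoly b) (basisNum b.natDegree s) (E.mult k) j) z := by
    rw [pf_eq_sum]
    rw [deriv_fun_sum fun s _ => (hd s).const_mul _]
    exact Finset.sum_congr rfl fun s _ => deriv_const_mul _ (hd s)
  rw [h1, pf_eq_sum]
  simp only [Finset.mul_sum]
  refine (add_le_add (norm_sum_le _ _) (norm_sum_le _ _)).trans ?_
  rw [← Finset.sum_add_distrib, remSum]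
  push_cast
  rw [Finset.mul_sum]
  refine Finset.sum_le_sum fun s hs => ?_
  have h2 := E.pfBound_spec k j hj s (Finset.mem_range.1 hs) z hz
  have hr : ‖(r s : ℂ)‖ = |(r s : ℝ)| := by
    rw [← Complex.ofReal_ratCast, Complex.norm_real, Real.norm_eq_abs]
  rw [mul_left_comm, norm_mul, norm_mul _ (z⁻¹ * _), ← mul_add, hr, mul_comm]
  gcongr

/-- The Chebyshev coefficients of the remainder over `b` sum up to it. -/
lemma hasSum_wFun (hb : NoZero b) (r : ℕ → ℚ) :
    (Summable fun n : ℤ => ‖E.wFun r E.root n.natAbs‖) ∧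
    ∀ z : ℂ, ‖z‖ = 1 → HasSum (fun n : ℤ => E.wFun r E.root n.natAbs * z ^ n)
      (aeval ((z + z⁻¹) / 2) (ChebVec.mk b.natDegree (truncSeq b.natDegree r)).toPoly
        / aeval ((z + z⁻¹) / 2) b) := by
  set c := truncSeq b.natDegree r
  have hval : ∀ z : ℂ, ‖z‖ = 1 → (E.numer r).eval z / (liftPoly b).eval z
      = (∑ n ∈ Finset.Icc (-(b.natDegree : ℤ)) b.natDegree, (c n.natAbs : ℂ) * z ^ n)
        / (∑ n ∈ Finset.Icc (-(b.natDegree : ℤ)) b.natDegree, (chebCoeff b n.natAbs : ℂ) * z ^ n) :=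
    fun z hz => by
    have hz0 := ne_zero_of_norm_one hz
    rw [numer, liftVec_eval _ _ hz0, liftPoly_eq, liftVec_eval _ _ hz0,
      mul_div_mul_left _ _ (pow_ne_zero _ hz0)]
  have h := hasSum_laurentCoeff (β := liftPoly b) (E.numer r) (liftPoly_ne_zero hb.ne_zero)
    (fun z hz => hb.liftPoly_eval_ne_zero hz) (degree_liftVec_truncSeq_lt hb.ne_zero r)
    (fun z hz => by
      rw [hval z hz, hval z⁻¹ (by rw [norm_inv, hz, inv_one]), sum_symm_inv, sum_symm_inv])
    (S := Finset.univ.image E.root) (fun z => by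
      rw [← E.mem_range_root]; simp)
  simp only [E.wFun_root_eq]
  refine ⟨h.1, fun z hz => ?_⟩
  have hz0 := ne_zero_of_norm_one hz
  have h2 := h.2 z hz
  rw [numer, liftVec_eval _ _ hz0, liftPoly_eval _ hz0,
      mul_div_mul_left _ _ (pow_ne_zero _ hz0)] at h2
  rw [ChebVec.aeval_joukowski _ hz0]
  exact h2

/-- The sum is real and `conj z = z⁻¹` on the circle, so the conjugate coefficients represent the
same function; average the two. Taking real parts is then harmless, even when approximate roots are
not paired by conjugation. -/
lemma hasSum_wFun_re (hb : NoZero b) (r : ℕ → ℚ) {z : ℂ} (hz : ‖z‖ = 1) :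
    HasSum (fun n : ℤ => ((E.wFun r E.root n.natAbs).re : ℂ) * z ^ n)
      (aeval ((z + z⁻¹) / 2) (ChebVec.mk b.natDegree (truncSeq b.natDegree r)).toPoly
        / aeval ((z + z⁻¹) / 2) b) := by
  have h := (E.hasSum_wFun hb r).2 z hz
  rw [joukowski_eq_re hz, aeval_ofReal, aeval_ofReal, ← Complex.ofReal_div] at h ⊢
  set v : ℝ := _ / _
  have h1 := (Complex.hasSum_conj'.2 h)
  have h2 := (Equiv.neg ℤ).hasSum_iff.2 h1
  have h3 : HasSum (fun n : ℤ => (starRingEnd ℂ) (E.wFun r E.root n.natAbs) * z ^ n) (v : ℂ) := by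
    rw [Complex.conj_ofReal] at h2
    refine h2.congr_fun fun n => ?_
    simp only [Function.comp_apply, Equiv.neg_apply, Int.natAbs_neg, map_mul, map_zpow₀,
      ← Complex.inv_eq_conj hz, inv_zpow, zpow_neg, inv_inv]
  have h4 := (h.add h3).mul_left (1 / 2 : ℂ)
  rw [show (1 / 2 : ℂ) * ((v : ℂ) + v) = v by ring] at h4
  refine h4.congr_fun fun n => ?_
  rw [← add_mul, Complex.add_conj]
  push_cast; ring

end ExpansionData
-- Effect of root errors, and tails of the expansion
namespace ExpansionData

variable {b : ℚ[X]} (E : ExpansionData b)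

lemma ne_zero_of_mem_disk {k : Fin E.numRoots} {z : ℂ} (hz : ‖z - E.root k‖ ≤ E.rad) : z ≠ 0 := by
  rintro rfl
  have h := (E.annulus k 0 hz).1
  have h1 := E.one_lt_rhoLow_real
  rw [norm_zero] at h
  linarith

lemma norm_inv_pow_le {k : Fin E.numRoots} {z : ℂ} (hz : ‖z - E.root k‖ ≤ E.rad) (p : ℕ) :
    ‖z⁻¹ ^ p‖ ≤ (E.rhoLow : ℝ)⁻¹ ^ p := by
  have h1 := E.one_lt_rhoLow_real
  rw [norm_pow, norm_inv]
  gcongr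
  exact (E.annulus k z hz).1

/-- Effect of an error on a root on one term of `w_n`. -/
lemma norm_term_sub_le (hb : b ≠ 0) (r : ℕ → ℚ) (k : Fin E.numRoots) {j : ℕ}
    (hj : j ∈ Finset.Icc 1 (E.mult k)) (n : ℕ) {z : ℂ} (hz : ‖z - E.root k‖ ≤ E.rad) :
    ‖E.pf r k j z * z⁻¹ ^ (n + j) - E.pf r k j (E.root k) * (E.root k)⁻¹ ^ (n + j)‖
      ≤ ((n + j : ℕ) * (E.rhoLow : ℝ)⁻¹ ^ (n + j) * (E.pfBound * E.remSum r))
        * ‖z - E.root k‖ := by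
  set p := n + j with hp
  have hp1 : 1 ≤ p := by have := (Finset.mem_Icc.1 hj).1; omega
  have hS := E.pfBound_nonneg hb k
  have hR : (0 : ℝ) ≤ E.remSum r := by exact_mod_cast E.remSum_nonneg r
  have hconv : Convex ℝ (Metric.closedBall (E.root k) E.rad) := convex_closedBall _ _
  have hmem : ∀ x ∈ Metric.closedBall (E.root k) (E.rad : ℝ), ‖x - E.root k‖ ≤ E.rad := fun x hx => by
    rwa [mem_closedBall_iff_norm] at hx
  -- With `h = pf`, the derivative of `h(x) x^{-p}` is `x^{-p} (h' - p x⁻¹ h)`. This is why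
  -- `pfBound` controls `|h'| + |z⁻¹ h|`; as `p ≥ 1`, the bracket is at most `p` times that.
  have hder : ∀ x ∈ Metric.closedBall (E.root k) (E.rad : ℝ),
      HasDerivAt (fun x => E.pf r k j x * x⁻¹ ^ p)
        (x⁻¹ ^ p * (deriv (E.pf r k j) x - p * (x⁻¹ * E.pf r k j x))) x := fun x hx => by
    have hx' := hmem x hx
    have hx0 := E.ne_zero_of_mem_disk hx'
    have h1 := (E.analyticAt_pf r k j hx').differentiableAt.hasDerivAt
    have h2 := (hasDerivAt_inv hx0).pow p
    refine (h1.mul h2).congr_deriv ?_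
    obtain ⟨q, hq⟩ : ∃ q, p = q + 1 := ⟨p - 1, by omega⟩
    simp only [Pi.pow_apply, hq, Nat.add_sub_cancel, pow_succ]
    field_simp
    ring
  refine hconv.norm_image_sub_le_of_norm_hasDerivWithin_le
    (f := fun x => E.pf r k j x * x⁻¹ ^ p)
    (fun x hx => (hder x hx).hasDerivWithinAt) (fun x hx => ?_) (Metric.mem_closedBall_self ?_) ?_
  · have hx' := hmem x hx
    have h1 := E.norm_pf_le r k hj hx'
    rw [norm_mul]
    have h2 : ‖deriv (E.pf r k j) x - p * (x⁻¹ * E.pf r k j x)‖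
        ≤ p * (E.pfBound * E.remSum r) := by
      refine (norm_sub_le _ _).trans ?_
      rw [norm_mul, Complex.norm_natCast]
      have hp' : (1 : ℝ) ≤ p := by exact_mod_cast hp1
      have h3 := norm_nonneg (deriv (E.pf r k j) x)
      nlinarith
    calc ‖x⁻¹ ^ p‖ * ‖deriv (E.pf r k j) x - p * (x⁻¹ * E.pf r k j x)‖
        ≤ (E.rhoLow : ℝ)⁻¹ ^ p * (p * (E.pfBound * E.remSum r)) := by
          gcongr
          · have := E.one_lt_rhoLow_real
            positivity
          · exact E.norm_inv_pow_le hx' p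
      _ = _ := by ring
  · exact_mod_cast E.rad_pos.le
  · rwa [mem_closedBall_iff_norm]

/-- Bound for the effect on `w_n` of errors at most `e` on the roots. -/
def rootErr (r : ℕ → ℚ) (e : ℝ) (n : ℕ) : ℝ :=
  ∑ k, ∑ j ∈ Finset.Icc 1 (E.mult k),
    (j * (E.pfBound * E.remSum r) * (E.rhoLow : ℝ)⁻¹ ^ j * e)
      * (((n + j).choose j : ℝ) * (E.rhoLow : ℝ)⁻¹ ^ n)

lemma norm_wFun_sub_le (hb : b ≠ 0) (r : ℕ → ℚ) {pt : Fin E.numRoots → ℂ} {e : ℝ}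
    (he : e ≤ E.rad) (hpt : ∀ k, ‖pt k - E.root k‖ ≤ e) (n : ℕ) :
    ‖E.wFun r pt n - E.wFun r E.root n‖ ≤ E.rootErr r e n := by
  rw [wFun, wFun, ← Finset.sum_sub_distrib]
  refine (norm_sum_le _ _).trans (Finset.sum_le_sum fun k _ => ?_)
  rw [← Finset.sum_sub_distrib]
  refine (norm_sum_le _ _).trans (Finset.sum_le_sum fun j hj => ?_)
  have hS := E.pfBound_nonneg hb k
  have hR : (0 : ℝ) ≤ E.remSum r := by exact_mod_cast E.remSum_nonneg r
  have hρ := E.one_lt_rhoLow_real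
  have h1 := E.norm_term_sub_le hb r k hj n ((hpt k).trans he)
  rw [mul_assoc, mul_assoc, ← mul_sub, norm_mul, Complex.norm_natCast]
  obtain ⟨i, rfl⟩ : ∃ i, j = i + 1 := ⟨j - 1, by have := (Finset.mem_Icc.1 hj).1; omega⟩
  -- The factor `n + j` coming from the derivative is absorbed by `(n+j) C(n+j-1, j-1) = j C(n+j,
  -- j)`, so that summation over `n` gives a power of a geometric series.
  have hch : ((n + (i + 1) : ℕ) : ℝ) * ((n + (i + 1) - 1).choose (i + 1 - 1) : ℕ)
      = ((n + (i + 1)).choose (i + 1) : ℕ) * ((i + 1 : ℕ) : ℝ) := by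
    have := Nat.add_one_mul_choose_eq (n + i) i
    rw [show n + (i + 1) - 1 = n + i by omega, Nat.add_sub_cancel]
    exact_mod_cast this
  calc _ ≤ (((n + (i + 1) - 1).choose (i + 1 - 1) : ℕ) : ℝ) * ((((n + (i + 1) : ℕ) : ℝ) *
        (E.rhoLow : ℝ)⁻¹ ^ (n + (i + 1)) * (E.pfBound * E.remSum r)) * e) := by
        gcongr
        refine h1.trans ?_
        gcongr
        exact hpt k
    _ = (((n + (i + 1) : ℕ) : ℝ) * ((n + (i + 1) - 1).choose (i + 1 - 1) : ℕ)) *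
        (E.rhoLow : ℝ)⁻¹ ^ (n + (i + 1)) * (E.pfBound * E.remSum r) * e := by ring
    _ = _ := by rw [hch, pow_add]; ring

lemma norm_rhoLow_inv_lt : ‖(E.rhoLow : ℝ)⁻¹‖ < 1 := by
  have h := E.one_lt_rhoLow_real
  rw [Real.norm_of_nonneg (by positivity)]
  exact inv_lt_one_of_one_lt₀ h

lemma hasSum_rootErr (r : ℕ → ℚ) (e : ℝ) :
    HasSum (E.rootErr r e) (∑ k, ∑ j ∈ Finset.Icc 1 (E.mult k),
      (j * (E.pfBound * E.remSum r) * (E.rhoLow : ℝ)⁻¹ ^ j * e)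
        * (1 / (1 - (E.rhoLow : ℝ)⁻¹) ^ (j + 1))) :=
  hasSum_sum fun _ _ => hasSum_sum fun j _ =>
    (hasSum_choose_mul_geometric_of_norm_lt_one j E.norm_rhoLow_inv_lt).mul_left _

/-- The quantity `M` of the algorithm. -/
def newtonConst (r : ℕ → ℚ) : ℚ :=
  E.pfBound * E.remSum r * ∑ k, ∑ j ∈ Finset.Icc 1 (E.mult k), j * (1 / E.rhoLow) ^ j

/-- Since `j ≤ deg b`, every factor `(1 - ρ₋⁻¹)^{-(j+1)}` is dominated by the single one with
exponent `deg b + 1`, which is the factor in the Newton stopping test. -/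
lemma tsum_rootErr_le (hb : b ≠ 0) (r : ℕ → ℚ) {e ε : ℝ} (he : 0 ≤ e)
    (h : E.newtonConst r * e ≤ (1 - (E.rhoLow : ℝ)⁻¹) ^ (b.natDegree + 1) * ε / 4) :
    (∑ k, ∑ j ∈ Finset.Icc 1 (E.mult k),
      (j * (E.pfBound * E.remSum r) * (E.rhoLow : ℝ)⁻¹ ^ j * e)
        * (1 / (1 - (E.rhoLow : ℝ)⁻¹) ^ (j + 1))) ≤ ε / 4 := by
  have hρ := E.one_lt_rhoLow_real
  have hR : (0 : ℝ) ≤ E.remSum r := by exact_mod_cast E.remSum_nonneg r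
  have hx1 : (E.rhoLow : ℝ)⁻¹ < 1 := inv_lt_one_of_one_lt₀ hρ
  have hx0 : 0 < (E.rhoLow : ℝ)⁻¹ := by positivity
  set x := (E.rhoLow : ℝ)⁻¹
  have hy0 : 0 < 1 - x := by linarith
  calc _ ≤ ∑ k, ∑ j ∈ Finset.Icc 1 (E.mult k),
      (j * (E.pfBound * E.remSum r) * x ^ j * e) * (1 / (1 - x) ^ (b.natDegree + 1)) := by
        refine Finset.sum_le_sum fun k _ => Finset.sum_le_sum fun j hj => ?_
        have hS := E.pfBound_nonneg hb k
        have hjm := (Finset.mem_Icc.1 hj).2.trans (E.mult_le hb k)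
        refine mul_le_mul_of_nonneg_left ?_ (by positivity)
        refine one_div_le_one_div_of_le (by positivity) ?_
        exact pow_le_pow_of_le_one hy0.le (by linarith) (by omega)
    _ = (E.newtonConst r * e) * (1 / (1 - x) ^ (b.natDegree + 1)) := by
        simp only [newtonConst]
        push_cast
        rw [Finset.mul_sum, Finset.sum_mul, Finset.sum_mul]
        refine Finset.sum_congr rfl fun k _ => ?_
        rw [Finset.mul_sum, Finset.sum_mul, Finset.sum_mul]
        refine Finset.sum_congr rfl fun j _ => ?_
        rw [one_div (E.rhoLow : ℝ)]
        ring
    _ ≤ ((1 - x) ^ (b.natDegree + 1) * ε / 4) * (1 / (1 - x) ^ (b.natDegree + 1)) := by gcongr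
    _ = ε / 4 := by field_simp

/-- Bound for `w_{d + 1 + n}`. -/
def tailTerm (r : ℕ → ℚ) (d n : ℕ) : ℝ :=
  ∑ k, ∑ j ∈ Finset.Icc 1 (E.mult k),
    (E.rhoHigh * E.pfBound * E.remSum r * (d + 2 : ℝ) ^ (j - 1) * (E.rhoLow : ℝ)⁻¹ ^ (d + 1 + j))
      * (((n + (j - 1)).choose (j - 1) : ℝ) * (E.rhoLow : ℝ)⁻¹ ^ n)

/-- Factor by factor, `a + k + s ≤ (a + 1)(k + s)` for `s ≥ 1`. With `a = d + 1` this separates the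
truncation order, as `(d+2)^{j-1}`, from the summation index of the tail. -/
lemma choose_add_le (a k i : ℕ) :
    (a + k + i).choose i ≤ (a + 1) ^ i * (k + i).choose i := by
  induction i with
  | zero => simp
  | succ i ih =>
    have h1 := Nat.add_one_mul_choose_eq (a + k + i) i
    have h2 := Nat.add_one_mul_choose_eq (k + i) i
    have h3 : (a + k + i + 1) ≤ (a + 1) * (k + i + 1) := by nlinarith [Nat.zero_le (a * (k + i))]
    refine Nat.le_of_mul_le_mul_right ?_ (Nat.succ_pos i)
    calc (a + k + (i + 1)).choose (i + 1) * (i + 1)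
        = (a + k + i + 1) * (a + k + i).choose i := by rw [h1]; rfl
      _ ≤ ((a + 1) * (k + i + 1)) * ((a + 1) ^ i * (k + i).choose i) := Nat.mul_le_mul h3 ih
      _ = (a + 1) ^ (i + 1) * ((k + i + 1) * (k + i).choose i) := by ring
      _ = (a + 1) ^ (i + 1) * (k + (i + 1)).choose (i + 1) * (i + 1) := by
          rw [h2, ← mul_assoc]; rfl

lemma norm_pf_root_le (hb : b ≠ 0) (r : ℕ → ℚ) (k : Fin E.numRoots) {j : ℕ}
    (hj : j ∈ Finset.Icc 1 (E.mult k)) :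
    ‖E.pf r k j (E.root k)‖ ≤ E.rhoHigh * E.pfBound * E.remSum r := by
  have h1 := E.norm_pf_le r k hj (E.mem_disk_root k)
  have h2 := (E.annulus k _ (E.mem_disk_root k)).2
  have h0 := E.ne_zero_of_mem_disk (E.mem_disk_root k)
  have hS := E.pfBound_nonneg hb k
  have hR : (0 : ℝ) ≤ E.remSum r := by exact_mod_cast E.remSum_nonneg r
  calc ‖E.pf r k j (E.root k)‖ = ‖E.root k‖ * ‖(E.root k)⁻¹ * E.pf r k j (E.root k)‖ := by
        rw [← norm_mul, mul_inv_cancel_left₀ h0]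
    _ ≤ E.rhoHigh * (E.pfBound * E.remSum r) := by
        gcongr
        · exact (norm_nonneg _).trans h2
        · exact (le_add_of_nonneg_left (norm_nonneg _)).trans h1
    _ = _ := by ring

lemma norm_wFun_le_tailTerm (hb : b ≠ 0) (r : ℕ → ℚ) (d n : ℕ) :
    ‖E.wFun r E.root (d + 1 + n)‖ ≤ E.tailTerm r d n := by
  refine (norm_sum_le _ _).trans (Finset.sum_le_sum fun k _ => ?_)
  refine (norm_sum_le _ _).trans (Finset.sum_le_sum fun j hj => ?_)
  have hS := E.pfBound_nonneg hb k
  have hH := E.rhoHigh_nonneg k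
  have hR : (0 : ℝ) ≤ E.remSum r := by exact_mod_cast E.remSum_nonneg r
  have hρ := E.one_lt_rhoLow_real
  obtain ⟨i, rfl⟩ : ∃ i, j = i + 1 := ⟨j - 1, by have := (Finset.mem_Icc.1 hj).1; omega⟩
  have hch : (((d + 1 + n + (i + 1) - 1).choose (i + 1 - 1) : ℕ) : ℝ)
      ≤ (d + 2 : ℝ) ^ i * ((n + i).choose i : ℕ) := by
    have := choose_add_le (d + 1) n i
    rw [show d + 1 + n + (i + 1) - 1 = d + 1 + n + i by omega, Nat.add_sub_cancel]
    calc (((d + 1 + n + i).choose i : ℕ) : ℝ) ≤ (((d + 1 + 1) ^ i * (n + i).choose i : ℕ) : ℝ) := by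
          exact_mod_cast this
      _ = _ := by push_cast; ring
  rw [norm_mul, norm_mul, Complex.norm_natCast]
  calc _ ≤ ((d + 2 : ℝ) ^ i * ((n + i).choose i : ℕ)) * (E.rhoHigh * E.pfBound * E.remSum r)
        * (E.rhoLow : ℝ)⁻¹ ^ (d + 1 + n + (i + 1)) := by
        gcongr
        · exact E.norm_pf_root_le hb r k hj
        · exact E.norm_inv_pow_le (E.mem_disk_root k) _
    _ = _ := by
        simp only [Nat.add_sub_cancel]
        rw [show d + 1 + n + (i + 1) = (d + 1 + (i + 1)) + n by ring, pow_add _ (d + 1 + (i + 1)) n]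
        ring

lemma hasSum_tailTerm (r : ℕ → ℚ) (d : ℕ) :
    HasSum (E.tailTerm r d) (∑ k, ∑ j ∈ Finset.Icc 1 (E.mult k),
      E.rhoHigh * E.pfBound * E.remSum r
        * ((d + 2 : ℝ) ^ (j - 1) / (E.rhoLow - 1 : ℝ) ^ j) * (E.rhoLow : ℝ)⁻¹ ^ (d + 1)) := by
  have hρ := E.one_lt_rhoLow_real
  refine hasSum_sum fun k _ => hasSum_sum fun j hj => ?_
  obtain ⟨i, rfl⟩ : ∃ i, j = i + 1 := ⟨j - 1, by have := (Finset.mem_Icc.1 hj).1; omega⟩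
  have h := (hasSum_choose_mul_geometric_of_norm_lt_one i E.norm_rhoLow_inv_lt).mul_left
    (E.rhoHigh * E.pfBound * E.remSum r * (d + 2 : ℝ) ^ i * (E.rhoLow : ℝ)⁻¹ ^ (d + 1 + (i + 1)))
  refine (congrArg (HasSum _) ?_).mpr h
  have e : (E.rhoLow : ℝ) - 1 = E.rhoLow * (1 - (E.rhoLow : ℝ)⁻¹) := by field_simp
  rw [Nat.add_sub_cancel, e, mul_pow, pow_add _ (d + 1), inv_pow _ (i + 1)]
  have h1 : (E.rhoLow : ℝ) ≠ 0 := by positivity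
  have h2 : (1 - (E.rhoLow : ℝ)⁻¹) ≠ 0 := by
    have : (E.rhoLow : ℝ)⁻¹ < 1 := inv_lt_one_of_one_lt₀ hρ
    linarith
  rw [div_mul_eq_div_div, one_div]
  simp only [div_eq_mul_inv]
  ring

/-- The quantity compared to `ε / 4` by the truncation loop. -/
def tailBound (r : ℕ → ℚ) (d : ℕ) : ℚ :=
  E.rhoHigh * E.pfBound * E.remSum r *
    (∑ k, ∑ j ∈ Finset.Icc 1 (E.mult k), ((d : ℚ) + 2) ^ (j - 1) / (E.rhoLow - 1) ^ j)
    * (1 / E.rhoLow) ^ (d + 1)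

lemma hasSum_tailTerm_tailBound (r : ℕ → ℚ) (d : ℕ) :
    HasSum (E.tailTerm r d) (E.tailBound r d) := by
  convert E.hasSum_tailTerm r d using 1
  simp only [tailBound]
  push_cast
  rw [Finset.mul_sum, Finset.sum_mul]
  refine Finset.sum_congr rfl fun k _ => ?_
  rw [Finset.mul_sum, Finset.sum_mul]
  refine Finset.sum_congr rfl fun j _ => ?_
  rw [one_div (E.rhoLow : ℝ)]

end ExpansionData

/-! ### Partial fraction tables, truncation loop and Newton loop -/

/-- Compare the coefficients of `t^l` in `B * Q = N` and solve for the term containing `Q_l`; this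
is the recurrence run by `seriesC`. -/
lemma quotCoeff_recurrence (β N : ℂ[X]) (μ : ℕ) {z : ℂ} (h0 : (taylor z β).coeff μ ≠ 0) (l : ℕ) :
    quotCoeff β N μ z l = ((taylor z N).coeff l - ∑ s ∈ Finset.range l,
      (taylor z β).coeff (μ + (s + 1)) * quotCoeff β N μ z (l - (s + 1)))
        * ((taylor z β).coeff μ)⁻¹ := by
  set B : PowerSeries ℂ := PowerSeries.mk fun l => (taylor z β).coeff (μ + l) with hB
  have hB0 : PowerSeries.constantCoeff B ≠ 0 := by
    rw [← PowerSeries.coeff_zero_eq_constantCoeff_apply, hB, PowerSeries.coeff_mk, add_zero]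
    exact h0
  set Q : PowerSeries ℂ := ((taylor z N : ℂ[X]) : PowerSeries ℂ) * B⁻¹ with hQ
  have hQB : B * Q = ((taylor z N : ℂ[X]) : PowerSeries ℂ) := by
    rw [hQ, mul_left_comm, PowerSeries.mul_inv_cancel _ hB0, mul_one]
  have h1 := congrArg (PowerSeries.coeff l) hQB
  rw [PowerSeries.coeff_mul, Polynomial.coeff_coe,
    Finset.Nat.sum_antidiagonal_eq_sum_range_succ_mk, Finset.sum_range_succ'] at h1
  simp only [hB, PowerSeries.coeff_mk, add_zero, Nat.sub_zero] at h1
  change _ + _ * quotCoeff β N μ z l = _ at h1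
  rw [eq_mul_inv_iff_mul_eq₀ h0, eq_sub_iff_add_eq, ← h1, add_comm, mul_comm]
  rfl

namespace ExpansionData

lemma seriesC_val (b : ℚ[X]) (num : ℕ → ℚ) (μ : ℕ) (z : GaussRat)
    (h0 : (taylor z.toComplex (liftPoly b)).coeff μ ≠ 0) :
    ∀ l < μ, ((seriesC (b := b) num μ z).val l).toComplex
      = quotCoeff (liftPoly b) (∑ i ∈ Finset.range (2 * b.natDegree + 1), C (num i : ℂ) * X ^ i)
          μ z.toComplex l := by
  set N := ∑ i ∈ Finset.range (2 * b.natDegree + 1), C (num i : ℂ) * X ^ i with hN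
  have hg : ∀ l, (taylorC (2 * b.natDegree) (liftCoeff b.natDegree (chebCoeff b)) l z).val.toComplex
      = (taylor z.toComplex (liftPoly b)).coeff l := fun l => taylorC_val _ _ _ _
  have hinner : ∀ (c : ℕ → GaussRat) (a : GaussRat) (l n : ℕ),
      (forLoop n (fun s acc => do
        let g ← taylorC (2 * b.natDegree) (liftCoeff b.natDegree (chebCoeff b)) (μ + (s + 1)) z
        let t ← g.mulC (c (l - (s + 1)))
        acc.subC t) a).val.toComplex = a.toComplex - ∑ s ∈ Finset.range n,
          (taylor z.toComplex (liftPoly b)).coeff (μ + (s + 1)) * (c (l - (s + 1))).toComplex := by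
    intro c a l n
    induction n with
    | zero => simp
    | succ n ih =>
      rw [forLoop_succ_val]
      simp only [bind_val, GaussRat.toComplex_subC, GaussRat.toComplex_mulC]
      rw [ih, hg, Finset.sum_range_succ]; ring
  simp only [seriesC, bind_val]
  refine forLoop_induct (fun t (c : ℕ → GaussRat) => ∀ l < t, (c l).toComplex
    = quotCoeff (liftPoly b) N μ z.toComplex l) μ _ _ (fun l hl => absurd hl (by omega)) ?_
  intro t ht c ih l hl
  simp only [bind_val, pure_val]
  rcases Nat.lt_succ_iff_lt_or_eq.1 hl with h | rfl
  · rw [Function.update_of_ne (by omega)]; exact ih l h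
  · rw [Function.update_self, GaussRat.toComplex_mulC, hinner, GaussRat.toComplex_invC, hg,
      taylorC_val, quotCoeff_recurrence _ _ _ h0 l]
    congr 2
    refine Finset.sum_congr rfl fun s hs => ?_
    rw [ih _ (by have := Finset.mem_range.1 hs; omega)]

lemma seriesC_ops_le (b : ℚ[X]) (num : ℕ → ℚ) (μ : ℕ) (z : GaussRat) :
    (seriesC (b := b) num μ z).ops ≤ ((2 * b.natDegree + 1) * 8 + 6
      + μ * ((2 * b.natDegree + 1) * 8 + μ * ((2 * b.natDegree + 1) * 8 + 8) + 6) : ℕ) := by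
  simp only [seriesC, bind_ops]
  rw [← add_assoc, Nat.cast_add]
  refine add_le_add ?_ ?_
  · rw [GaussRat.invC_ops]; push_cast
    have := taylorC_ops_le (2 * b.natDegree) (liftCoeff b.natDegree (chebCoeff b)) μ z
    push_cast at this
    gcongr
  · rw [Nat.cast_mul]
    refine forLoop_ops_le _ _ _ _ fun l hl c => ?_
    simp only [bind_ops, pure_ops, add_zero, GaussRat.mulC_ops]
    rw [Nat.cast_add, Nat.cast_add, ← add_assoc]
    refine add_le_add (add_le_add (taylorC_ops_le _ _ _ _) ?_) le_rfl
    refine (forLoop_ops_le _ _ _ ((2 * b.natDegree + 1) * 8 + 8 : ℕ) fun s _ acc => ?_).trans ?_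
    · simp only [bind_ops, GaussRat.mulC_ops, GaussRat.subC_ops]
      refine (add_le_add (taylorC_ops_le _ _ _ _) le_rfl).trans_eq ?_
      push_cast; norm_num
    · rw [Nat.cast_mul]
      gcongr

lemma powersC_val (u : GaussRat) (n : ℕ) :
    ∀ i ≤ n, ((powersC u n).val i).toComplex = u.toComplex ^ i := by
  refine forLoop_induct (fun t (pw : ℕ → GaussRat) => ∀ i ≤ t, (pw i).toComplex
    = u.toComplex ^ i) n _ _ (fun i hi => ?_) ?_
  · rw [Nat.le_zero.1 hi, pow_zero]; exact GaussRat.toComplex_one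
  · intro t ht pw ih i hi
    simp only [bind_val, pure_val]
    rcases Nat.le_succ_iff.1 hi with h | rfl
    · rw [Function.update_of_ne (by omega)]; exact ih i h
    · rw [Function.update_self, GaussRat.toComplex_mulC, ih t le_rfl, pow_succ]

lemma powersC_ops_le (u : GaussRat) (n : ℕ) : (powersC u n).ops ≤ n * 6 := by
  refine forLoop_ops_le _ _ _ 6 fun t _ pw => ?_
  simp [GaussRat.mulC_ops]

variable {b : ℚ[X]} (E : ExpansionData b)

/-- Cost of a test of the truncation loop. -/
def truncTestCost : ℕ := E.numRoots * (b.natDegree * (2 * b.natDegree + 3) + 1) + 3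

/-- `T` may be any number of passes after which the test is known to succeed. A test costs an amount
depending on the expansion data only, so the loop is linear in `T`; the starting power adds the term
`d₀`. -/
lemma truncC_spec (hb : b ≠ 0) (d₀ : ℕ) (r : ℕ → ℚ) (ε : ℚ) (T : ℕ)
    (hT : E.tailBound r (d₀ + T) ≤ ε / 4) :
    d₀ ≤ (E.truncC d₀ (E.remSum r) ε).val ∧ (E.truncC d₀ (E.remSum r) ε).val ≤ d₀ + T ∧
    E.tailBound r (E.truncC d₀ (E.remSum r) ε).val ≤ ε / 4 ∧
    (E.truncC d₀ (E.remSum r) ε).ops ≤ (d₀ + 6 + (T + 1) * E.truncTestCost + T : ℕ) := by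
  set x := 1 / E.rhoLow with hx
  set fin : TailState → Counted Bool := fun st => do
      let s ← sumC Finset.univ fun k => sumC (Finset.Icc 1 (E.mult k)) fun j => do
        let y ← addC st.deg 2
        let u ← powC y (j - 1)
        let v ← powC (E.rhoLow - 1) j
        divC u v
      let t ← mulC (E.rhoHigh * E.pfBound * E.remSum r) s
      let t' ← mulC t st.pow
      leC t' (ε / 4) with hfin
  set step : TailState → Counted TailState := fun st => do
      let p ← mulC st.pow x
      pure ⟨st.deg + 1, p⟩ with hstep
  have hst : ∀ t : ℕ, (fun u => (step u).val)^[t] ⟨d₀, (powC x (d₀ + 1)).val⟩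
      = ⟨d₀ + t, x ^ (d₀ + 1 + t)⟩ := by
    intro t
    induction t with
    | zero => simp [powC_val]
    | succ t ih =>
      rw [Function.iterate_succ_apply', ih]
      simp only [hstep, bind_val, pure_val, mulC_val]
      congr 1
      rw [← add_assoc, pow_succ]
  have hval : ∀ t : ℕ, (fin ⟨d₀ + t, x ^ (d₀ + 1 + t)⟩).val = true
      ↔ E.tailBound r (d₀ + t) ≤ ε / 4 := by
    intro t
    simp only [hfin, bind_val, sumC_val, addC_val, powC_val, divC_val, mulC_val, leC_val,
      decide_eq_true_eq, tailBound]
    rw [show d₀ + 1 + t = d₀ + t + 1 by ring]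
  have hcf : ∀ st, (fin st).ops ≤ (E.truncTestCost : ℕ) := by
    intro st
    simp only [hfin, bind_ops, mulC_ops, leC_ops]
    refine (add_le_add (sumC_ops_le _ _ ((b.natDegree * (2 * b.natDegree + 3) : ℕ) : ℕ∞)
      fun k _ => ?_) le_rfl).trans_eq ?_
    · refine (sumC_ops_le _ _ ((2 * b.natDegree + 2 : ℕ) : ℕ∞) fun j hj => ?_).trans ?_
      · simp only [bind_ops, addC_ops, divC_ops]
        have hj' := (Finset.mem_Icc.1 hj).2.trans (E.mult_le hb k)
        refine (add_le_add le_rfl (add_le_add (powC_ops_le _ _)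
          (add_le_add (powC_ops_le _ _) le_rfl))).trans ?_
        norm_cast
        omega
      · rw [Nat.card_Icc]
        norm_cast
        have := E.mult_le hb k
        gcongr
        omega
    · rw [truncTestCost, Finset.card_univ, Fintype.card_fin]
      push_cast; norm_num
  have hcs : ∀ st, (step st).ops ≤ 1 := fun st => by simp [hstep]
  obtain ⟨t, htT, h1, h2, h3⟩ := repeatUntil_spec fin step ⟨d₀, (powC x (d₀ + 1)).val⟩ T (by
    rw [hst, hval]; exact hT)
  have hres : (E.truncC d₀ (E.remSum r) ε).val = d₀ + t := by
    have : (E.truncC d₀ (E.remSum r) ε).val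
      = (repeatUntil fin step ⟨d₀, (powC x (d₀ + 1)).val⟩).val.deg := rfl
    rw [this, h1, hst]
  rw [hst, hval] at h2
  rw [hres]
  refine ⟨by omega, by omega, h2, ?_⟩
  have hops : (E.truncC d₀ (E.remSum r) ε).ops = 1 + ((powC x (d₀ + 1)).ops + (1 + (1 + (1 + (1 +
    ((repeatUntil fin step ⟨d₀, (powC x (d₀ + 1)).val⟩).ops + 0)))))) := rfl
  rw [hops]
  refine (add_le_add le_rfl (add_le_add (powC_ops_le _ _) (add_le_add le_rfl (add_le_add le_rfl
    (add_le_add le_rfl (add_le_add le_rfl (add_le_add (h3 _ _ hcf hcs) le_rfl))))))).trans ?_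
  norm_cast
  rw [mul_one]
  omega

/-- Cost of a Newton step. -/
def newtonCost : ℕ := 1 + E.numRoots * ((2 * b.natDegree + 1) * 8 + 8)

lemma newtonStep_ops_le (st : RootState E.numRoots) : (E.newtonStep st).ops ≤ E.newtonCost := by
  simp only [newtonStep, bind_ops, divC_ops, pure_ops, add_zero, newtonCost]
  rw [Nat.cast_add, Nat.cast_one]
  gcongr
  refine (familyC_ops_le _ ((2 * b.natDegree + 1) * 8 + 8 : ℕ) fun k => ?_).trans_eq ?_
  · simp only [bind_ops, GaussRat.mulC_ops, GaussRat.subC_ops]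
    refine (add_le_add (taylorC_ops_le _ _ _ _) le_rfl).trans_eq ?_
    push_cast; norm_num
  · simp

/-- The stored radius is halved exactly when the simplified Newton step halves the true distance, so
it is always a valid error bound. Points never leave the initial disk, where the contraction holds.
-/
lemma newton_iterate (t : ℕ) :
    ((fun u => (E.newtonStep u).val)^[t] ⟨E.rad, E.start⟩).rad = E.rad / 2 ^ t ∧
    ∀ k, ‖(((fun u => (E.newtonStep u).val)^[t] ⟨E.rad, E.start⟩).pt k).toComplex - E.root k‖
      ≤ (E.rad / 2 ^ t : ℝ) := by
  induction t with
  | zero => exact ⟨by simp, fun k => by simpa using E.start_mem k⟩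
  | succ t ih =>
    rw [Function.iterate_succ_apply']
    set st := (fun u => (E.newtonStep u).val)^[t] ⟨E.rad, E.start⟩
    have hrad : (0 : ℝ) < E.rad := by exact_mod_cast E.rad_pos
    refine ⟨?_, fun k => ?_⟩
    · simp only [newtonStep, bind_val, pure_val, divC_val]
      rw [ih.1, pow_succ, div_div]
    · simp only [newtonStep, bind_val, pure_val, familyC_val, GaussRat.toComplex_subC,
        GaussRat.toComplex_mulC, taylorC_val]
      have h1 := ih.2 k
      have h2 := E.newton k _ (h1.trans (div_le_self hrad.le (one_le_pow₀ (by norm_num))))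
      refine h2.trans ?_
      rw [pow_succ, ← div_div]
      gcongr

/-- Cost of the preparation of the Newton iteration. -/
def rootsInitCost : ℕ := E.numRoots * (b.natDegree * (b.natDegree + 2) + 1) + b.natDegree + 7

lemma rootsC_spec (hb : b ≠ 0) (r : ℕ → ℚ) (ε : ℚ) (T : ℕ)
    (hT : E.newtonConst r * (E.rad / 2 ^ T) ≤ (1 - 1 / E.rhoLow) ^ (b.natDegree + 1) * ε / 4) :
    ∃ e : ℝ, 0 ≤ e ∧ e ≤ E.rad ∧
      (∀ k, ‖((E.rootsC (E.remSum r) ε).val.pt k).toComplex - E.root k‖ ≤ e) ∧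
      E.newtonConst r * e ≤ (1 - (E.rhoLow : ℝ)⁻¹) ^ (b.natDegree + 1) * ε / 4 ∧
      (E.rootsC (E.remSum r) ε).ops
        ≤ (E.rootsInitCost + (T + 1) * 2 + T * E.newtonCost : ℕ) := by
  set x := 1 / E.rhoLow with hx
  set s₀ : Counted ℚ := sumC Finset.univ fun k => sumC (Finset.Icc 1 (E.mult k)) fun j => do
    let u ← powC x j
    mulC j u with hs₀
  set M := E.pfBound * E.remSum r * s₀.val with hM
  set z := (powC (1 - x) (b.natDegree + 1)).val * ε / 4 with hz
  set fin : RootState E.numRoots → Counted Bool := fun st => do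
      let u ← mulC M st.rad
      leC u z with hfin
  have hMeq : M = E.newtonConst r := by
    simp only [hM, hs₀, sumC_val, bind_val, mulC_val, powC_val, newtonConst, hx]
  have hzeq : z = (1 - x) ^ (b.natDegree + 1) * ε / 4 := by rw [hz, powC_val]
  have hval : ∀ st : RootState E.numRoots, (fin st).val = true ↔ E.newtonConst r * st.rad ≤ z := by
    intro st
    simp only [hfin, bind_val, mulC_val, leC_val, decide_eq_true_eq, hMeq]
  obtain ⟨t, htT, h1, h2, h3⟩ := repeatUntil_spec fin E.newtonStep ⟨E.rad, E.start⟩ T (by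
    rw [hval, (E.newton_iterate T).1, hzeq]; exact hT)
  have hres : (E.rootsC (E.remSum r) ε).val
      = (repeatUntil fin E.newtonStep ⟨E.rad, E.start⟩).val := rfl
  have hrad : (0 : ℝ) < E.rad := by exact_mod_cast E.rad_pos
  rw [hval, (E.newton_iterate t).1, hzeq] at h2
  refine ⟨E.rad / 2 ^ t, by positivity, div_le_self hrad.le (one_le_pow₀ (by norm_num)),
    fun k => ?_, ?_, ?_⟩
  · rw [hres, h1]; exact (E.newton_iterate t).2 k
  · have h4 : ((E.newtonConst r * (E.rad / 2 ^ t) : ℚ) : ℝ)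
      ≤ (((1 - x) ^ (b.natDegree + 1) * ε / 4 : ℚ) : ℝ) := by exact_mod_cast h2
    push_cast at h4
    rw [hx] at h4
    push_cast at h4
    rwa [one_div] at h4
  · have hops : (E.rootsC (E.remSum r) ε).ops = 1 + (s₀.ops + (1 + (1 + (1 +
      ((powC (1 - x) (b.natDegree + 1)).ops + (1 + (1 +
        (repeatUntil fin E.newtonStep ⟨E.rad, E.start⟩).ops))))))) := rfl
    have hcf : ∀ st, (fin st).ops ≤ 2 := fun st => by
      simp [hfin]; norm_num
    have hs : s₀.ops ≤ (E.numRoots * (b.natDegree * (b.natDegree + 2) + 1) : ℕ) := by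
      refine (sumC_ops_le _ _ ((b.natDegree * (b.natDegree + 2) : ℕ) : ℕ∞)
        fun k _ => ?_).trans_eq ?_
      · refine (sumC_ops_le _ _ ((b.natDegree + 1 : ℕ) : ℕ∞) fun j hj => ?_).trans ?_
        · simp only [bind_ops, mulC_ops]
          have hj' := (Finset.mem_Icc.1 hj).2.trans (E.mult_le hb k)
          refine (add_le_add (powC_ops_le _ _) le_rfl).trans ?_
          norm_cast
          omega
        · rw [Nat.card_Icc]
          norm_cast
          have := E.mult_le hb k
          gcongr
          omega
      · rw [Finset.card_univ, Fintype.card_fin]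
        push_cast; norm_num
    rw [hops]
    refine (add_le_add le_rfl (add_le_add hs (add_le_add le_rfl (add_le_add le_rfl
      (add_le_add le_rfl (add_le_add (powC_ops_le _ _) (add_le_add le_rfl (add_le_add le_rfl
        (h3 _ _ hcf E.newtonStep_ops_le))))))))).trans ?_
    rw [rootsInitCost]
    norm_cast
    omega

end ExpansionData

/-! ### Error of the expansion procedure in `ℓ¹` -/

open scoped ENNReal

lemma tsum_int_natAbs_le (f : ℕ → ℝ≥0∞) : ∑' n : ℤ, f n.natAbs ≤ 2 * ∑' n : ℕ, f n := by
  rw [tsum_of_nat_of_neg_add_one (f := fun n : ℤ => f n.natAbs) ENNReal.summable ENNReal.summable,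
    two_mul]
  refine add_le_add (le_of_eq (by simp)) ?_
  have h : ∀ n : ℕ, (-((n : ℤ) + 1)).natAbs = n + 1 := fun n => by omega
  simp only [h]
  exact ENNReal.tsum_comp_le_tsum_of_injective (add_left_injective 1) f

lemma ChebVec.WF.exists_bound {f : ChebVec} (hf : f.WF) : ∃ M, ∀ j, |f.coeff j| ≤ M := by
  refine ⟨∑ i ∈ Finset.range (f.deg + 1), |f.coeff i|, fun j => ?_⟩
  rcases lt_or_ge j (f.deg + 1) with h | h
  · exact Finset.single_le_sum (f := fun i => |f.coeff i|) (fun _ _ => abs_nonneg _)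
      (Finset.mem_range.2 h)
  · rw [hf j h, abs_zero]
    exact Finset.sum_nonneg fun _ _ => abs_nonneg _

namespace ExpansionData

variable {b : ℚ[X]} (E : ExpansionData b)

/-- The exact Chebyshev coefficients of `f / b`. -/
def trueCoeff (f : ChebVec) (n : ℕ) : ℝ :=
  ((divModC f (ChebVec.ofPoly b)).val.quo n : ℝ)
    + (E.wFun (divModC f (ChebVec.ofPoly b)).val.rem E.root n).re

lemma chebCoeff_bound (b : ℚ[X]) (j : ℕ) :
    |(ChebVec.ofPoly b).coeff j| ≤ ∑ i ∈ Finset.range (b.natDegree + 1), |chebCoeff b i| := by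
  rcases lt_or_ge j (b.natDegree + 1) with h | h
  · exact Finset.single_le_sum (f := fun i => |chebCoeff b i|) (fun _ _ => abs_nonneg _)
      (Finset.mem_range.2 h)
  · rw [ChebVec.ofPoly_wf b j h, abs_zero]
    exact Finset.sum_nonneg fun _ _ => abs_nonneg _

/-- The growth factor of the remainders during a division by `b`. -/
def divFactor (b : ℚ[X]) : ℚ :=
  1 + 2 * (∑ i ∈ Finset.range (b.natDegree + 1), |chebCoeff b i|) / |chebCoeff b b.natDegree|

lemma one_le_divFactor (b : ℚ[X]) : 1 ≤ divFactor b := by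
  have : 0 ≤ ∑ i ∈ Finset.range (b.natDegree + 1), |chebCoeff b i| :=
    Finset.sum_nonneg fun _ _ => abs_nonneg _
  rw [divFactor]
  exact le_add_of_nonneg_right (by positivity)

lemma divModC_facts (hb : b ≠ 0) {f : ChebVec} (hf : f.WF) :
    f.toPoly = b * (ChebVec.mk (f.deg - b.natDegree) (divModC f (ChebVec.ofPoly b)).val.quo).toPoly
      + (ChebVec.mk b.natDegree
          (truncSeq b.natDegree (divModC f (ChebVec.ofPoly b)).val.rem)).toPoly ∧
    (ChebVec.mk (f.deg - b.natDegree) (divModC f (ChebVec.ofPoly b)).val.quo).WF ∧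
    ∀ M : ℚ, (∀ j, |f.coeff j| ≤ M) →
      ∀ j, |(divModC f (ChebVec.ofPoly b)).val.rem j| ≤ divFactor b ^ (f.deg + 1) * M := by
  have hbwf := ChebVec.ofPoly_wf b
  have hlead : (ChebVec.ofPoly b).coeff (ChebVec.ofPoly b).deg ≠ 0 := chebCoeff_natDegree_ne_zero hb
  obtain ⟨M₀, hM₀⟩ := hf.exists_bound
  obtain ⟨h1, h2, h3, -⟩ := divModC_spec hf hbwf hlead (chebCoeff_bound b) hM₀
  set qr := (divModC f (ChebVec.ofPoly b)).val
  set q : ChebVec := ⟨f.deg - b.natDegree, qr.quo⟩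
  set ρ : ChebVec := ⟨b.natDegree, truncSeq b.natDegree qr.rem⟩
  have hq : q.WF := fun j hj => by
    by_contra h
    have h4 : j + b.natDegree ≤ f.deg := h2 j h
    have h5 : f.deg - b.natDegree < j := hj
    omega
  have hρ : ρ.WF := fun j hj => if_neg (by change b.natDegree < j at hj; omega)
  have hρrem : ∀ j, ρ.coeff j = qr.rem j := fun j => by
    change truncSeq _ _ _ = _
    rw [truncSeq]
    split_ifs with h
    · rfl
    · exact (h3 j (by change b.natDegree ≤ j; omega)).symm
  refine ⟨?_, hq, fun M hM j => ?_⟩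
  · have h6 : ((ChebVec.ofPoly b).mulC q).val.toPoly = b * q.toPoly := by
      rw [ChebVec.mulC_toPoly hq, ChebVec.ofPoly_toPoly]
    rw [← h6, ChebVec.toPoly_eq_finsum hf, ChebVec.toPoly_eq_finsum (ChebVec.mulC_wf _ _),
      ChebVec.toPoly_eq_finsum hρ, ← finsum_add_distrib]
    · refine finsum_congr fun n => ?_
      rw [← add_mul, ← C_add, ChebVec.mulC_coeff hq, hρrem, h1]
    · exact finite_support_of_natAbs _ _ fun n hn => by
        rw [ChebVec.mulC_wf (ChebVec.ofPoly b) q _ hn, C_0, zero_mul]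
    · exact finite_support_of_natAbs _ _ fun n hn => by rw [hρ _ hn, C_0, zero_mul]
  · obtain ⟨-, -, -, h7⟩ := divModC_spec hf hbwf hlead (chebCoeff_bound b) hM
    refine (h7 j).trans ?_
    have hM0 : 0 ≤ M := (abs_nonneg _).trans (hM 0)
    refine mul_le_mul_of_nonneg_right ?_ hM0
    exact pow_le_pow_right₀ (one_le_divFactor b) (Nat.sub_le _ _)

lemma hasSum_trueCoeff (hb : NoZero b) {f : ChebVec} (hf : f.WF) {z : ℂ} (hz : ‖z‖ = 1) :
    HasSum (fun n : ℤ => (E.trueCoeff f n.natAbs : ℂ) * z ^ n)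
      (aeval ((z + z⁻¹) / 2) f.toPoly / aeval ((z + z⁻¹) / 2) b) := by
  obtain ⟨h1, h2, -⟩ := divModC_facts hb.ne_zero hf
  have h3 := ChebVec.hasSum_joukowski h2 (ne_zero_of_norm_one hz)
  have h4 := h3.add (E.hasSum_wFun_re hb (divModC f (ChebVec.ofPoly b)).val.rem hz)
  have h5 := hb.aeval_joukowski_ne_zero hz
  rw [h1, map_add, map_mul, add_div, mul_div_cancel_left₀ _ h5]
  refine h4.congr_fun fun n => ?_
  simp only [trueCoeff]
  push_cast
  ring

lemma expandC_deg (f : ChebVec) (ε : ℚ) : (E.expandC f ε).val.deg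
    = (E.truncC (f.deg - b.natDegree)
        (E.remSum (divModC f (ChebVec.ofPoly b)).val.rem) ε).val := rfl

/-- The computation of one coefficient of the expansion, from the tables of partial fraction
coefficients and of powers of the inverse roots. -/
def coeffC (quo rem : ℕ → ℚ) (pt : Fin E.numRoots → GaussRat) (N n : ℕ) : Counted ℚ := do
  let w ← sumC Finset.univ fun k => sumC (Finset.Icc 1 (E.mult k)) fun j => do
    let c ← binomC n j
    let c' ← mulC ((-1) ^ j) c
    let v ← ((seriesC (b := b) (liftCoeff b.natDegree (truncSeq b.natDegree rem)) (E.mult k)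
      (pt k)).val (E.mult k - j)).mulC ((powersC (pt k).invC.val N).val (n + j))
    mulC c' v.re
  addC (quo n) w

lemma expandC_val (f : ChebVec) (ε : ℚ) : (E.expandC f ε).val
    = (buildC (E.truncC (f.deg - b.natDegree)
        (E.remSum (divModC f (ChebVec.ofPoly b)).val.rem) ε).val
      (E.coeffC (divModC f (ChebVec.ofPoly b)).val.quo (divModC f (ChebVec.ofPoly b)).val.rem
        (E.rootsC (E.remSum (divModC f (ChebVec.ofPoly b)).val.rem) ε).val.pt
        ((E.truncC (f.deg - b.natDegree)
          (E.remSum (divModC f (ChebVec.ofPoly b)).val.rem) ε).val + b.natDegree))).val := rfl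

lemma expandC_wf (f : ChebVec) (ε : ℚ) : (E.expandC f ε).val.WF := by
  rw [expandC_val]
  exact ChebVec.buildC_wf _ _

lemma expandC_coeff (hb : b ≠ 0) (f : ChebVec) (ε : ℚ)
    {pt : Fin E.numRoots → GaussRat}
    (hpt : pt = (E.rootsC (E.remSum (divModC f (ChebVec.ofPoly b)).val.rem) ε).val.pt)
    (hdisk : ∀ k, ‖(pt k).toComplex - E.root k‖ ≤ E.rad)
    {n : ℕ} (hn : n ≤ (E.expandC f ε).val.deg) :
    ((E.expandC f ε).val.coeff n : ℝ) = ((divModC f (ChebVec.ofPoly b)).val.quo n : ℝ)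
      + (E.wFun (divModC f (ChebVec.ofPoly b)).val.rem (fun k => (pt k).toComplex) n).re := by
  set rem := (divModC f (ChebVec.ofPoly b)).val.rem
  rw [expandC_deg] at hn
  set d' := (E.truncC (f.deg - b.natDegree) (E.remSum rem) ε).val with hd'
  have h1 : (E.expandC f ε).val.coeff n = (divModC f (ChebVec.ofPoly b)).val.quo n
      + ∑ k, ∑ j ∈ Finset.Icc 1 (E.mult k), (-1) ^ j * (binomC n j).val *
        (((seriesC (b := b) (liftCoeff b.natDegree (truncSeq b.natDegree rem)) (E.mult k)
          (pt k)).val (E.mult k - j)).mulC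
            ((powersC (pt k).invC.val (d' + b.natDegree)).val (n + j))).val.re := by
    rw [expandC_val, ChebVec.buildC_val_coeff, if_pos hn, hpt]
    rfl
  rw [h1]
  push_cast
  congr 1
  rw [wFun, Complex.re_sum]
  refine Finset.sum_congr rfl fun k _ => ?_
  rw [Complex.re_sum]
  refine Finset.sum_congr rfl fun j hj => ?_
  have hj' := Finset.mem_Icc.1 hj
  have hm := E.mult_le hb k
  rw [← GaussRat.toComplex_re, GaussRat.toComplex_mulC,
    seriesC_val b _ _ _ (E.coeff_ne_zero k _ (hdisk k)) _ (by omega),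
    powersC_val _ _ _ (by omega), GaussRat.toComplex_invC, binomC_val _ _ hj'.1, pf, pfNum_eq]
  have h2 : ((n + j - 1).choose (j - 1) : ℂ) * ((-1) ^ j * quotCoeff (liftPoly b) (E.numer rem)
      (E.mult k) (pt k).toComplex (E.mult k - j)) * (pt k).toComplex⁻¹ ^ (n + j)
      = (((-1) ^ j * ((n + j - 1).choose (j - 1) : ℕ) : ℝ) : ℂ) * (quotCoeff (liftPoly b)
        (E.numer rem) (E.mult k) (pt k).toComplex (E.mult k - j)
          * (pt k).toComplex⁻¹ ^ (n + j)) := by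
    push_cast; ring
  rw [h2, Complex.re_ofReal_mul]
  push_cast
  rfl

/-- The expansion procedure has an error at most `ε` in the sum of the absolute values of the
Chebyshev coefficients. -/
lemma expandC_error (hb : b ≠ 0) {f : ChebVec} (hf : f.WF) {ε : ℚ} (hε : 0 < ε)
    {T₁ T₂ : ℕ}
    (hT₁ : E.tailBound (divModC f (ChebVec.ofPoly b)).val.rem (f.deg - b.natDegree + T₁) ≤ ε / 4)
    (hT₂ : E.newtonConst (divModC f (ChebVec.ofPoly b)).val.rem * (E.rad / 2 ^ T₂)
      ≤ (1 - 1 / E.rhoLow) ^ (b.natDegree + 1) * ε / 4) :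
    ∑' n : ℤ, ‖((E.expandC f ε).val.coeff n.natAbs : ℝ) - E.trueCoeff f n.natAbs‖ₑ
      ≤ ENNReal.ofReal ε := by
  set rem := (divModC f (ChebVec.ofPoly b)).val.rem with hrem
  obtain ⟨hd₀, -, htail, -⟩ := E.truncC_spec hb (f.deg - b.natDegree) rem ε T₁ hT₁
  obtain ⟨e, he0, herad, hept, hnewt, -⟩ := E.rootsC_spec hb rem ε T₂ hT₂
  set d' := (E.truncC (f.deg - b.natDegree) (E.remSum rem) ε).val with hd'
  set pt := (E.rootsC (E.remSum rem) ε).val.pt with hpt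
  have hεR : (0 : ℝ) < ε := by exact_mod_cast hε
  let g : ℕ → ℝ := fun n => if n ≤ d' then 0 else E.tailTerm rem d' (n - (d' + 1))
  have hg : HasSum g (E.tailBound rem d') := by
    rw [← hasSum_nat_add_iff' (d' + 1), Finset.sum_eq_zero, sub_zero]
    · refine (E.hasSum_tailTerm_tailBound rem d').congr_fun fun n => ?_
      simp only [g]
      rw [if_neg (by omega), Nat.add_sub_cancel]
    · intro n hn
      exact if_pos (by have := Finset.mem_range.1 hn; omega)
  have hsum := (E.hasSum_rootErr rem e).add hg
  have hroot0 : ∀ n, 0 ≤ E.rootErr rem e n := fun n =>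
    (norm_nonneg _).trans (E.norm_wFun_sub_le hb rem herad hept n)
  have hg0 : ∀ n, 0 ≤ g n := fun n => by
    simp only [g]
    split_ifs
    · exact le_rfl
    · exact (norm_nonneg _).trans (E.norm_wFun_le_tailTerm hb rem d' _)
  have hbound : ∀ n : ℕ, ‖((E.expandC f ε).val.coeff n : ℝ) - E.trueCoeff f n‖
      ≤ E.rootErr rem e n + g n := by
    intro n
    -- Up to `d'` only the root errors matter. Beyond it the output is zero and so is the quotient,
    -- because `d' ≥ deg f - deg b`, which leaves the tail of the remainder part.
    rcases le_or_gt n d' with hn | hn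
    · rw [E.expandC_coeff hb f ε hpt (fun k => (hept k).trans herad) hn, trueCoeff,
        add_sub_add_left_eq_sub, ← Complex.sub_re]
      refine (Complex.abs_re_le_norm _).trans ?_
      exact (E.norm_wFun_sub_le hb rem herad hept n).trans (le_add_of_nonneg_right (hg0 n))
    · have h0 : (E.expandC f ε).val.coeff n = 0 := E.expandC_wf f ε n hn
      have hq : (divModC f (ChebVec.ofPoly b)).val.quo n = 0 :=
        (divModC_facts hb hf).2.1 n (hd₀.trans_lt hn)
      rw [h0, trueCoeff, hq]
      simp only [Rat.cast_zero, zero_add, zero_sub, norm_neg]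
      refine (Complex.abs_re_le_norm _).trans ?_
      have h1 := E.norm_wFun_le_tailTerm hb rem d' (n - (d' + 1))
      rw [show d' + 1 + (n - (d' + 1)) = n by omega] at h1
      have h2 : g n = E.tailTerm rem d' (n - (d' + 1)) := if_neg (by omega)
      rw [h2]
      exact h1.trans (le_add_of_nonneg_left (hroot0 n))
  -- Roots and truncation each cost at most `ε / 4` over `n ≥ 0`; doubling for the negative indices
  -- then gives `ε`.
  have hnat : ∑' n : ℕ, ‖((E.expandC f ε).val.coeff n : ℝ) - E.trueCoeff f n‖ₑ
      ≤ ENNReal.ofReal (ε / 2) := by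
    calc _ ≤ ∑' n : ℕ, ENNReal.ofReal (E.rootErr rem e n + g n) := by
          refine ENNReal.tsum_le_tsum fun n => ?_
          rw [← ofReal_norm]
          exact ENNReal.ofReal_le_ofReal (hbound n)
      _ = ENNReal.ofReal (∑' n, (E.rootErr rem e n + g n)) :=
          (ENNReal.ofReal_tsum_of_nonneg (fun n => add_nonneg (hroot0 n) (hg0 n)) hsum.summable).symm
      _ ≤ _ := by
          rw [hsum.tsum_eq]
          refine ENNReal.ofReal_le_ofReal ?_
          have h1 := E.tsum_rootErr_le hb rem he0 hnewt
          have h2 : (E.tailBound rem d' : ℝ) ≤ ε / 4 := by exact_mod_cast htail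
          linarith
  refine (tsum_int_natAbs_le fun n =>
    ‖((E.expandC f ε).val.coeff n : ℝ) - E.trueCoeff f n‖ₑ).trans ?_
  refine (mul_le_mul_right hnat 2).trans_eq ?_
  rw [← ENNReal.ofReal_ofNat, ← ENNReal.ofReal_mul (by norm_num)]
  congr 1
  ring

end ExpansionData

/-! ### Number of loop steps and cost of an expansion -/

/-- An exponentially decreasing sequence falls below `1 / Q` after `O(log Q)` steps. -/
lemma exists_mul_pow_le_one {θ : ℝ} (h0 : 0 < θ) (h1 : θ < 1) :
    ∃ C : ℝ, 0 ≤ C ∧ ∀ Q : ℝ, 0 ≤ Q → ∃ T : ℕ, Q * θ ^ T ≤ 1 ∧ T ≤ C * (1 + Real.log (1 + Q)) := by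
  have hl : 0 < -Real.log θ := neg_pos.2 (Real.log_neg h0 h1)
  refine ⟨1 + (-Real.log θ)⁻¹, by positivity, fun Q hQ => ?_⟩
  have hq : 0 ≤ Real.log (1 + Q) := Real.log_nonneg (by linarith)
  refine ⟨⌈Real.log (1 + Q) / (-Real.log θ)⌉₊, ?_, ?_⟩
  · set T := ⌈Real.log (1 + Q) / (-Real.log θ)⌉₊
    have h2 : Real.log (1 + Q) ≤ T * (-Real.log θ) := (div_le_iff₀ hl).1 (Nat.le_ceil _)
    have h3 : Real.log ((1 + Q) * θ ^ T) ≤ 0 := by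
      rw [Real.log_mul (by positivity) (by positivity), Real.log_pow]
      linarith
    have h4 : (1 + Q) * θ ^ T ≤ 1 := by
      by_contra h
      exact absurd (Real.log_pos (not_le.1 h)) (not_lt.2 h3)
    have h5 : 0 ≤ θ ^ T := by positivity
    linarith
  · have h6 := (Nat.ceil_lt_add_one (div_nonneg hq hl.le)).le
    refine h6.trans ?_
    rw [div_eq_mul_inv]
    have : 0 ≤ (-Real.log θ)⁻¹ := by positivity
    nlinarith

lemma log_one_add_mul_le {x y : ℝ} (hx : 0 ≤ x) (hy : 0 ≤ y) :
    Real.log (1 + x * y) ≤ Real.log (1 + x) + Real.log (1 + y) := by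
  rw [← Real.log_mul (by positivity) (by positivity)]
  refine Real.log_le_log (by positivity) ?_
  nlinarith

lemma log_one_add_pow_mul_le {D y : ℝ} (hD : 1 ≤ D) (hy : 0 ≤ y) (k : ℕ) :
    Real.log (1 + D ^ k * y) ≤ k * Real.log D + Real.log (1 + y) := by
  have h : 1 ≤ D ^ k := one_le_pow₀ hD
  rw [← Real.log_pow, ← Real.log_mul (by positivity) (by positivity)]
  refine Real.log_le_log (by positivity) ?_
  nlinarith

lemma exists_bound_pow_mul_pow (k : ℕ) {θ : ℝ} (h0 : 0 ≤ θ) (h1 : θ < 1) :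
    ∃ c : ℝ, 0 ≤ c ∧ ∀ n : ℕ, (n : ℝ) ^ k * θ ^ n ≤ c := by
  obtain ⟨c, hc⟩ := (tendsto_pow_const_mul_const_pow_of_abs_lt_one k
    (by rwa [abs_of_nonneg h0])).bddAbove_range
  have hc' : ∀ n : ℕ, (n : ℝ) ^ k * θ ^ n ≤ c := fun n => hc ⟨n, rfl⟩
  exact ⟨c, le_trans (by positivity) (hc' 0), hc'⟩

namespace ExpansionData

variable {b : ℚ[X]} (E : ExpansionData b)

/-- Take `θ = ρ₋^{-1/2}`: the factor `ρ₋^{-(d+1)}` equals `θ^{d+2} θ^d`, where the first half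
absorbs the polynomial `(d+2)^{j-1}` and the second remains. -/
lemma exists_tailBound_le (hb : b ≠ 0) : ∃ θ K : ℝ, 0 < θ ∧ θ < 1 ∧ 0 ≤ K ∧
    ∀ r d, (E.tailBound r d : ℝ) ≤ K * E.remSum r * θ ^ d := by
  have hρ := E.one_lt_rhoLow_real
  set θ : ℝ := Real.sqrt (1 / E.rhoLow) with hθ
  have hinv : (0 : ℝ) < 1 / E.rhoLow := by positivity
  have hθ0 : 0 < θ := Real.sqrt_pos.2 hinv
  have hθ1 : θ < 1 := by
    rw [hθ, Real.sqrt_lt' one_pos, one_pow, div_lt_one (by positivity)]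
    exact hρ
  have hsq : θ ^ 2 = 1 / E.rhoLow := Real.sq_sqrt hinv.le
  choose c hc0 hc using fun k => exists_bound_pow_mul_pow k hθ0.le hθ1
  -- Without roots the signs of `pfBound` and `rhoHigh` are unknown, but the bound is an empty sum.
  rcases isEmpty_or_nonempty (Fin E.numRoots) with hE | ⟨⟨k₀⟩⟩
  · refine ⟨θ, 0, hθ0, hθ1, le_rfl, fun r d => ?_⟩
    simp [tailBound]
  have hS : (0 : ℝ) ≤ E.pfBound := by exact_mod_cast E.pfBound_nonneg hb k₀
  have hH : (0 : ℝ) ≤ E.rhoHigh := by exact_mod_cast E.rhoHigh_nonneg k₀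
  refine ⟨θ, E.rhoHigh * E.pfBound * ∑ k, ∑ j ∈ Finset.Icc 1 (E.mult k),
    c (j - 1) / ((E.rhoLow : ℝ) - 1) ^ j, hθ0, hθ1, ?_, fun r d => ?_⟩
  · refine mul_nonneg (mul_nonneg hH hS) (Finset.sum_nonneg fun k _ => Finset.sum_nonneg fun j _ =>
      div_nonneg (hc0 _) (pow_nonneg (by linarith) _))
  · have hR : (0 : ℝ) ≤ E.remSum r := by exact_mod_cast E.remSum_nonneg r
    have key : (∑ k, ∑ j ∈ Finset.Icc 1 (E.mult k),
          ((d : ℝ) + 2) ^ (j - 1) / ((E.rhoLow : ℝ) - 1) ^ j) * (1 / E.rhoLow) ^ (d + 1)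
        ≤ (∑ k, ∑ j ∈ Finset.Icc 1 (E.mult k), c (j - 1) / ((E.rhoLow : ℝ) - 1) ^ j) * θ ^ d := by
      rw [Finset.sum_mul, Finset.sum_mul]
      refine Finset.sum_le_sum fun k _ => ?_
      rw [Finset.sum_mul, Finset.sum_mul]
      refine Finset.sum_le_sum fun j _ => ?_
      rw [div_mul_eq_mul_div, div_mul_eq_mul_div]
      refine div_le_div_of_nonneg_right ?_ (pow_nonneg (by linarith) _)
      rw [← hsq, ← pow_mul, show 2 * (d + 1) = (d + 2) + d by ring, pow_add, ← mul_assoc]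
      refine mul_le_mul_of_nonneg_right ?_ (by positivity)
      have := hc (j - 1) (d + 2)
      push_cast at this
      exact this
    rw [tailBound]
    push_cast
    calc _ = E.rhoHigh * E.pfBound * E.remSum r * ((∑ k, ∑ j ∈ Finset.Icc 1 (E.mult k),
          ((d : ℝ) + 2) ^ (j - 1) / ((E.rhoLow : ℝ) - 1) ^ j) * (1 / E.rhoLow) ^ (d + 1)) := by ring
      _ ≤ E.rhoHigh * E.pfBound * E.remSum r * ((∑ k, ∑ j ∈ Finset.Icc 1 (E.mult k),
          c (j - 1) / ((E.rhoLow : ℝ) - 1) ^ j) * θ ^ d) :=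
        mul_le_mul_of_nonneg_left key (mul_nonneg (mul_nonneg hH hS) hR)
      _ = _ := by ring

/-- Both loops of the expansion procedure stop after `O(log R + log ε⁻¹)` steps. -/
lemma exists_steps (hb : b ≠ 0) : ∃ C : ℝ, 0 ≤ C ∧ ∀ (r : ℕ → ℚ) (d₀ : ℕ) (ε : ℚ), 0 < ε →
    ∃ T₁ T₂ : ℕ, E.tailBound r (d₀ + T₁) ≤ ε / 4 ∧
      E.newtonConst r * (E.rad / 2 ^ T₂) ≤ (1 - 1 / E.rhoLow) ^ (b.natDegree + 1) * ε / 4 ∧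
      ((T₁ + T₂ : ℕ) : ℝ)
        ≤ C * (1 + Real.log (1 + (E.remSum r : ℝ)) + Real.log (1 + 1 / (ε : ℝ))) := by
  obtain ⟨θ, K, hθ0, hθ1, hK, htail⟩ := E.exists_tailBound_le hb
  obtain ⟨C₁, hC₁, h₁⟩ := exists_mul_pow_le_one hθ0 hθ1
  obtain ⟨C₂, hC₂, h₂⟩ := exists_mul_pow_le_one (θ := 1 / 2) (by norm_num) (by norm_num)
  have hρ := E.one_lt_rhoLow_real
  set s : ℝ := ∑ k, ∑ j ∈ Finset.Icc 1 (E.mult k), j * (1 / (E.rhoLow : ℝ)) ^ j with hs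
  set κ : ℝ := (1 - 1 / (E.rhoLow : ℝ)) ^ (b.natDegree + 1) with hκ
  have hκ0 : 0 < κ := pow_pos (by rw [sub_pos, div_lt_one (by positivity)]; exact hρ) _
  have hs0 : 0 ≤ s := Finset.sum_nonneg fun k _ => Finset.sum_nonneg fun j _ => by positivity
  -- The ratio of the initial Newton test value to its target `κ ε / 4`, apart from `R / ε`. The
  -- absolute value covers the case without roots, where `pfBound` may be negative.
  set K₂ : ℝ := 4 * |(E.pfBound : ℝ)| * s * E.rad / κ with hK₂
  have hrad : (0 : ℝ) < E.rad := by exact_mod_cast E.rad_pos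
  have hK₂0 : 0 ≤ K₂ := by positivity
  have hlog : ∀ x : ℝ, 0 ≤ x → 0 ≤ Real.log (1 + x) := fun x hx => Real.log_nonneg (by linarith)
  refine ⟨C₁ * (1 + Real.log (1 + 4 * K)) + C₂ * (1 + Real.log (1 + K₂)), ?_, fun r d₀ ε hε => ?_⟩
  · have := hlog (4 * K) (by positivity)
    have := hlog K₂ hK₂0
    positivity
  have hεR : (0 : ℝ) < ε := by exact_mod_cast hε
  have hR : (0 : ℝ) ≤ E.remSum r := by exact_mod_cast E.remSum_nonneg r
  set R : ℝ := ((E.remSum r : ℚ) : ℝ) with hRdef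
  obtain ⟨T₁, hT₁, hT₁'⟩ := h₁ (4 * K * (R * (1 / ε))) (by positivity)
  obtain ⟨T₂, hT₂, hT₂'⟩ := h₂ (K₂ * (R * (1 / ε))) (by positivity)
  refine ⟨T₁, T₂, ?_, ?_, ?_⟩
  · have h3 : (E.tailBound r (d₀ + T₁) : ℝ) ≤ ε / 4 := by
      refine (htail r _).trans ?_
      have h4 : K * R * θ ^ (d₀ + T₁) ≤ K * R * θ ^ T₁ :=
        mul_le_mul_of_nonneg_left (pow_le_pow_of_le_one hθ0.le hθ1.le (by omega)) (by positivity)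
      refine h4.trans ?_
      have h5 : 4 * K * (R * (1 / ε)) * θ ^ T₁ * ε = 4 * (K * R * θ ^ T₁) := by
        field_simp
      have := mul_le_mul_of_nonneg_right hT₁ hεR.le
      linarith
    exact_mod_cast h3
  · have h3 : (E.newtonConst r : ℝ) * (E.rad / 2 ^ T₂) ≤ κ * ε / 4 := by
      rw [newtonConst]
      push_cast
      calc (E.pfBound : ℝ) * R * s * (E.rad / 2 ^ T₂)
          ≤ |(E.pfBound : ℝ)| * R * s * (E.rad / 2 ^ T₂) := by
            have := le_abs_self (E.pfBound : ℝ)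
            gcongr
        _ = K₂ * (R * (1 / ε)) * (1 / 2) ^ T₂ * (κ * ε / 4) := by
            rw [hK₂, one_div_pow]; field_simp
        _ ≤ 1 * (κ * ε / 4) := mul_le_mul_of_nonneg_right hT₂ (by positivity)
        _ = _ := one_mul _
    rw [hκ] at h3
    exact_mod_cast h3
  · have e1 := log_one_add_mul_le hR (y := 1 / (ε : ℝ)) (by positivity)
    have e2 := log_one_add_mul_le (x := 4 * K) (y := R * (1 / ε)) (by positivity) (by positivity)
    have e3 := log_one_add_mul_le (x := K₂) (y := R * (1 / ε)) (by positivity) (by positivity)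
    have p1 := hlog R hR
    have p2 := hlog (1 / ε) (by positivity)
    have p3 := hlog (4 * K) (by positivity)
    have p4 := hlog K₂ hK₂0
    push_cast
    set l := Real.log (1 + R) + Real.log (1 + 1 / (ε : ℝ)) with hl
    have hl0 : 0 ≤ l := add_nonneg p1 p2
    have q1 : (T₁ : ℝ) ≤ C₁ * (1 + Real.log (1 + 4 * K)) * (1 + l) := by
      refine hT₁'.trans ?_
      rw [mul_assoc C₁]
      refine mul_le_mul_of_nonneg_left ?_ hC₁
      nlinarith
    have q2 : (T₂ : ℝ) ≤ C₂ * (1 + Real.log (1 + K₂)) * (1 + l) := by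
      refine hT₂'.trans ?_
      rw [mul_assoc C₂]
      refine mul_le_mul_of_nonneg_left ?_ hC₂
      nlinarith
    rw [add_assoc 1, add_mul]
    exact add_le_add q1 q2

/-- Cost of one coefficient of the expansion. -/
def coeffCost : ℕ := E.numRoots * (b.natDegree * (3 * b.natDegree + 9) + 1) + 1

lemma coeffC_ops_le (hb : b ≠ 0) (quo rem : ℕ → ℚ) (pt : Fin E.numRoots → GaussRat) (N n : ℕ) :
    (E.coeffC quo rem pt N n).ops ≤ E.coeffCost := by
  simp only [coeffC, bind_ops, addC_ops, coeffCost]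
  rw [Nat.cast_add, Nat.cast_one]
  refine add_le_add ?_ le_rfl
  refine (sumC_ops_le _ _ ((b.natDegree * (3 * b.natDegree + 9) : ℕ) : ℕ∞)
    fun k _ => ?_).trans_eq (by rw [Finset.card_univ, Fintype.card_fin]; push_cast; rfl)
  refine (sumC_ops_le _ _ ((3 * b.natDegree + 8 : ℕ) : ℕ∞) fun j hj => ?_).trans ?_
  · simp only [bind_ops, mulC_ops, GaussRat.mulC_ops]
    have hj' := (Finset.mem_Icc.1 hj).2.trans (E.mult_le hb k)
    refine (add_le_add (binomC_ops_le _ _) le_rfl).trans ?_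
    norm_cast
    omega
  · rw [Nat.card_Icc]
    norm_cast
    have := E.mult_le hb k
    gcongr
    omega

/-- Cost of the partial fraction coefficients at one root. -/
def seriesCost (b : ℚ[X]) : ℕ := (2 * b.natDegree + 1) * 8 + 6
  + b.natDegree * ((2 * b.natDegree + 1) * 8 + b.natDegree * ((2 * b.natDegree + 1) * 8 + 8) + 6)

lemma expandC_ops (f : ChebVec) (ε : ℚ) : (E.expandC f ε).ops
    = (divModC f (ChebVec.ofPoly b)).ops
    + ((sumC (Finset.range b.natDegree) fun s =>
        absC ((divModC f (ChebVec.ofPoly b)).val.rem s)).ops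
    + ((E.truncC (f.deg - b.natDegree) (E.remSum (divModC f (ChebVec.ofPoly b)).val.rem) ε).ops
    + ((E.rootsC (E.remSum (divModC f (ChebVec.ofPoly b)).val.rem) ε).ops
    + ((familyC fun k => seriesC (b := b) (liftCoeff b.natDegree (truncSeq b.natDegree
          (divModC f (ChebVec.ofPoly b)).val.rem)) (E.mult k)
        ((E.rootsC (E.remSum (divModC f (ChebVec.ofPoly b)).val.rem) ε).val.pt k)).ops
    + ((familyC fun k => do
        let u ← ((E.rootsC (E.remSum (divModC f (ChebVec.ofPoly b)).val.rem) ε).val.pt k).invC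
        powersC u ((E.expandC f ε).val.deg + b.natDegree)).ops
    + (buildC (E.expandC f ε).val.deg
      (E.coeffC (divModC f (ChebVec.ofPoly b)).val.quo (divModC f (ChebVec.ofPoly b)).val.rem
        (E.rootsC (E.remSum (divModC f (ChebVec.ofPoly b)).val.rem) ε).val.pt
        ((E.expandC f ε).val.deg + b.natDegree))).ops))))) := rfl

/-- The constant in the linear bound for the cost of the expansion procedure. -/
def costFactor : ℕ :=
  (1 + (2 * b.natDegree + 1) * 3) + b.natDegree * 2 + (8 + E.truncTestCost)
    + (E.rootsInitCost + 4 + E.newtonCost) + E.numRoots * seriesCost b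
    + E.numRoots * (6 + (b.natDegree + 1) * 6) + E.coeffCost

lemma expandC_ops_le (hb : b ≠ 0) {f : ChebVec} {ε : ℚ} {T₁ T₂ : ℕ}
    (hT₁ : E.tailBound (divModC f (ChebVec.ofPoly b)).val.rem (f.deg - b.natDegree + T₁) ≤ ε / 4)
    (hT₂ : E.newtonConst (divModC f (ChebVec.ofPoly b)).val.rem * (E.rad / 2 ^ T₂)
      ≤ (1 - 1 / E.rhoLow) ^ (b.natDegree + 1) * ε / 4) :
    (E.expandC f ε).val.deg ≤ f.deg + T₁ ∧
    (E.expandC f ε).ops ≤ (E.costFactor * (f.deg + (T₁ + T₂) + 1) : ℕ) := by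
  set rem := (divModC f (ChebVec.ofPoly b)).val.rem with hrem
  obtain ⟨-, hd, -, htr⟩ := E.truncC_spec hb (f.deg - b.natDegree) rem ε T₁ hT₁
  obtain ⟨-, -, -, -, -, hro⟩ := E.rootsC_spec hb rem ε T₂ hT₂
  rw [← E.expandC_deg] at hd
  have hdeg : (E.expandC f ε).val.deg ≤ f.deg + T₁ := hd.trans (by omega)
  refine ⟨hdeg, ?_⟩
  rw [expandC_ops]
  set d' := (E.expandC f ε).val.deg
  set X := f.deg + (T₁ + T₂) + 1 with hX
  have hX1 : 1 ≤ X := by omega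
  have hd'X : d' + 1 ≤ X := by omega
  rw [costFactor]
  simp only [add_mul, Nat.cast_add]
  simp only [add_assoc]
  have a1 : (divModC f (ChebVec.ofPoly b)).ops
      ≤ ((1 * X : ℕ) : ℕ∞) + ((2 * b.natDegree * 3 * X : ℕ) + (1 * 3 * X : ℕ)) := by
    refine (divModC_ops_le _ _).trans ?_
    norm_cast
    rw [show (ChebVec.ofPoly b).deg = b.natDegree from rfl]
    calc (f.deg + 1) * (1 + (2 * b.natDegree + 1) * 3) ≤ X * (1 + (2 * b.natDegree + 1) * 3) := by
          gcongr; omega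
      _ = _ := by ring
  have a2 : (sumC (Finset.range b.natDegree) fun s => absC (rem s)).ops
      ≤ ((b.natDegree * 2 * X : ℕ) : ℕ∞) := by
    refine (sumC_ops_le _ _ 1 fun s _ => le_of_eq (by simp)).trans ?_
    rw [Finset.card_range]
    norm_cast
    exact Nat.le_mul_of_pos_right _ hX1
  have a3 : (E.truncC (f.deg - b.natDegree) (E.remSum rem) ε).ops
      ≤ ((8 * X : ℕ) : ℕ∞) + (E.truncTestCost * X : ℕ) := by
    refine htr.trans ?_
    norm_cast
    have : (T₁ + 1) * E.truncTestCost ≤ E.truncTestCost * X := by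
      rw [mul_comm]; gcongr; omega
    omega
  have a4 : (E.rootsC (E.remSum rem) ε).ops
      ≤ ((E.rootsInitCost * X : ℕ) : ℕ∞) + ((4 * X : ℕ) + (E.newtonCost * X : ℕ)) := by
    refine hro.trans ?_
    norm_cast
    have h1 : T₂ * E.newtonCost ≤ E.newtonCost * X := by rw [mul_comm]; gcongr; omega
    have h2 : E.rootsInitCost ≤ E.rootsInitCost * X := Nat.le_mul_of_pos_right _ hX1
    omega
  have a5 : ∀ pt : Fin E.numRoots → GaussRat, (familyC fun k => seriesC (b := b)
      (liftCoeff b.natDegree (truncSeq b.natDegree rem)) (E.mult k) (pt k)).ops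
      ≤ ((E.numRoots * seriesCost b * X : ℕ) : ℕ∞) := by
    intro pt
    refine (familyC_ops_le _ (seriesCost b : ℕ) fun k => (seriesC_ops_le _ _ _ _).trans ?_).trans ?_
    · norm_cast
      have := E.mult_le hb k
      rw [seriesCost]
      gcongr
    · rw [Fintype.card_fin]
      norm_cast
      exact Nat.le_mul_of_pos_right _ hX1
  have a6 : ∀ pt : Fin E.numRoots → GaussRat, (familyC fun k => do
      let u ← (pt k).invC
      powersC u (d' + b.natDegree)).ops
      ≤ ((E.numRoots * (6 + (b.natDegree * 6 + 1 * 6)) * X : ℕ) : ℕ∞) := by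
    intro pt
    refine (familyC_ops_le _ ((6 + (d' + b.natDegree) * 6 : ℕ) : ℕ∞) fun k => ?_).trans ?_
    · simp only [bind_ops, GaussRat.invC_ops]
      refine (add_le_add le_rfl (powersC_ops_le _ _)).trans_eq ?_
      push_cast; rfl
    · rw [Fintype.card_fin]
      norm_cast
      rw [mul_assoc]
      gcongr
      nlinarith
  have a7 : ∀ quo pt N, (buildC d' (E.coeffC quo rem pt N)).ops
      ≤ ((E.coeffCost * X : ℕ) : ℕ∞) := by
    intro quo pt N
    refine (ChebVec.buildC_ops_le _ _ (E.coeffCost : ℕ) fun n _ =>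
      E.coeffC_ops_le hb _ _ _ _ _).trans ?_
    norm_cast
    rw [mul_comm]
    gcongr
  have a6' := a6 (E.rootsC (E.remSum rem) ε).val.pt
  refine (add_le_add a1 (add_le_add a2 (add_le_add a3 (add_le_add a4 (add_le_add (a5 _)
    (add_le_add a6' (a7 _ _ _))))))).trans_eq ?_
  norm_cast
  ring

/-- The expansion procedure: its error, and its cost. -/
lemma exists_expandC_cost (hb : b ≠ 0) : ∃ C : ℝ, 0 ≤ C ∧ ∀ (f : ChebVec), f.WF →
    ∀ M : ℚ, (∀ j, |f.coeff j| ≤ M) → ∀ ε : ℚ, 0 < ε →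
    ∃ N : ℕ, (E.expandC f ε).ops ≤ N ∧ (E.expandC f ε).val.deg ≤ N ∧
      (N : ℝ) ≤ C * (f.deg + 1 + Real.log (1 + (M : ℝ)) + Real.log (1 + 1 / (ε : ℝ))) ∧
      ∑' n : ℤ, ‖((E.expandC f ε).val.coeff n.natAbs : ℝ) - E.trueCoeff f n.natAbs‖ₑ
        ≤ ENNReal.ofReal ε := by
  obtain ⟨C, hC, hsteps⟩ := E.exists_steps hb
  have hD : (1 : ℝ) ≤ divFactor b := by exact_mod_cast one_le_divFactor b
  set lD := Real.log (divFactor b) with hlD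
  have hlD0 : 0 ≤ lD := Real.log_nonneg hD
  set lm := Real.log (1 + (b.natDegree : ℝ)) with hlm
  have hlm0 : 0 ≤ lm := Real.log_nonneg (by linarith [Nat.cast_nonneg (α := ℝ) b.natDegree])
  refine ⟨((E.costFactor + 1 : ℕ) : ℝ) * (1 + C * (1 + lD + lm)), by positivity, ?_⟩
  intro f hf M hM ε hε
  set rem := (divModC f (ChebVec.ofPoly b)).val.rem with hrem
  obtain ⟨T₁, T₂, hT₁, hT₂, hT⟩ := hsteps rem (f.deg - b.natDegree) ε hε
  obtain ⟨hdeg, hops⟩ := E.expandC_ops_le hb hT₁ hT₂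
  have hεR : (0 : ℝ) < ε := by exact_mod_cast hε
  have hM0 : (0 : ℚ) ≤ M := (abs_nonneg _).trans (hM 0)
  have hM0' : (0 : ℝ) ≤ M := by exact_mod_cast hM0
  have hR : (E.remSum rem : ℝ)
      ≤ b.natDegree * ((divFactor b : ℝ) ^ (f.deg + 1) * M) := by
    have : E.remSum rem ≤ b.natDegree * (divFactor b ^ (f.deg + 1) * M) := by
      rw [remSum]
      refine (Finset.sum_le_sum fun s _ => (divModC_facts hb hf).2.2 M hM s).trans_eq ?_
      simp
    exact_mod_cast this
  have hR0 : (0 : ℝ) ≤ E.remSum rem := by exact_mod_cast E.remSum_nonneg rem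
  -- The remainder may be exponentially large in `deg f`, but its logarithm is only linear in `deg
  -- f`, which the cost can afford.
  have hlR : Real.log (1 + (E.remSum rem : ℝ))
      ≤ lm + ((f.deg + 1 : ℕ) * lD + Real.log (1 + (M : ℝ))) := by
    refine (Real.log_le_log (by positivity) (add_le_add le_rfl hR)).trans ?_
    refine (log_one_add_mul_le (by positivity) (by positivity)).trans ?_
    exact add_le_add le_rfl (log_one_add_pow_mul_le hD hM0' _)
  have hlM : 0 ≤ Real.log (1 + (M : ℝ)) := Real.log_nonneg (by linarith)
  have hlε : 0 ≤ Real.log (1 + 1 / (ε : ℝ)) :=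
    Real.log_nonneg (by have : (0 : ℝ) < 1 / ε := by positivity
                        linarith)
  refine ⟨(E.costFactor + 1) * (f.deg + (T₁ + T₂) + 1), hops.trans ?_, ?_, ?_,
    E.expandC_error hb hf hε hT₁ hT₂⟩
  · norm_cast
    gcongr
    omega
  · refine hdeg.trans ?_
    nlinarith
  · rw [Nat.cast_mul, mul_assoc]
    refine mul_le_mul_of_nonneg_left ?_ (by positivity)
    set l := Real.log (1 + (M : ℝ)) + Real.log (1 + 1 / (ε : ℝ)) with hl
    have hd0 : (0 : ℝ) ≤ f.deg := by positivity
    push_cast at hT hlR ⊢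
    have h1 : 1 + Real.log (1 + (E.remSum rem : ℝ)) + Real.log (1 + 1 / (ε : ℝ))
        ≤ (1 + lD + lm) * (f.deg + 1 + l) := by
      have hl0 : 0 ≤ l := add_nonneg hlM hlε
      have : 0 ≤ lm * (f.deg + l) := by positivity
      have : 0 ≤ lD * l := by positivity
      nlinarith
    have h2 := mul_le_mul_of_nonneg_left h1 hC
    rw [add_assoc ((f.deg : ℝ) + 1), add_mul]
    nlinarith

end ExpansionData

/-! ### Weighted `ℓ¹` norms of Chebyshev coefficients -/

/-- The two-sided sequence of symmetric Chebyshev coefficients. -/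
def ChebVec.seq (u : ChebVec) (n : ℤ) : ℝ := u.coeff n.natAbs

/-- A weighted `ℓ¹` norm. -/
def wnorm (ω : ℤ → ℝ≥0∞) (c : ℤ → ℝ) : ℝ≥0∞ := ∑' n, ω n * ‖c n‖ₑ

/-- A weight on `ℤ` growing at most like `Θ ^ |n|`, and minimal at `0`. -/
structure IsWeight (Θ : ℝ≥0∞) (ω : ℤ → ℝ≥0∞) : Prop where
  shift : ∀ n k, ω (n + k) ≤ Θ ^ k.natAbs * ω n
  zero_le : ∀ n, ω 0 ≤ ω n

/-- The weight `Θ ^ |n|`. -/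
def expWeight (Θ : ℝ≥0∞) (n : ℤ) : ℝ≥0∞ := Θ ^ n.natAbs

lemma wnorm_add_le (ω : ℤ → ℝ≥0∞) (c d : ℤ → ℝ) :
    wnorm ω (fun n => c n + d n) ≤ wnorm ω c + wnorm ω d := by
  rw [wnorm, wnorm, wnorm, ← ENNReal.tsum_add]
  refine ENNReal.tsum_le_tsum fun n => ?_
  rw [← mul_add]
  exact mul_le_mul_right (enorm_add_le _ _) _

/-- Young's inequality: `ω n ≤ Θ^{|i|} ω (n - i)` distributes the weight over the two factors. The
kernel is measured in the exponential weight, so the constant is the same for every `ω` with the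
same `Θ`. -/
lemma IsWeight.wnorm_conv {Θ : ℝ≥0∞} {ω : ℤ → ℝ≥0∞} (hω : IsWeight Θ ω) {c a d : ℤ → ℝ}
    (h : ∀ n, ‖c n‖ₑ ≤ ∑' i, ‖a i‖ₑ * ‖d (n - i)‖ₑ) :
    wnorm ω c ≤ wnorm (expWeight Θ) a * wnorm ω d := by
  calc wnorm ω c ≤ ∑' n, ∑' i, ω n * (‖a i‖ₑ * ‖d (n - i)‖ₑ) := by
        refine ENNReal.tsum_le_tsum fun n => ?_
        rw [ENNReal.tsum_mul_left]
        exact mul_le_mul_right (h n) _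
    _ = ∑' i, ∑' n, ω n * (‖a i‖ₑ * ‖d (n - i)‖ₑ) := ENNReal.tsum_comm
    _ ≤ ∑' i, ∑' n, (expWeight Θ i * ‖a i‖ₑ) * (ω (n - i) * ‖d (n - i)‖ₑ) := by
        refine ENNReal.tsum_le_tsum fun i => ENNReal.tsum_le_tsum fun n => ?_
        have := hω.shift (n - i) i
        rw [sub_add_cancel] at this
        calc _ ≤ (Θ ^ i.natAbs * ω (n - i)) * (‖a i‖ₑ * ‖d (n - i)‖ₑ) := mul_le_mul_left this _
          _ = _ := by rw [expWeight]; ring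
    _ = ∑' i, (expWeight Θ i * ‖a i‖ₑ) * wnorm ω d := by
        refine tsum_congr fun i => ?_
        rw [ENNReal.tsum_mul_left, wnorm]
        congr 1
        exact (Equiv.subRight i).tsum_eq fun n => ω n * ‖d n‖ₑ
    _ = _ := ENNReal.tsum_mul_right

lemma ChebVec.wnorm_eq_sum {u : ChebVec} (hu : u.WF) {d : ℕ} (hd : u.deg ≤ d) (ω : ℤ → ℝ≥0∞) :
    wnorm ω u.seq = ∑ n ∈ Finset.Icc (-(d : ℤ)) d, ω n * ‖u.seq n‖ₑ := by
  refine tsum_eq_sum fun n hn => ?_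
  rw [Finset.mem_Icc] at hn
  rw [seq, hu _ (by omega)]
  simp

lemma ChebVec.wnorm_ne_top {u : ChebVec} (hu : u.WF) {ω : ℤ → ℝ≥0∞} (hω : ∀ n, ω n ≠ ∞) :
    wnorm ω u.seq ≠ ∞ := by
  rw [wnorm_eq_sum hu le_rfl]
  exact ENNReal.sum_ne_top.2 fun n _ => ENNReal.mul_ne_top (hω n) enorm_ne_top

lemma expWeight_ne_top {Θ : ℝ≥0∞} (h : Θ ≠ ∞) (n : ℤ) : expWeight Θ n ≠ ∞ := ENNReal.pow_ne_top h

section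
variable {Θ : ℝ≥0∞} {ω : ℤ → ℝ≥0∞}

lemma IsWeight.wnorm_mulC (hω : IsWeight Θ ω) {u v : ChebVec} (hu : u.WF) (hv : v.WF) :
    wnorm ω (u.mulC v).val.seq ≤ wnorm (expWeight Θ) u.seq * wnorm ω v.seq := by
  refine hω.wnorm_conv fun n => ?_
  rw [tsum_eq_sum (s := Finset.Icc (-(u.deg : ℤ)) u.deg), ChebVec.seq,
    ChebVec.mulC_coeff_natAbs hv]
  · push_cast
    refine (enorm_sum_le _ _).trans (Finset.sum_le_sum fun i _ => ?_)
    rw [enorm_mul]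
    rfl
  · intro n hn
    rw [Finset.mem_Icc] at hn
    rw [ChebVec.seq, hu _ (by omega)]
    simp

lemma IsWeight.wnorm_addC {u v : ChebVec} (hu : u.WF) (hv : v.WF) :
    wnorm ω (u.addC v).val.seq ≤ wnorm ω u.seq + wnorm ω v.seq := by
  refine le_trans (le_of_eq ?_) (wnorm_add_le ω u.seq v.seq)
  congr 1
  funext n
  rw [ChebVec.seq, ChebVec.addC_coeff hu hv]
  push_cast
  rfl

/-- For `n ≠ 0` the recurrence bounds `|F_n|` by `|u_{n-1}| + |u_{n+1}|`, which costs `2 Θ` in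
total. The constant coefficient is twice an alternating sum of even coefficients, and minimality of
`ω 0` charges it to them: another `4 Θ`. -/
lemma IsWeight.wnorm_intC (hω : IsWeight Θ ω) {u : ChebVec} (hu : u.WF) :
    wnorm ω u.intC.val.seq ≤ 6 * Θ * wnorm ω u.seq := by
  set G : ℤ → ℝ≥0∞ := fun n => ω n * (‖u.seq (n - 1)‖ₑ + ‖u.seq (n + 1)‖ₑ) with hG
  have h1 : ∀ n : ℤ, n ≠ 0 → ω n * ‖u.intC.val.seq n‖ₑ ≤ G n := by
    intro n hn
    refine mul_le_mul_right ?_ _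
    have h := congr_arg (fun q : ℚ => (q : ℝ)) (ChebVec.intC_coeff_mul hu n)
    push_cast at h
    have hn' : (1 : ℝ) ≤ |(n : ℝ)| := by exact_mod_cast Int.one_le_abs hn
    rw [← ofReal_norm, ← ofReal_norm, ← ofReal_norm,
      ← ENNReal.ofReal_add (norm_nonneg _) (norm_nonneg _)]
    refine ENNReal.ofReal_le_ofReal ?_
    simp only [ChebVec.seq, Real.norm_eq_abs]
    calc |(u.intC.val.coeff n.natAbs : ℝ)|
        ≤ |(u.intC.val.coeff n.natAbs : ℝ)| * |(n : ℝ)| := le_mul_of_one_le_right (abs_nonneg _) hn'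
      _ = |(u.coeff (n - 1).natAbs : ℝ) - u.coeff (n + 1).natAbs| / 2 := by
          rw [← abs_mul, h, abs_div, abs_two]
      _ ≤ |(u.coeff (n - 1).natAbs : ℝ) - u.coeff (n + 1).natAbs| := half_le_self (abs_nonneg _)
      _ ≤ _ := abs_sub _ _
  have h2 : ω 0 * ‖u.intC.val.seq 0‖ₑ ≤ 2 * ∑' n, G n := by
    have h := congr_arg (fun q : ℚ => (q : ℝ)) (ChebVec.intC_coeff_zero u)
    push_cast at h
    have h3 : ‖u.intC.val.seq 0‖ₑ
        ≤ 2 * ∑ k ∈ Finset.Icc 1 ((u.deg + 1) / 2), ‖u.intC.val.seq ((2 * k : ℕ) : ℤ)‖ₑ := by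
      have e1 : u.intC.val.seq 0 = -2 * ∑ k ∈ Finset.Icc 1 ((u.deg + 1) / 2),
        (-1 : ℝ) ^ k * u.intC.val.coeff (2 * k) := h
      rw [e1, enorm_mul]
      have e2 : ‖(-2 : ℝ)‖ₑ = 2 := by
        rw [enorm_neg, Real.enorm_eq_ofReal (by norm_num)]; simp
      rw [e2]
      refine mul_le_mul_right ((enorm_sum_le _ _).trans (Finset.sum_le_sum fun k _ => ?_)) _
      rw [enorm_mul, enorm_pow, enorm_neg, enorm_one, one_pow, one_mul]
      rfl
    calc ω 0 * ‖u.intC.val.seq 0‖ₑ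
        ≤ ω 0 * (2 * ∑ k ∈ Finset.Icc 1 ((u.deg + 1) / 2), ‖u.intC.val.seq ((2 * k : ℕ) : ℤ)‖ₑ) :=
          mul_le_mul_right h3 _
      _ = 2 * ∑ k ∈ Finset.Icc 1 ((u.deg + 1) / 2), ω 0 * ‖u.intC.val.seq ((2 * k : ℕ) : ℤ)‖ₑ := by
          rw [← Finset.mul_sum]; ring
      _ ≤ 2 * ∑ k ∈ Finset.Icc 1 ((u.deg + 1) / 2), G ((2 * k : ℕ) : ℤ) := by
          refine mul_le_mul_right (Finset.sum_le_sum fun k hk => ?_) _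
          have := (Finset.mem_Icc.1 hk).1
          exact (mul_le_mul_left (hω.zero_le _) _).trans (h1 _ (by omega))
      _ ≤ 2 * ∑' k : ℕ, G ((2 * k : ℕ) : ℤ) := mul_le_mul_right (ENNReal.sum_le_tsum _) _
      _ ≤ _ := mul_le_mul_right (ENNReal.tsum_comp_le_tsum_of_injective
          (f := fun k : ℕ => ((2 * k : ℕ) : ℤ)) (fun a b h => by simpa using h) G) _
  have h4 : ∑' n, G n ≤ 2 * Θ * wnorm ω u.seq := by
    simp only [hG, mul_add]
    rw [ENNReal.tsum_add, two_mul, add_mul]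
    refine add_le_add ?_ ?_
    · rw [wnorm, ← (Equiv.subRight (1 : ℤ)).tsum_eq (fun n => ω n * ‖u.seq n‖ₑ),
        ← ENNReal.tsum_mul_left]
      refine ENNReal.tsum_le_tsum fun n => ?_
      rw [← mul_assoc]
      refine mul_le_mul_left ?_ _
      have := hω.shift (n - 1) 1
      simpa using this
    · rw [wnorm, ← (Equiv.addRight (1 : ℤ)).tsum_eq (fun n => ω n * ‖u.seq n‖ₑ),
        ← ENNReal.tsum_mul_left]
      refine ENNReal.tsum_le_tsum fun n => ?_
      rw [← mul_assoc]
      refine mul_le_mul_left ?_ _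
      have := hω.shift (n + 1) (-1)
      simpa using this
  have h5 : wnorm ω u.intC.val.seq ≤ ∑' n : ℤ,
      (G n + (Pi.single 0 (2 * ∑' n, G n) : ℤ → ℝ≥0∞) n) := by
    refine ENNReal.tsum_le_tsum fun n => ?_
    rcases eq_or_ne n 0 with rfl | hn
    · rw [Pi.single_eq_same]
      exact h2.trans le_add_self
    · exact (h1 n hn).trans le_self_add
  rw [ENNReal.tsum_add, tsum_pi_single] at h5
  refine h5.trans ?_
  calc _ = 3 * ∑' n, G n := by ring
    _ ≤ 3 * (2 * Θ * wnorm ω u.seq) := mul_le_mul_right h4 _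
    _ = _ := by ring

end

/-- The constant polynomial `1`. -/
def ChebVec.one : ChebVec := ⟨0, fun n => if n = 0 then 1 else 0⟩

lemma ChebVec.one_wf : ChebVec.one.WF := fun n hn => if_neg (by change 0 < n at hn; omega)

lemma ChebVec.one_toPoly : ChebVec.one.toPoly = 1 := by simp [ChebVec.toPoly, ChebVec.one]

/-! ### Division by `b` in weighted norms -/

namespace ExpansionData

variable {b : ℚ[X]} (E : ExpansionData b)

/-- The Chebyshev coefficients of `1 / b`. -/
def invSeq (n : ℤ) : ℝ := E.trueCoeff ChebVec.one n.natAbs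

lemma hasSum_invSeq (hb : NoZero b) {z : ℂ} (hz : ‖z‖ = 1) :
    HasSum (fun n : ℤ => (E.invSeq n : ℂ) * z ^ n) (aeval ((z + z⁻¹) / 2) b)⁻¹ := by
  have := E.hasSum_trueCoeff hb ChebVec.one_wf hz
  rwa [ChebVec.one_toPoly, map_one, one_div] at this

lemma summable_trueCoeff (hb : NoZero b) {f : ChebVec} (hf : f.WF) :
    Summable fun n : ℤ => ‖(E.trueCoeff f n.natAbs : ℂ)‖ := by
  have := (E.hasSum_trueCoeff hb hf (z := 1) (by simp)).summable.norm
  simpa using this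

/-- Both sides are absolutely summable Laurent coefficients of `f / b` on the circle, hence equal.
The Euclidean division, which depends on `f`, is replaced by convolution with one fixed sequence. -/
lemma trueCoeff_eq_conv (hb : NoZero b) {f : ChebVec} (hf : f.WF) (n : ℤ) :
    E.trueCoeff f n.natAbs
      = ∑ i ∈ Finset.Icc (-(f.deg : ℤ)) f.deg, f.seq i * E.invSeq (n - i) := by
  have hs := E.summable_trueCoeff hb ChebVec.one_wf
  have hs' : Summable fun n : ℤ =>
      ‖(∑ i ∈ Finset.Icc (-(f.deg : ℤ)) f.deg, (f.seq i : ℂ) * (E.invSeq (n - i) : ℂ))‖ := by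
    refine Summable.norm (summable_sum fun i _ => Summable.mul_left _ ?_)
    exact ((Equiv.subRight i).summable_iff (f := fun n => (E.invSeq n : ℂ))).2 hs.of_norm
  have key := eq_zero_of_hasSum_circle (u := fun n => (E.trueCoeff f n.natAbs : ℂ)
    - ∑ i ∈ Finset.Icc (-(f.deg : ℤ)) f.deg, (f.seq i : ℂ) * (E.invSeq (n - i) : ℂ))
    (((E.summable_trueCoeff hb hf).add hs').of_nonneg_of_le (fun _ => norm_nonneg _)
      fun n => norm_sub_le _ _) (fun z hz => ?_) n
  · rw [sub_eq_zero] at key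
    exact_mod_cast key
  · have hz0 := ne_zero_of_norm_one hz
    have h1 := E.hasSum_trueCoeff hb hf hz
    have h2 : HasSum (fun n : ℤ => ∑ i ∈ Finset.Icc (-(f.deg : ℤ)) f.deg,
        ((f.seq i : ℂ) * z ^ i) * ((E.invSeq (n - i) : ℂ) * z ^ (n - i)))
        (∑ i ∈ Finset.Icc (-(f.deg : ℤ)) f.deg,
          ((f.seq i : ℂ) * z ^ i) * (aeval ((z + z⁻¹) / 2) b)⁻¹) := by
      refine hasSum_sum fun i _ => HasSum.mul_left _ ?_
      exact ((Equiv.subRight i).hasSum_iff (f := fun n => (E.invSeq n : ℂ) * z ^ n)).2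
        (E.hasSum_invSeq hb hz)
    have h3 : (∑ i ∈ Finset.Icc (-(f.deg : ℤ)) f.deg,
          ((f.seq i : ℂ) * z ^ i) * (aeval ((z + z⁻¹) / 2) b)⁻¹)
        = aeval ((z + z⁻¹) / 2) f.toPoly / aeval ((z + z⁻¹) / 2) b := by
      rw [← Finset.sum_mul, f.aeval_joukowski hz0, ← div_eq_mul_inv]
      simp only [ChebVec.seq, Complex.ofReal_ratCast]
    rw [h3] at h2
    have h4 := h1.sub h2
    rw [sub_self] at h4
    refine h4.congr_fun fun n => ?_
    rw [sub_mul, Finset.sum_mul]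
    congr 1
    refine Finset.sum_congr rfl fun i _ => ?_
    rw [mul_mul_mul_comm, ← zpow_add₀ hz0]
    congr 2
    ring

/-- The Chebyshev coefficients of `1 / b` decrease exponentially. -/
lemma exists_wnorm_invSeq (hb : b ≠ 0) : ∃ Θ : ℝ, 1 < Θ ∧
    wnorm (expWeight (ENNReal.ofReal Θ)) E.invSeq ≠ ∞ := by
  obtain ⟨θ, K, hθ0, hθ1, hK, htail⟩ := E.exists_tailBound_le hb
  set rem := (divModC ChebVec.one (ChebVec.ofPoly b)).val.rem with hrem
  set quo := (divModC ChebVec.one (ChebVec.ofPoly b)).val.quo with hquo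
  have hq := (divModC_facts hb ChebVec.one_wf).2.1
  have hinv : 1 < θ⁻¹ := (one_lt_inv₀ hθ0).2 hθ1
  -- Strictly between `1` and `θ⁻¹`, so that `Θ^n θ^n` is still summable.
  set Θ : ℝ := (1 + θ⁻¹) / 2 with hΘ
  have hΘ0 : 0 < Θ := by positivity
  have hΘθ : Θ * θ = (θ + 1) / 2 := by rw [hΘ]; field_simp
  have hΘθ1 : Θ * θ < 1 := by rw [hΘθ]; linarith
  refine ⟨Θ, by rw [hΘ]; linarith, ?_⟩
  -- The numerator `1` has degree `0`, so its quotient by `b` can only occupy index `0`, which is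
  -- left aside here.
  have hbound : ∀ n : ℕ, |E.trueCoeff ChebVec.one (n + 1)| ≤ K * E.remSum rem * θ ^ n := by
    intro n
    have h0 : quo (n + 1) = 0 := hq (n + 1) (by
      change 0 - b.natDegree < n + 1
      omega)
    rw [trueCoeff, ← hquo, h0, Rat.cast_zero, zero_add]
    refine (Complex.abs_re_le_norm _).trans (le_trans ?_ (htail rem n))
    have h1 := E.norm_wFun_le_tailTerm hb rem n
    have h2 := E.hasSum_tailTerm_tailBound rem n
    refine (h1 0).trans ?_
    exact le_hasSum h2 0 fun j _ => (norm_nonneg _).trans (h1 j)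
  have hsum : Summable fun n : ℕ => Θ ^ (n + 1) * |E.trueCoeff ChebVec.one (n + 1)| := by
    refine Summable.of_nonneg_of_le (fun n => by positivity) (fun n => ?_)
      ((summable_geometric_of_lt_one (by positivity) hΘθ1).mul_left (Θ * (K * E.remSum rem)))
    calc _ ≤ Θ ^ (n + 1) * (K * E.remSum rem * θ ^ n) :=
          mul_le_mul_of_nonneg_left (hbound n) (by positivity)
      _ = _ := by rw [mul_pow]; ring
  have hsum' : Summable fun n : ℕ => Θ ^ n * |E.trueCoeff ChebVec.one n| :=
    (summable_nat_add_iff (f := fun n : ℕ => Θ ^ n * |E.trueCoeff ChebVec.one n|) 1).1 hsum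
  have hnat : ∑' n : ℕ, ENNReal.ofReal Θ ^ n * ‖E.trueCoeff ChebVec.one n‖ₑ ≠ ∞ := by
    have := hsum'.tsum_ofReal_ne_top
    convert this using 3 with n
    rw [ENNReal.ofReal_mul (by positivity), ENNReal.ofReal_pow hΘ0.le, Real.enorm_eq_ofReal_abs]
  refine ne_top_of_le_ne_top (ENNReal.mul_ne_top (by norm_num) hnat)
    (tsum_int_natAbs_le fun n => ENNReal.ofReal Θ ^ n * ‖E.trueCoeff ChebVec.one n‖ₑ)

/-- The exact coefficients are a convolution of `f` with those of `1 / b`. The computational error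
is known only in unweighted `ℓ¹`, so it is multiplied by the supremum `Λ` of the weight. -/
lemma wnorm_expandC_le (hb : NoZero b) {Θ Λ : ℝ≥0∞} {ω : ℤ → ℝ≥0∞} (hω : IsWeight Θ ω)
    (hΛ : ∀ n, ω n ≤ Λ) {f : ChebVec} (hf : f.WF) {ε : ℚ} (hε : 0 < ε) :
    wnorm ω (E.expandC f ε).val.seq
      ≤ wnorm (expWeight Θ) E.invSeq * wnorm ω f.seq + Λ * ENNReal.ofReal ε := by
  obtain ⟨C, -, h⟩ := E.exists_expandC_cost hb.ne_zero
  obtain ⟨M, hM⟩ := hf.exists_bound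
  obtain ⟨-, -, -, -, herr⟩ := h f hf M hM ε hε
  have h1 : (E.expandC f ε).val.seq = fun n : ℤ => E.trueCoeff f n.natAbs
      + (((E.expandC f ε).val.coeff n.natAbs : ℝ) - E.trueCoeff f n.natAbs) := by
    funext n
    rw [ChebVec.seq]
    ring
  rw [h1]
  refine (wnorm_add_le _ _ _).trans (add_le_add ?_ ?_)
  · refine hω.wnorm_conv fun n => ?_
    rw [E.trueCoeff_eq_conv hb hf]
    refine (enorm_sum_le _ _).trans ?_
    calc _ = ∑ i ∈ Finset.Icc (-(f.deg : ℤ)) f.deg, ‖E.invSeq (n - i)‖ₑ * ‖f.seq i‖ₑ :=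
          Finset.sum_congr rfl fun i _ => by rw [enorm_mul, mul_comm]
      _ ≤ ∑' i, ‖E.invSeq (n - i)‖ₑ * ‖f.seq i‖ₑ := ENNReal.sum_le_tsum _
      _ = _ := by
          rw [← (Equiv.subLeft n).tsum_eq]
          refine tsum_congr fun i => ?_
          simp
  · calc _ ≤ ∑' n : ℤ, Λ * ‖((E.expandC f ε).val.coeff n.natAbs : ℝ)
            - E.trueCoeff f n.natAbs‖ₑ :=
          ENNReal.tsum_le_tsum fun n => mul_le_mul_left (hΛ n) _
      _ ≤ _ := by
          rw [ENNReal.tsum_mul_left]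
          exact mul_le_mul_right herr _

end ExpansionData

/-! ### The iterates in weighted norms -/

namespace Preparation

variable {L : DiffOp} (P : Preparation L)

lemma volterraC_wf {g : ChebVec} (hg : g.WF) (p : ChebVec) : (P.volterraC g p).val.WF :=
  forLoop_induct (fun _ (u : ChebVec) => u.WF) _ _ _ hg fun _ _ _ _ => ChebVec.addC_wf _ _

/-- The constant in the bound for the weighted norm of the Volterra operator. -/
def volterraConst (Θ : ℝ≥0∞) : ℝ≥0∞ := ∑ j ∈ Finset.range L.order,
  wnorm (expWeight Θ) (ChebVec.ofPoly (X ^ j)).seq *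
    (6 * Θ * wnorm (expWeight Θ) (ChebVec.ofPoly (kernelCoeff L.order P.α j)).seq)

lemma volterraConst_ne_top {Θ : ℝ≥0∞} (h : Θ ≠ ∞) : P.volterraConst Θ ≠ ∞ := by
  have h1 := fun f => ChebVec.wnorm_ne_top (ChebVec.ofPoly_wf f) (expWeight_ne_top h)
  exact ENNReal.sum_ne_top.2 fun j _ => ENNReal.mul_ne_top (h1 _)
    (ENNReal.mul_ne_top (ENNReal.mul_ne_top (by norm_num) h) (h1 _))

lemma wnorm_volterraC_le {Θ : ℝ≥0∞} {ω : ℤ → ℝ≥0∞} (hω : IsWeight Θ ω) {g p : ChebVec}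
    (hg : g.WF) (hp : p.WF) :
    wnorm ω (P.volterraC g p).val.seq ≤ wnorm ω g.seq + P.volterraConst Θ * wnorm ω p.seq := by
  have := forLoop_induct (fun t (u : ChebVec) => u.WF ∧ wnorm ω u.seq ≤ wnorm ω g.seq
      + (∑ j ∈ Finset.range t, wnorm (expWeight Θ) (ChebVec.ofPoly (X ^ j)).seq *
    (6 * Θ * wnorm (expWeight Θ) (ChebVec.ofPoly (kernelCoeff L.order P.α j)).seq))
      * wnorm ω p.seq) L.order (fun j acc => do
    let u ← (ChebVec.ofPoly (kernelCoeff L.order P.α j)).mulC p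
    let v ← u.intC
    let w ← (ChebVec.ofPoly (X ^ j)).mulC v
    acc.addC w) g ⟨hg, by simp⟩ (fun t _ u ⟨hu, h⟩ => ⟨ChebVec.addC_wf _ _, ?_⟩)
  · exact this.2
  · simp only [bind_val]
    refine (IsWeight.wnorm_addC hu (ChebVec.mulC_wf _ _)).trans ?_
    rw [Finset.sum_range_succ, add_mul, ← add_assoc]
    refine add_le_add h ?_
    have h1 := ChebVec.mulC_wf (ChebVec.ofPoly (kernelCoeff L.order P.α t)) p
    refine (hω.wnorm_mulC (ChebVec.ofPoly_wf _) (ChebVec.intC_wf h1)).trans ?_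
    rw [mul_assoc]
    refine mul_le_mul_right ?_ _
    refine (hω.wnorm_intC h1).trans ?_
    rw [mul_assoc (6 * Θ)]
    exact mul_le_mul_right (hω.wnorm_mulC (ChebVec.ofPoly_wf _) hp) _

lemma iterC_wf (g : ChebVec) {p : ChebVec} (hp : p.WF) (ε : ℚ) (k : ℕ) :
    (P.iterC g p ε k).val.WF :=
  forLoop_induct (fun _ (u : ChebVec) => u.WF) _ _ _ hp fun _ _ _ _ => by
    simp only [bind_val]
    exact P.expansion.expandC_wf _ _

/-- The weighted norms of the iterates. -/
lemma exists_wnorm_iterC (hb : NoZero (P.α L.order)) {Θ : ℝ≥0∞} (hΘ : Θ ≠ ∞)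
    (hE : wnorm (expWeight Θ) P.expansion.invSeq ≠ ∞) (k : ℕ) :
    ∃ C : ℝ≥0∞, C ≠ ∞ ∧ ∀ (ω : ℤ → ℝ≥0∞) (Λ : ℝ≥0∞), IsWeight Θ ω → (∀ n, ω n ≤ Λ) →
      ∀ (g p : ChebVec), g.WF → p.WF → ∀ ε : ℚ, 0 < ε →
      wnorm ω (P.iterC g p ε k).val.seq
        ≤ C * (wnorm ω g.seq + wnorm ω p.seq + Λ * ENNReal.ofReal ε) := by
  induction k with
  | zero =>
    refine ⟨1, by norm_num, fun ω Λ _ _ g p _ _ ε _ => ?_⟩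
    rw [one_mul, add_right_comm]
    exact le_add_self
  | succ k ih =>
    obtain ⟨C, hC, h⟩ := ih
    set S := wnorm (expWeight Θ) P.expansion.invSeq with hS
    set V := P.volterraConst Θ with hV
    refine ⟨S * (1 + V * C) + 1, ?_, fun ω Λ hω hΛ g p hg hp ε hε => ?_⟩
    · have := P.volterraConst_ne_top hΘ
      exact ENNReal.add_ne_top.2 ⟨ENNReal.mul_ne_top hE (ENNReal.add_ne_top.2
        ⟨by norm_num, ENNReal.mul_ne_top this hC⟩), by norm_num⟩
    · set u := (P.iterC g p ε k).val with hu
      have e : (P.iterC g p ε (k + 1)).val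
          = (P.expansion.expandC (P.volterraC g u).val ε).val := rfl
      rw [e]
      set W := wnorm ω g.seq + wnorm ω p.seq + Λ * ENNReal.ofReal ε with hW
      have h1 := P.expansion.wnorm_expandC_le hb hω hΛ (P.volterraC_wf hg u) hε
      have h2 := P.wnorm_volterraC_le hω hg (P.iterC_wf g hp ε k)
      have h3 := h ω Λ hω hΛ g p hg hp ε hε
      have hgW : wnorm ω g.seq ≤ W := by rw [hW, add_assoc]; exact le_self_add
      have hεW : Λ * ENNReal.ofReal ε ≤ W := le_add_self
      calc _ ≤ S * (wnorm ω g.seq + V * wnorm ω u.seq) + Λ * ENNReal.ofReal ε :=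
            h1.trans (add_le_add (mul_le_mul_right h2 _) le_rfl)
        _ ≤ S * (W + V * (C * W)) + W :=
            add_le_add (mul_le_mul_right (add_le_add hgW (mul_le_mul_right h3 _)) _) hεW
        _ = _ := by ring

end Preparation

/-! ### From the differential equation to the Volterra equation -/

/-- The `i`-th derivative of `a * y` by the Leibniz rule, where `Y l` is the `l`-th derivative
of `y`. -/
def leibniz (a : ℚ[X]) (Y : ℕ → ℝ → ℝ) (i : ℕ) (x : ℝ) : ℝ :=
  ∑ l ∈ Finset.range (i + 1), (i.choose l : ℝ) * (Y l x * aeval x (derivative^[i - l] a))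

lemma hasDerivWithinAt_leibniz (a : ℚ[X]) {Y : ℕ → ℝ → ℝ} {s : Set ℝ} {x : ℝ} (i : ℕ)
    (hY : ∀ l ≤ i, HasDerivWithinAt (Y l) (Y (l + 1) x) s x) :
    HasDerivWithinAt (leibniz a Y i) (leibniz a Y (i + 1) x) s x := by
  have h1 : HasDerivWithinAt (leibniz a Y i) (∑ l ∈ Finset.range (i + 1), (i.choose l : ℝ) *
      (Y (l + 1) x * aeval x (derivative^[i - l] a)
        + Y l x * aeval x (derivative (derivative^[i - l] a)))) s x := by
    refine HasDerivWithinAt.fun_sum fun l hl => HasDerivWithinAt.const_mul _ ?_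
    exact (hY l (by have := Finset.mem_range.1 hl; omega)).mul
      (Polynomial.hasDerivAt_aeval _ _).hasDerivWithinAt
  convert h1 using 1
  rw [leibniz, Finset.sum_choose_succ_mul fun l k => Y l x * aeval x (derivative^[k] a),
    ← Finset.sum_add_distrib]
  refine Finset.sum_congr rfl fun l hl => ?_
  have := Finset.mem_range.1 hl
  rw [show i + 1 - l = (i - l) + 1 by omega, Function.iterate_succ_apply']
  ring

/-- Test on `X ^ i`: lower coefficients already vanish, higher derivatives kill `X ^ i`, and the
`i`-th one is the nonzero constant `i!`. -/
lemma eq_zero_of_operator_eq_zero {r : ℕ} {c : ℕ → ℚ[X]}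
    (h : ∀ f : ℚ[X], ∑ i ∈ Finset.range (r + 1), c i * derivative^[i] f = 0) :
    ∀ i ≤ r, c i = 0 := by
  intro i
  induction i using Nat.strong_induction_on with
  | _ i ih =>
    intro hi
    have h1 := h (X ^ i)
    rw [Finset.sum_eq_single i] at h1
    · rw [iterate_derivative_X_pow_eq_natCast_mul, Nat.descFactorial_self, Nat.sub_self, pow_zero,
        mul_one] at h1
      refine (mul_eq_zero.1 h1).resolve_right ?_
      exact_mod_cast i.factorial_ne_zero
    · intro k hk hne
      rcases lt_or_gt_of_ne hne with h2 | h2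
      · rw [ih k h2 (by omega), zero_mul]
      · rw [iterate_derivative_eq_zero (by simpa using h2), mul_zero]
    · intro hn
      exact absurd (Finset.mem_range.2 (by omega)) hn

lemma coeff_eq_of_operator_eq {r : ℕ} {a α : ℕ → ℚ[X]}
    (h : ∀ f : ℚ[X], ∑ i ∈ Finset.range (r + 1), a i * derivative^[i] f
      = ∑ j ∈ Finset.range (r + 1), derivative^[j] (α j * f)) :
    ∀ i ≤ r, a i = ∑ j ∈ Finset.range (r + 1), (j.choose i : ℚ[X]) * derivative^[j - i] (α j) := by
  intro i hi
  rw [← sub_eq_zero]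
  refine eq_zero_of_operator_eq_zero (r := r) (c := fun i => a i
    - ∑ j ∈ Finset.range (r + 1), (j.choose i : ℚ[X]) * derivative^[j - i] (α j))
    (fun f => ?_) i hi
  simp only [sub_mul]
  rw [Finset.sum_sub_distrib, h, sub_eq_zero]
  simp only [iterate_derivative_mul, Finset.sum_mul]
  rw [Finset.sum_comm]
  refine Finset.sum_congr rfl fun j hj => ?_
  refine Eq.trans ?_ (Finset.sum_subset (s₁ := Finset.range j.succ) ?_ ?_)
  · refine Finset.sum_congr rfl fun i _ => ?_
    rw [nsmul_eq_mul, mul_assoc]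
  · intro x hx
    rw [Finset.mem_range] at *
    omega
  · intro x _ hx
    rw [Finset.mem_range] at hx
    rw [Nat.choose_eq_zero_of_lt (by omega)]
    simp

/-- Only `j = r` contributes to `∂^r`. In this way the nonvanishing of the leading coefficient
passes to the denominator `α_r`. -/
lemma lead_eq_of_operator_eq {r : ℕ} {a α : ℕ → ℚ[X]}
    (h : ∀ f : ℚ[X], ∑ i ∈ Finset.range (r + 1), a i * derivative^[i] f
      = ∑ j ∈ Finset.range (r + 1), derivative^[j] (α j * f)) : α r = a r := by
  rw [coeff_eq_of_operator_eq h _ le_rfl, Finset.sum_range_succ, Finset.sum_eq_zero]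
  · simp
  · intro j hj
    rw [Nat.choose_eq_zero_of_lt (Finset.mem_range.1 hj)]
    simp

namespace Preparation

variable {L : DiffOp} (P : Preparation L)

lemma noZero : NoZero (P.α L.order) := by
  rw [lead_eq_of_operator_eq P.α_spec]
  exact L.lead_ne_zero

lemma natDegree_initPoly_le (j : ℕ) : (initPoly L.order P.α j).natDegree ≤ L.order := by
  refine natDegree_sum_le_of_forall_le _ _ fun k hk => natDegree_sum_le_of_forall_le _ _
    fun i _ => (natDegree_C_mul_X_pow_le _ _).trans (Finset.mem_Ico.1 hk).2.le

lemma gC_wf (ell : Fin L.order → ℚ) : (P.gC ell).val.WF := ChebVec.buildC_wf _ _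

lemma gC_deg (ell : Fin L.order → ℚ) : (P.gC ell).val.deg = L.order := rfl

lemma gC_coeff (ell : Fin L.order → ℚ) (n : ℕ) : (P.gC ell).val.coeff n
    = ∑ j, ell j * (ChebVec.ofPoly (initPoly L.order P.α j)).coeff n := by
  rw [gC, ChebVec.buildC_val_coeff]
  split_ifs with h
  · rfl
  · refine (Finset.sum_eq_zero fun j _ => ?_).symm
    rw [ChebVec.ofPoly_wf _ n ((P.natDegree_initPoly_le j).trans_lt (not_le.1 h)), mul_zero]

lemma gC_toPoly (ell : Fin L.order → ℚ) :
    (P.gC ell).val.toPoly = ∑ j, C (ell j) * initPoly L.order P.α j := by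
  have h : ∀ j : Fin L.order, C (ell j) * initPoly L.order P.α j
      = ∑ n ∈ Finset.Icc (-(L.order : ℤ)) L.order, C (ell j) *
        (C ((ChebVec.ofPoly (initPoly L.order P.α j)).coeff n.natAbs) * Chebyshev.T ℚ n) := by
    intro j
    rw [← Finset.mul_sum, ← ChebVec.toPoly_eq_sum (ChebVec.ofPoly_wf _)
      (P.natDegree_initPoly_le j), ChebVec.ofPoly_toPoly]
  simp only [h]
  rw [Finset.sum_comm, ChebVec.toPoly, gC_deg]
  refine Finset.sum_congr rfl fun n _ => ?_
  rw [gC_coeff, map_sum, Finset.sum_mul]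
  exact Finset.sum_congr rfl fun j _ => by rw [C_mul, mul_assoc]

end Preparation

/-- The binomial theorem separates `x` from `t`, so that the integral reduces to products and
antiderivatives of polynomials. -/
lemma kernel_eq_sum (r : ℕ) (α : ℕ → ℚ[X]) (x t : ℝ) :
    kernel r α x t = ∑ j ∈ Finset.range r, x ^ j * aeval t (kernelCoeff r α j) := by
  have h1 : ∀ k, (x - t) ^ k / (k.factorial : ℝ) * aeval t (α (r - 1 - k))
      = ∑ j ∈ Finset.range (k + 1), x ^ j * (-t) ^ (k - j) /
        ((k - j).factorial * j.factorial) * aeval t (α (r - 1 - k)) := by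
    intro k
    rw [sub_eq_add_neg, add_pow, Finset.sum_div, Finset.sum_mul]
    refine Finset.sum_congr rfl fun j hj => ?_
    have hj' : j ≤ k := by have := Finset.mem_range.1 hj; omega
    rw [Nat.cast_choose ℝ hj']
    field_simp
  simp only [kernel, h1, kernelCoeff, map_sum, Finset.mul_sum]
  rw [← Finset.sum_neg_distrib]
  simp only [← Finset.sum_neg_distrib]
  rw [Finset.sum_sigma', Finset.sum_sigma']
  refine Finset.sum_bij' (fun a _ => ⟨a.2, a.1 - a.2⟩) (fun a _ => ⟨a.1 + a.2, a.1⟩) ?_ ?_ ?_ ?_ ?_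
  · rintro ⟨k, j⟩ h
    simp only [Finset.mem_sigma, Finset.mem_range] at *
    omega
  · rintro ⟨k, j⟩ h
    simp only [Finset.mem_sigma, Finset.mem_range] at *
    omega
  · rintro ⟨k, j⟩ h
    simp only [Finset.mem_sigma, Finset.mem_range] at *
    simp only [Sigma.mk.injEq, heq_eq_eq, and_true]
    omega
  · rintro ⟨k, j⟩ h
    simp
  · rintro ⟨k, j⟩ h
    simp only [Finset.mem_sigma, Finset.mem_range] at *
    simp only [map_mul, aeval_C, aeval_X, map_pow]
    rw [show r - 1 - j - (k - j) = r - 1 - k by omega]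
    simp only [eq_ratCast]
    push_cast
    rw [neg_pow t, pow_succ]
    field_simp

lemma continuous_kernel (r : ℕ) (α : ℕ → ℚ[X]) :
    Continuous fun p : ℝ × ℝ => kernel r α p.1 p.2 := by
  simp only [kernel_eq_sum]
  refine continuous_finsetSum _ fun j _ => ?_
  exact (continuous_fst.pow j).mul ((Polynomial.continuous_aeval _).comp continuous_snd)

lemma continuous_kernel_right (r : ℕ) (α : ℕ → ℚ[X]) (x : ℝ) : Continuous (kernel r α x) :=
  (continuous_kernel r α).comp (Continuous.prodMk_right x)

/-- The primitive `∫_0^x β_j(t) p(t) dt` combined into the Volterra operator. -/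
lemma Preparation.aeval_volterraC {L : DiffOp} (P : Preparation L) {g p : ChebVec} (hg : g.WF)
    (hp : p.WF) (x : ℝ) : aeval x (P.volterraC g p).val.toPoly = aeval x g.toPoly
      + ∫ t in (0 : ℝ)..x, kernel L.order P.α x t * aeval t p.toPoly := by
  have := forLoop_induct (fun s (u : ChebVec) => u.WF ∧ aeval x u.toPoly = aeval x g.toPoly
      + ∑ j ∈ Finset.range s, ∫ t in (0 : ℝ)..x,
        x ^ j * (aeval t (kernelCoeff L.order P.α j) * aeval t p.toPoly)) L.order (fun j acc => do
    let u ← (ChebVec.ofPoly (kernelCoeff L.order P.α j)).mulC p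
    let v ← u.intC
    let w ← (ChebVec.ofPoly (X ^ j)).mulC v
    acc.addC w) g ⟨hg, by simp⟩ (fun t _ u ⟨hu, h⟩ => ⟨ChebVec.addC_wf _ _, ?_⟩)
  · refine this.2.trans ?_
    congr 1
    rw [← intervalIntegral.integral_finsetSum]
    · simp only [kernel_eq_sum, Finset.sum_mul, mul_assoc]
    · intro j _
      refine Continuous.intervalIntegrable ?_ _ _
      exact continuous_const.mul
        ((Polynomial.continuous_aeval _).mul (Polynomial.continuous_aeval _))
  · simp only [bind_val]
    have h1 := ChebVec.mulC_wf (ChebVec.ofPoly (kernelCoeff L.order P.α t)) p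
    rw [ChebVec.addC_toPoly hu (ChebVec.mulC_wf _ _), map_add, h, Finset.sum_range_succ,
      ChebVec.mulC_toPoly (ChebVec.intC_wf h1), map_mul, ChebVec.ofPoly_toPoly,
      ChebVec.aeval_intC h1, ChebVec.mulC_toPoly hp, ChebVec.ofPoly_toPoly,
      intervalIntegral.integral_const_mul]
    simp only [map_mul, map_pow, aeval_X]
    ring

/-- The integral form of the differential equation. -/
lemma Preparation.volterra_eq {L : DiffOp} (P : Preparation L) {ell : Fin L.order → ℚ}
    {y : ℝ → ℝ} (hy : IsSolution L ell y) {x : ℝ} (hx : x ∈ Set.Icc (-1 : ℝ) 1) :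
    aeval x (P.α L.order) * y x = aeval x (P.gC ell).val.toPoly
      + ∫ t in (0 : ℝ)..x, kernel L.order P.α x t * y t := by
  set I := Set.Icc (-1 : ℝ) 1 with hI
  have hI' : UniqueDiffOn ℝ I := uniqueDiffOn_Icc (by norm_num)
  set Y : ℕ → ℝ → ℝ := fun l => iteratedDerivWithin l y I with hYdef
  have hY0 : Y 0 = y := iteratedDerivWithin_zero
  have hYd : ∀ l < L.order, ∀ t ∈ I, HasDerivWithinAt (Y l) (Y (l + 1) t) I t := by
    intro l hl t ht
    have := (hy.contDiffOn.differentiableOn_iteratedDerivWithin (by exact_mod_cast hl) hI')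
    have h2 := (this t ht).hasDerivWithinAt
    rwa [← iteratedDerivWithin_succ] at h2
  have hYc : ∀ l ≤ L.order, ContinuousOn (Y l) I := fun l hl =>
    hy.contDiffOn.continuousOn_iteratedDerivWithin (by exact_mod_cast hl) hI'
  -- `V_s = ∑_{j ≤ s} (α_{r-s+j} y)^{(j)}` interpolates between `V_0 = α_r y` and `V_r = L y = 0`,
  -- with `V_s' = V_{s+1} - α_{r-1-s} y`.
  set V : ℕ → ℝ → ℝ := fun s t => ∑ j ∈ Finset.range (s + 1), leibniz (P.α (L.order - s + j)) Y j t
    with hV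
  have hVr : ∀ t ∈ I, V L.order t = 0 := by
    intro t ht
    have h := hy.eq_zero t ht
    rw [← h]
    simp only [hV, leibniz, Nat.sub_self, zero_add]
    have h2 : ∀ j ∈ Finset.range (L.order + 1), ∑ l ∈ Finset.range (j + 1),
        (j.choose l : ℝ) * (Y l t * aeval t (derivative^[j - l] (P.α j)))
        = ∑ l ∈ Finset.range (L.order + 1),
        (j.choose l : ℝ) * (Y l t * aeval t (derivative^[j - l] (P.α j))) := by
      intro j hj
      refine Finset.sum_subset ?_ ?_
      · intro x hx
        rw [Finset.mem_range] at *
        omega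
      · intro x _ hx
        rw [Finset.mem_range] at hx
        rw [Nat.choose_eq_zero_of_lt (by omega)]
        simp
    rw [Finset.sum_congr rfl h2, Finset.sum_comm]
    refine Finset.sum_congr rfl fun i hi => ?_
    rw [coeff_eq_of_operator_eq P.α_spec i (by have := Finset.mem_range.1 hi; omega), map_sum, Finset.sum_mul]
    refine Finset.sum_congr rfl fun j _ => ?_
    simp only [map_mul, map_natCast, hYdef]
    ring
  have hVd : ∀ s < L.order, ∀ t ∈ I,
      HasDerivWithinAt (V s) (V (s + 1) t - aeval t (P.α (L.order - 1 - s)) * y t) I t := by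
    intro s hs t ht
    have h1 : HasDerivWithinAt (V s)
        (∑ j ∈ Finset.range (s + 1), leibniz (P.α (L.order - s + j)) Y (j + 1) t) I t :=
      HasDerivWithinAt.fun_sum fun j hj => hasDerivWithinAt_leibniz _ _ fun l hl =>
        hYd l (by have := Finset.mem_range.1 hj; omega) t ht
    convert h1 using 1
    simp only [hV]
    rw [Finset.sum_range_succ']
    have h2 : leibniz (P.α (L.order - (s + 1) + 0)) Y 0 t = aeval t (P.α (L.order - 1 - s)) * y t := by
      simp [leibniz, hY0, mul_comm, Nat.sub_add_eq, Nat.sub_right_comm]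
    rw [h2, add_sub_cancel_right]
    refine Finset.sum_congr rfl fun j _ => ?_
    rw [show L.order - (s + 1) + (j + 1) = L.order - s + j by omega]
  -- A Taylor sum in the base point `t`, for fixed `x`. Its derivative telescopes to `K(x,t) y(t)`,
  -- while `Φ(x) = α_r(x) y(x)` and `Φ(0) = g(x)`; one integration from `0` to `x` replaces `r`
  -- nested ones.
  set Φ : ℝ → ℝ := fun t => ∑ k ∈ Finset.range L.order, (x - t) ^ k / (k.factorial : ℝ) * V k t with hΦ
  have hΦd : ∀ t ∈ I, HasDerivWithinAt Φ (kernel L.order P.α x t * y t) I t := by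
    intro t ht
    have h1 : ∀ n ≤ L.order, HasDerivWithinAt
        (fun t => ∑ k ∈ Finset.range n, (x - t) ^ k / (k.factorial : ℝ) * V k t)
        ((if n = 0 then 0 else (x - t) ^ (n - 1) / ((n - 1).factorial : ℝ) * V n t)
          + (-∑ k ∈ Finset.range n, (x - t) ^ k / (k.factorial : ℝ) *
            aeval t (P.α (L.order - 1 - k))) * y t) I t := by
      intro n
      induction n with
      | zero =>
        intro _
        simp only [Finset.range_zero, Finset.sum_empty, if_true, neg_zero, zero_mul, add_zero]
        exact hasDerivWithinAt_const _ _ _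
      | succ n ih =>
        intro hn
        have h2 := ih (by omega)
        have h3 : HasDerivWithinAt (fun t => (x - t) ^ n / (n.factorial : ℝ))
            (n * (x - t) ^ (n - 1) * (-1) / (n.factorial : ℝ)) I t := by
          have : HasDerivAt (fun t => x - t) (-1) t := by
            simpa using (hasDerivAt_id t).const_sub x
          exact ((this.pow n).div_const _).hasDerivWithinAt
        have h4 := h2.add (h3.mul (hVd n (by omega) t ht))
        have h5 : (fun t => ∑ k ∈ Finset.range (n + 1), (x - t) ^ k / (k.factorial : ℝ) * V k t)
            = (fun t => ∑ k ∈ Finset.range n, (x - t) ^ k / (k.factorial : ℝ) * V k t)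
              + (fun t => (x - t) ^ n / (n.factorial : ℝ)) * V n := by
          funext t
          rw [Finset.sum_range_succ]
          rfl
        rw [h5]
        refine h4.congr_deriv ?_
        rw [Finset.sum_range_succ, if_neg n.succ_ne_zero, Nat.add_sub_cancel]
        rcases n with _ | n
        · simp
          ring
        · rw [if_neg n.succ_ne_zero, Nat.add_sub_cancel, Nat.factorial_succ]
          push_cast
          have : (n.factorial : ℝ) ≠ 0 := by positivity
          have : (n : ℝ) + 1 ≠ 0 := by positivity
          field_simp
          ring
    have h6 := h1 L.order le_rfl
    rw [hVr t ht, mul_zero, ite_self, zero_add] at h6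
    exact h6
  have h0I : (0 : ℝ) ∈ I := by norm_num [hI]
  have hsub : Set.uIcc 0 x ⊆ I := Set.ordConnected_Icc.uIcc_subset h0I hx
  have hInt : Φ x - Φ 0 = ∫ t in (0 : ℝ)..x, kernel L.order P.α x t * y t := by
    -- At `±1` derivatives are only taken within the interval; continuity on the closed segment and
    -- derivatives inside are enough.
    refine (intervalIntegral.integral_eq_sub_of_hasDeriv_right (f := Φ) ?_ ?_ ?_).symm
    · exact fun t ht => (hΦd t (hsub ht)).continuousWithinAt.mono hsub
    · intro t ht
      have ht' : t ∈ Set.Ioo (-1 : ℝ) 1 := by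
        rw [Set.mem_Icc] at hx
        refine ⟨lt_of_le_of_lt (le_min (by norm_num) hx.1) ht.1,
          lt_of_lt_of_le ht.2 (max_le (by norm_num) hx.2)⟩
      exact ((hΦd t ⟨ht'.1.le, ht'.2.le⟩).hasDerivAt
        (Icc_mem_nhds ht'.1 ht'.2)).hasDerivWithinAt
    · refine ContinuousOn.intervalIntegrable ?_
      refine (continuous_kernel_right _ _ _).continuousOn.mul ?_
      have := hYc 0 (Nat.zero_le _)
      rw [hY0] at this
      exact this.mono hsub
  have hΦ0 : Φ 0 = aeval x (P.gC ell).val.toPoly := by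
    rw [P.gC_toPoly]
    have e0 : ∀ f : ℚ[X], aeval (0 : ℝ) f = ((eval 0 f : ℚ) : ℝ) := fun f => by
      have := aeval_algebraMap_apply ℝ (0 : ℚ) f
      simpa using this
    have e1 : aeval x (∑ j, C (ell j) * initPoly L.order P.α j)
        = ∑ j : Fin L.order, ∑ k ∈ Finset.Ico (j : ℕ) L.order, ∑ i ∈ Finset.Icc (j : ℕ) k,
          x ^ k / (k.factorial : ℝ) * ((i.choose j : ℝ) * (Y j 0 *
            aeval 0 (derivative^[i - j] (P.α (L.order - k + i))))) := by
      simp only [map_sum, map_mul, aeval_C, initPoly, aeval_X, map_pow, Finset.mul_sum]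
      refine Finset.sum_congr rfl fun j _ => Finset.sum_congr rfl fun k _ =>
        Finset.sum_congr rfl fun i _ => ?_
      have e2 : Y j 0 = ell j := hy.initial j
      rw [e2, e0]
      simp only [eq_ratCast]
      push_cast
      ring
    rw [e1, Finset.sum_range (fun j => ∑ k ∈ Finset.Ico j L.order, ∑ i ∈ Finset.Icc j k,
          x ^ k / (k.factorial : ℝ) * ((i.choose j : ℝ) * (Y j 0 *
            aeval 0 (derivative^[i - j] (P.α (L.order - k + i)))))) |>.symm]
    rw [Finset.sum_comm' (t' := Finset.range L.order) (s' := fun k => Finset.range (k + 1))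
      (by intro j k; simp only [Finset.mem_range, Finset.mem_Ico]; omega)]
    simp only [hΦ, hV, leibniz, sub_zero, Finset.mul_sum]
    refine Finset.sum_congr rfl fun k _ => ?_
    exact Finset.sum_comm' (by
      intro i j; simp only [Finset.mem_range, Finset.mem_Icc]; omega)
  have hΦx : Φ x = aeval x (P.α L.order) * y x := by
    -- For order `0` the sum `Φ` is empty, and the equation itself says `α_0 y = 0`.
    rcases Nat.eq_zero_or_pos L.order with h0 | hpos
    · have h1 := hVr x hx
      simp only [hV, h0, leibniz, zero_add, Finset.sum_range_one, Nat.choose_self, hY0] at h1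
      simp only [hΦ, h0, Finset.range_zero, Finset.sum_empty]
      rw [← h1]
      simp [mul_comm]
    · simp only [hΦ, sub_self]
      rw [Finset.sum_eq_single 0]
      · simp [hV, leibniz, hY0, mul_comm]
      · intro k _ hk
        simp [hk]
      · intro h
        exact absurd (Finset.mem_range.2 hpos) h
  rw [← hΦx, ← hΦ0, ← hInt]
  ring

/-! ### Volterra iterations -/

lemma integral_sum_pow_div_factorial (S : Finset ℕ) (c : ℕ → ℝ) (e : ℕ → ℕ) (s : ℝ) :
    ∫ t in (0 : ℝ)..s, ∑ j ∈ S, c j * (t ^ e j / (e j).factorial)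
      = ∑ j ∈ S, c j * (s ^ (e j + 1) / (e j + 1).factorial) := by
  rw [intervalIntegral.integral_finsetSum]
  · refine Finset.sum_congr rfl fun j _ => ?_
    rw [intervalIntegral.integral_const_mul, intervalIntegral.integral_div, integral_pow,
      zero_pow (by omega), sub_zero, div_div, Nat.factorial_succ]
    push_cast
    rfl
  · exact fun j _ => Continuous.intervalIntegrable (by fun_prop) _ _

/-- The majorant depends on `|t|` only, so negative `x` reduces to positive `x` by reflection. -/
lemma abs_integral_le_of_abs_le {f φ : ℝ → ℝ} (hφ : Continuous φ) {x : ℝ}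
    (h : ∀ t ∈ Set.uIcc 0 x, |f t| ≤ φ |t|) : |∫ t in (0 : ℝ)..x, f t| ≤ ∫ t in (0 : ℝ)..|x|, φ t := by
  have key : ∀ {f : ℝ → ℝ} {x : ℝ}, 0 ≤ x → (∀ t ∈ Set.Icc 0 x, |f t| ≤ φ |t|) →
      |∫ t in (0 : ℝ)..x, f t| ≤ ∫ t in (0 : ℝ)..x, φ t := by
    intro f x hx h
    have hInt : IntervalIntegrable φ MeasureTheory.volume 0 x := hφ.intervalIntegrable _ _
    rw [← Real.norm_eq_abs]
    refine intervalIntegral.norm_integral_le_of_norm_le hx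
      (Filter.Eventually.of_forall fun t ht => ?_) hInt
    have := h t ⟨ht.1.le, ht.2⟩
    rwa [abs_of_nonneg ht.1.le] at this
  rcases le_total 0 x with hx | hx
  · rw [abs_of_nonneg hx]
    exact key hx fun t ht => h t (by rwa [Set.uIcc_of_le hx])
  · rw [abs_of_nonpos hx]
    have h1 := key (f := fun t => f (-t)) (x := -x) (by linarith) fun t ht => by
      have := h (-t) (by rw [Set.uIcc_of_ge hx]; exact ⟨by linarith [ht.2], by linarith [ht.1]⟩)
      rwa [abs_neg] at this
    rw [intervalIntegral.integral_comp_neg, neg_neg, neg_zero, intervalIntegral.integral_symm,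
      abs_neg] at h1
    exact h1

/-- `|κ(x, t)| ≤ A` whenever `t` lies between `0` and `x` in `[-1, 1]`. -/
def KernelBound (κ : ℝ → ℝ → ℝ) (A : ℝ) : Prop :=
  ∀ x t : ℝ, (0 ≤ t ∧ t ≤ x ∧ x ≤ 1) ∨ (-1 ≤ x ∧ x ≤ t ∧ t ≤ 0) → |κ x t| ≤ A

section
variable {κ : ℝ → ℝ → ℝ} {A ε : ℝ} {i : ℕ} {D : ℕ → ℝ → ℝ}

lemma KernelBound.nonneg (hκ : KernelBound κ A) : 0 ≤ A :=
  (abs_nonneg _).trans (hκ 0 0 (Or.inl (by norm_num)))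

lemma KernelBound.abs_integral_le (hκ : KernelBound κ A) {h φ : ℝ → ℝ} (hφ : Continuous φ)
    (hb : ∀ t ∈ Set.Icc (-1 : ℝ) 1, |h t| ≤ φ |t|) {x : ℝ} (hx : x ∈ Set.Icc (-1 : ℝ) 1) :
    |∫ t in (0 : ℝ)..x, κ x t * h t| ≤ A * ∫ t in (0 : ℝ)..|x|, φ t := by
  rw [← intervalIntegral.integral_const_mul]
  refine abs_integral_le_of_abs_le (φ := fun t => A * φ t) (continuous_const.mul hφ) fun t ht => ?_
  have hI : t ∈ Set.Icc (-1 : ℝ) 1 :=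
    Set.ordConnected_Icc.uIcc_subset (by norm_num) hx ht
  rw [abs_mul]
  refine mul_le_mul (hκ x t ?_) (hb t hI) (abs_nonneg _) hκ.nonneg
  rcases le_total 0 x with h0 | h0
  · rw [Set.uIcc_of_le h0] at ht
    exact Or.inl ⟨ht.1, ht.2, hx.2⟩
  · rw [Set.uIcc_of_ge h0] at ht
    exact Or.inr ⟨hx.1, ht.1, ht.2⟩

/-- Propagation of a bound through a perturbed Volterra iteration. -/
lemma KernelBound.iterate_bound (hκ : KernelBound κ A)
    (hD : ∀ k < i, ∀ x ∈ Set.Icc (-1 : ℝ) 1,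
      |D (k + 1) x - ∫ t in (0 : ℝ)..x, κ x t * D k t| ≤ ε)
    (S : Finset ℕ) (c : ℕ → ℝ) (e : ℕ → ℕ)
    (h0 : ∀ x ∈ Set.Icc (-1 : ℝ) 1, |D 0 x| ≤ ∑ j ∈ S, c j * (|x| ^ e j / (e j).factorial)) :
    ∀ k ≤ i, ∀ x ∈ Set.Icc (-1 : ℝ) 1, |D k x|
      ≤ ∑ l ∈ Finset.range k, (ε * A ^ l) * (|x| ^ l / l.factorial)
        + ∑ j ∈ S, (A ^ k * c j) * (|x| ^ (e j + k) / (e j + k).factorial) := by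
  intro k
  induction k with
  | zero => intro _ x hx; simpa using h0 x hx
  | succ k ih =>
    intro hk x hx
    have h1 := hκ.abs_integral_le (h := D k) (φ := fun s =>
      ∑ l ∈ Finset.range k, (ε * A ^ l) * (s ^ l / l.factorial)
        + ∑ j ∈ S, (A ^ k * c j) * (s ^ (e j + k) / (e j + k).factorial)) (by fun_prop)
      (ih (by omega)) hx
    have h2 := hD k (by omega) x hx
    rw [intervalIntegral.integral_add (Continuous.intervalIntegrable (by fun_prop) _ _)
      (Continuous.intervalIntegrable (by fun_prop) _ _),
      integral_sum_pow_div_factorial _ _ fun l => l,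
      integral_sum_pow_div_factorial _ (fun j => A ^ k * c j) fun j => e j + k] at h1
    have h3 : |D (k + 1) x| ≤ |∫ t in (0 : ℝ)..x, κ x t * D k t|
        + |D (k + 1) x - ∫ t in (0 : ℝ)..x, κ x t * D k t| := by
      have := abs_add_le (∫ t in (0 : ℝ)..x, κ x t * D k t)
        (D (k + 1) x - ∫ t in (0 : ℝ)..x, κ x t * D k t)
      rwa [add_sub_cancel] at this
    rw [Finset.sum_range_succ', pow_zero, Nat.factorial_zero, pow_zero]
    rw [mul_add, Finset.mul_sum, Finset.mul_sum] at h1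
    have e1 : ∀ l, A * ((ε * A ^ l) * (|x| ^ (l + 1) / (l + 1).factorial))
        = (ε * A ^ (l + 1)) * (|x| ^ (l + 1) / (l + 1).factorial) := fun l => by ring
    have e2 : ∀ j, A * ((A ^ k * c j) * (|x| ^ (e j + k + 1) / (e j + k + 1).factorial))
        = (A ^ (k + 1) * c j) * (|x| ^ (e j + (k + 1)) / (e j + (k + 1)).factorial) := fun j => by
      rw [← add_assoc]; ring
    simp only [e1, e2] at h1
    simp only [Nat.cast_one, div_one, mul_one]
    linarith

lemma sum_exp_le {A ε s : ℝ} (hA : 0 ≤ A) (hε : 0 ≤ ε) (hs0 : 0 ≤ s) (hs1 : s ≤ 1) (k : ℕ) :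
    ∑ l ∈ Finset.range k, (ε * A ^ l) * (s ^ l / l.factorial) ≤ Real.exp A * ε := by
  have h : ∑ l ∈ Finset.range k, (ε * A ^ l) * (s ^ l / l.factorial)
      ≤ ∑ l ∈ Finset.range k, ε * (A ^ l / l.factorial) := by
    refine Finset.sum_le_sum fun l _ => ?_
    rw [mul_assoc]
    refine mul_le_mul_of_nonneg_left ?_ hε
    rw [← mul_div_assoc]
    refine div_le_div_of_nonneg_right ?_ (by positivity)
    exact mul_le_of_le_one_right (by positivity) (pow_le_one₀ hs0 hs1)
  refine h.trans ?_
  rw [← Finset.mul_sum, mul_comm]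
  exact mul_le_mul_of_nonneg_right (Real.sum_le_exp_of_nonneg hA k) hε

lemma summable_gamma {A : ℝ} (hi : 1 ≤ i) :
    Summable fun j : ℕ => A ^ (i * j) / ((i * j).factorial : ℝ) :=
  (Real.summable_pow_div_factorial A).comp_injective
    (i := fun j : ℕ => i * j) fun _ _ h => Nat.eq_of_mul_eq_mul_left hi h

lemma one_le_gamma {A : ℝ} (hA : 0 ≤ A) (hi : 1 ≤ i) : 1 ≤ Preparation.gamma A i := by
  have := (summable_gamma (A := A) hi).le_tsum 0 fun j _ => by positivity
  simpa [Preparation.gamma] using this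

/-- A function that is close to its image under a perturbed `i`-fold Volterra iteration is
small. -/
lemma KernelBound.abs_le_gamma (hκ : KernelBound κ A) (hi : 1 ≤ i) (hε : 0 ≤ ε)
    (hD : ∀ k < i, ∀ x ∈ Set.Icc (-1 : ℝ) 1,
      |D (k + 1) x - ∫ t in (0 : ℝ)..x, κ x t * D k t| ≤ ε)
    {U δ : ℝ} (hU : ∀ x ∈ Set.Icc (-1 : ℝ) 1, |D 0 x| ≤ U)
    (hδ : ∀ x ∈ Set.Icc (-1 : ℝ) 1, |D 0 x - D i x| ≤ δ) {x : ℝ} (hx : x ∈ Set.Icc (-1 : ℝ) 1) :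
    |D 0 x| ≤ Preparation.gamma A i * (δ + Real.exp A * ε) := by
  have hA := hκ.nonneg
  set N := δ + Real.exp A * ε with hN
  have hδ0 : 0 ≤ δ := (abs_nonneg _).trans (hδ x hx)
  have hN0 : 0 ≤ N := by positivity
  have hU0 : 0 ≤ U := (abs_nonneg _).trans (hU x hx)
  -- Bootstrap: insert the current majorant of `D 0` into `i` Volterra steps and use `D 0 = (D 0 - D
  -- i) + D i`. Each round shifts the terms by `i` and adds a new leading term `N`, while the crude
  -- bound `U` is pushed to the factor `A^{in} / (in)!`, which tends to `0`.
  have key : ∀ n : ℕ, ∀ x ∈ Set.Icc (-1 : ℝ) 1, |D 0 x| ≤ ∑ j ∈ Finset.range (n + 1),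
      (A ^ (i * j) * if j < n then N else U) * (|x| ^ (i * j) / (i * j).factorial) := by
    intro n
    induction n with
    | zero => intro x hx; simpa using hU x hx
    | succ n ih =>
      intro x hx
      have h1 := hκ.iterate_bound hD _ _ _ ih i le_rfl x hx
      have h2 := hδ x hx
      have h3 : |D 0 x| ≤ |D 0 x - D i x| + |D i x| := by
        have := abs_add_le (D 0 x - D i x) (D i x)
        rwa [sub_add_cancel] at this
      have h4 := sum_exp_le hA hε (abs_nonneg x) (abs_le.2 hx) i
      rw [Finset.sum_range_succ']
      have e1 : ∀ j, A ^ i * (A ^ (i * j) * if j < n then N else U)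
          * (|x| ^ (i * j + i) / (i * j + i).factorial)
          = (A ^ (i * (j + 1)) * if j + 1 < n + 1 then N else U)
            * (|x| ^ (i * (j + 1)) / (i * (j + 1)).factorial) := by
        intro j
        rw [show i * (j + 1) = i * j + i by ring, pow_add A]
        simp only [add_lt_add_iff_right]
        ring
      simp only [e1] at h1
      simp only [mul_zero, pow_zero, Nat.factorial_zero, Nat.cast_one, div_one, mul_one, one_mul,
        if_pos n.succ_pos]
      linarith
  have hs := summable_gamma (A := A) hi
  have hb : ∀ n : ℕ, |D 0 x| ≤ N * Preparation.gamma A i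
      + U * (A ^ (i * n) / (i * n).factorial) := by
    intro n
    refine (key n x hx).trans ?_
    rw [Finset.sum_range_succ, if_neg (lt_irrefl n)]
    have hx1 : |x| ≤ 1 := abs_le.2 hx
    refine add_le_add ?_ ?_
    · calc _ ≤ ∑ j ∈ Finset.range n, N * (A ^ (i * j) / (i * j).factorial) := by
            refine Finset.sum_le_sum fun j hj => ?_
            rw [if_pos (Finset.mem_range.1 hj), mul_comm _ N, mul_assoc]
            refine mul_le_mul_of_nonneg_left ?_ hN0
            rw [← mul_div_assoc]
            refine div_le_div_of_nonneg_right ?_ (by positivity)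
            exact mul_le_of_le_one_right (by positivity) (pow_le_one₀ (abs_nonneg x) hx1)
        _ ≤ _ := by
            rw [← Finset.mul_sum]
            exact mul_le_mul_of_nonneg_left (hs.sum_le_tsum _ fun j _ => by positivity) hN0
    · rw [mul_comm _ U, mul_assoc]
      refine mul_le_mul_of_nonneg_left ?_ hU0
      rw [← mul_div_assoc]
      refine div_le_div_of_nonneg_right ?_ (by positivity)
      exact mul_le_of_le_one_right (by positivity) (pow_le_one₀ (abs_nonneg x) hx1)
  have hlim : Filter.Tendsto (fun n : ℕ => N * Preparation.gamma A i
      + U * (A ^ (i * n) / (i * n).factorial)) Filter.atTop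
      (nhds (N * Preparation.gamma A i + U * 0)) :=
    tendsto_const_nhds.add (hs.tendsto_atTop_zero.const_mul U)
  rw [mul_zero, add_zero] at hlim
  rw [mul_comm]
  exact ge_of_tendsto' hlim hb

end

/-! ### Uniform norms -/

lemma le_supNorm {f : ℝ → ℝ} (hf : ContinuousOn f (Set.Icc (-1) 1)) {x : ℝ}
    (hx : x ∈ Set.Icc (-1 : ℝ) 1) : |f x| ≤ supNorm f :=
  le_csSup (isCompact_Icc.image_of_continuousOn hf.abs).bddAbove ⟨x, hx, rfl⟩

lemma supNorm_nonneg (f : ℝ → ℝ) : 0 ≤ supNorm f :=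
  Real.sSup_nonneg (by rintro _ ⟨x, -, rfl⟩; exact abs_nonneg _)

lemma supNorm_le {f : ℝ → ℝ} {B : ℝ} (h : ∀ x ∈ Set.Icc (-1 : ℝ) 1, |f x| ≤ B) :
    supNorm f ≤ B :=
  csSup_le ⟨_, 0, by norm_num, rfl⟩ (by rintro _ ⟨x, hx, rfl⟩; exact h x hx)

lemma ChebVec.boundC_val (u : ChebVec) : (u.boundC.val : ℝ)
    = ∑ n ∈ Finset.Icc (-(u.deg : ℤ)) u.deg, |u.seq n| := by
  rw [boundC, sumC_val]
  push_cast
  exact Finset.sum_congr rfl fun n _ => by rw [absC_val, Rat.cast_abs]; rfl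

lemma ChebVec.abs_aeval_le (u : ChebVec) {x : ℝ} (hx : x ∈ Set.Icc (-1 : ℝ) 1) :
    |aeval x u.toPoly| ≤ u.boundC.val := by
  obtain ⟨z, hz, hzx⟩ := exists_joukowski hx
  have h := u.aeval_joukowski (ne_zero_of_norm_one hz)
  rw [hzx, aeval_ofReal] at h
  have h2 := congr_arg norm h
  rw [Complex.norm_real, Real.norm_eq_abs] at h2
  rw [h2, u.boundC_val]
  refine (norm_sum_le _ _).trans (Finset.sum_le_sum fun n _ => ?_)
  rw [norm_mul, norm_zpow, hz, one_zpow, mul_one, ← Complex.ofReal_ratCast, Complex.norm_real]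
  rfl

/-- On the unit circle every `z^n` has modulus `1`, so the `ℓ¹` error of the coefficients dominates
the uniform error. -/
lemma ExpansionData.abs_expandC_sub_le {b : ℚ[X]} (E : ExpansionData b) (hb : NoZero b)
    {f : ChebVec} (hf : f.WF) {ε : ℚ} (hε : 0 < ε) {x : ℝ} (hx : x ∈ Set.Icc (-1 : ℝ) 1) :
    |aeval x (E.expandC f ε).val.toPoly - (aeval x b)⁻¹ * aeval x f.toPoly| ≤ ε := by
  obtain ⟨C, -, h⟩ := E.exists_expandC_cost hb.ne_zero
  obtain ⟨M, hM⟩ := hf.exists_bound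
  obtain ⟨-, -, -, -, herr⟩ := h f hf M hM ε hε
  obtain ⟨z, hz, hzx⟩ := exists_joukowski hx
  have h1 := ChebVec.hasSum_joukowski (E.expandC_wf f ε) (ne_zero_of_norm_one hz)
  have h2 := h1.sub (E.hasSum_trueCoeff hb hf hz)
  rw [hzx, aeval_ofReal, aeval_ofReal, aeval_ofReal, ← Complex.ofReal_div,
    ← Complex.ofReal_sub] at h2
  set c : ℤ → ℝ := fun n => ((E.expandC f ε).val.coeff n.natAbs : ℝ) - E.trueCoeff f n.natAbs with hc
  have hs : Summable fun n => ‖c n‖ := by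
    have h3 : ∑' n, ‖c n‖ₑ ≠ ∞ := ne_top_of_le_ne_top ENNReal.ofReal_ne_top herr
    have := ENNReal.summable_toReal h3
    simpa using this
  have h4 : HasSum (fun n => (c n : ℂ) * z ^ n) _ := h2.congr_fun fun n => by
    simp only [hc]
    push_cast
    ring
  have hnorm : ∀ n, ‖(c n : ℂ) * z ^ n‖ = ‖c n‖ := fun n => by
    rw [norm_mul, norm_zpow, hz, one_zpow, mul_one, Complex.norm_real]
  have h5 : ∑' n, ‖c n‖ ≤ ε := by
    have h6 : ENNReal.ofReal (∑' n, ‖c n‖) ≤ ENNReal.ofReal ε := by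
      rw [ENNReal.ofReal_tsum_of_nonneg (fun n => norm_nonneg _) hs]
      simpa only [ofReal_norm] using herr
    exact (ENNReal.ofReal_le_ofReal_iff (by exact_mod_cast hε.le)).1 h6
  have h7 := norm_tsum_le_tsum_norm (f := fun n => (c n : ℂ) * z ^ n) (by simpa only [hnorm] using hs)
  rw [h4.tsum_eq, Complex.norm_real] at h7
  simp only [hnorm] at h7
  rw [Real.norm_eq_abs, div_eq_inv_mul] at h7
  exact h7.trans h5

/-! ### Correctness of the returned bound -/

namespace Preparation

variable {L : DiffOp} (P : Preparation L)

/-- The kernel of the fixed point equation. -/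
def fixKernel (x t : ℝ) : ℝ := (aeval x (P.α L.order))⁻¹ * kernel L.order P.α x t

lemma kernelBound : KernelBound P.fixKernel P.A := P.A_spec

/-- Excludes `i = 0`, where every term of the series `γ_i` would be `1` and the sum would diverge.
-/
lemma one_le_i : 1 ≤ P.i := by
  rcases Nat.eq_zero_or_pos P.i with h | h
  · have := P.i_spec.1
    rw [h] at this
    norm_num at this
  · exact h

lemma continuousOn_of_isSolution {ell : Fin L.order → ℚ} {y : ℝ → ℝ} (hy : IsSolution L ell y) :
    ContinuousOn y (Set.Icc (-1) 1) := hy.contDiffOn.continuousOn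

lemma continuousOn_error {ell : Fin L.order → ℚ} {y : ℝ → ℝ} (hy : IsSolution L ell y)
    (p : ℚ[X]) : ContinuousOn (fun x => y x - aeval x p) (Set.Icc (-1) 1) :=
  hy.contDiffOn.continuousOn.sub (Polynomial.continuous_aeval p).continuousOn

lemma solution_eq {ell : Fin L.order → ℚ} {y : ℝ → ℝ} (hy : IsSolution L ell y) {x : ℝ}
    (hx : x ∈ Set.Icc (-1 : ℝ) 1) :
    y x = (aeval x (P.α L.order))⁻¹ * aeval x (P.gC ell).val.toPoly
      + ∫ t in (0 : ℝ)..x, P.fixKernel x t * y t := by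
  have h := P.volterra_eq hy hx
  have h0 := P.noZero x hx
  simp only [fixKernel, mul_assoc]
  rw [intervalIntegral.integral_const_mul, ← mul_add, ← h, inv_mul_cancel_left₀ h0]

/-- The solution is fixed by the affine map of which `p_{k+1}` is an `ε`-approximate value at `p_k`;
in the difference `g` cancels and only the expansion error is left. -/
lemma iterC_error {ell : Fin L.order → ℚ} {y : ℝ → ℝ} (hy : IsSolution L ell y)
    {p : ChebVec} (hp : p.WF) {ε : ℚ} (hε : 0 < ε) (k : ℕ) {x : ℝ}
    (hx : x ∈ Set.Icc (-1 : ℝ) 1) :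
    |(y x - aeval x (P.iterC (P.gC ell).val p ε (k + 1)).val.toPoly)
      - ∫ t in (0 : ℝ)..x, P.fixKernel x t *
        (y t - aeval t (P.iterC (P.gC ell).val p ε k).val.toPoly)| ≤ ε := by
  set u := (P.iterC (P.gC ell).val p ε k).val with hu
  have hg := P.gC_wf ell
  have hsub : Set.uIcc 0 x ⊆ Set.Icc (-1 : ℝ) 1 :=
    Set.ordConnected_Icc.uIcc_subset (by norm_num) hx
  have hκ : Continuous (P.fixKernel x) := continuous_const.mul (continuous_kernel_right _ _ x)
  have e : (P.iterC (P.gC ell).val p ε (k + 1)).val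
      = (P.expansion.expandC (P.volterraC (P.gC ell).val u).val ε).val := rfl
  have h1 := P.expansion.abs_expandC_sub_le P.noZero (P.volterraC_wf hg u) hε hx
  rw [← e, P.aeval_volterraC hg (P.iterC_wf _ hp ε k)] at h1
  have h2 : ∫ t in (0 : ℝ)..x, P.fixKernel x t * (y t - aeval t u.toPoly)
      = (∫ t in (0 : ℝ)..x, P.fixKernel x t * y t)
        - ∫ t in (0 : ℝ)..x, P.fixKernel x t * aeval t u.toPoly := by
    simp only [mul_sub]
    refine intervalIntegral.integral_sub ?_ ?_
    · exact (hκ.continuousOn.mul (hy.contDiffOn.continuousOn.mono hsub)).intervalIntegrable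
    · exact (hκ.mul (Polynomial.continuous_aeval _)).intervalIntegrable _ _
  have h3 : ∫ t in (0 : ℝ)..x, P.fixKernel x t * aeval t u.toPoly
      = (aeval x (P.α L.order))⁻¹ *
        ∫ t in (0 : ℝ)..x, kernel L.order P.α x t * aeval t u.toPoly := by
    simp only [fixKernel, mul_assoc]
    rw [intervalIntegral.integral_const_mul]
  rw [h2, h3, P.solution_eq hy hx, abs_sub_comm]
  convert h1 using 2
  ring

lemma validate_val (ell : Fin L.order → ℚ) (p : ChebVec) (ε : ℚ) :
    (P.validate ell p ε).val = gamma P.A P.i *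
      (((p.subC (P.iterC (P.gC ell).val p ε P.i).val).val.boundC.val : ℝ)
        + Real.exp P.A * ε) := rfl

lemma boundC_nonneg (u : ChebVec) : (0 : ℝ) ≤ u.boundC.val := by
  rw [u.boundC_val]
  exact Finset.sum_nonneg fun _ _ => abs_nonneg _

lemma validate_pos (ell : Fin L.order → ℚ) (p : ChebVec) {ε : ℚ} (hε : 0 < ε) :
    0 < (P.validate ell p ε).val := by
  rw [validate_val]
  have h1 := one_le_gamma P.kernelBound.nonneg P.one_le_i
  have h2 := boundC_nonneg (p.subC (P.iterC (P.gC ell).val p ε P.i).val).val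
  have h3 : (0 : ℝ) < ε := by exact_mod_cast hε
  have h4 := Real.exp_pos P.A
  positivity

lemma supNorm_le_validate {ell : Fin L.order → ℚ} {y : ℝ → ℝ} (hy : IsSolution L ell y)
    {p : ChebVec} (hp : p.WF) {ε : ℚ} (hε : 0 < ε) :
    supNorm (fun x => y x - aeval x p.toPoly) ≤ (P.validate ell p ε).val := by
  rw [validate_val]
  refine supNorm_le fun x hx => ?_
  set D : ℕ → ℝ → ℝ := fun k x => y x - aeval x (P.iterC (P.gC ell).val p ε k).val.toPoly with hD
  -- Here `D k = y - p_k`, so `D 0 - D i = p_i - p`, whose uniform norm is at most the coefficient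
  -- sum `δ`.
  refine P.kernelBound.abs_le_gamma P.one_le_i (by exact_mod_cast hε.le) (D := D)
    (fun k _ x hx => P.iterC_error hy hp hε k hx)
    (fun x hx => le_supNorm (continuousOn_error hy _) hx) (fun x hx => ?_) hx
  have h := (p.subC (P.iterC (P.gC ell).val p ε P.i).val).val.abs_aeval_le hx
  rw [ChebVec.subC_toPoly hp (P.iterC_wf _ hp ε _), map_sub, abs_sub_comm] at h
  convert h using 2
  simp only [hD]
  change y x - aeval x p.toPoly - _ = _
  ring

end Preparation

/-! ### Tightness of the bound -/

/-- The weighted sum of the absolute values of the symmetric Chebyshev coefficients. -/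
def ChebVec.wsum (w : ℤ → ℝ) (u : ChebVec) : ℝ :=
  ∑ n ∈ Finset.Icc (-(u.deg : ℤ)) u.deg, w n * |u.seq n|

lemma ChebVec.wsum_eq {u : ChebVec} (hu : u.WF) (w : ℤ → ℝ) {d : ℕ} (hd : u.deg ≤ d) :
    u.wsum w = ∑ n ∈ Finset.Icc (-(d : ℤ)) d, w n * |u.seq n| := by
  refine Finset.sum_subset (Finset.Icc_subset_Icc (by omega) (by omega)) fun n _ hn => ?_
  rw [Finset.mem_Icc] at hn
  rw [seq, hu _ (by omega)]
  simp

lemma ChebVec.wsum_one (u : ChebVec) : u.wsum (fun _ => 1) = u.boundC.val := by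
  simp only [u.boundC_val, wsum, one_mul]

lemma ChebVec.wsum_nonneg (u : ChebVec) {w : ℤ → ℝ} (hw : ∀ n, 0 ≤ w n) : 0 ≤ u.wsum w :=
  Finset.sum_nonneg fun n _ => mul_nonneg (hw n) (abs_nonneg _)

lemma ChebVec.wnorm_ofReal {u : ChebVec} (hu : u.WF) {w : ℤ → ℝ} (hw : ∀ n, 0 ≤ w n) :
    wnorm (fun n => ENNReal.ofReal (w n)) u.seq = ENNReal.ofReal (u.wsum w) := by
  rw [wnorm_eq_sum hu le_rfl, wsum,
    ENNReal.ofReal_sum_of_nonneg fun n _ => mul_nonneg (hw n) (abs_nonneg _)]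
  refine Finset.sum_congr rfl fun n _ => ?_
  rw [ENNReal.ofReal_mul (hw n), Real.enorm_eq_ofReal_abs]

/-- The absolute value of a coefficient is at most the uniform norm. -/
lemma ChebVec.abs_seq_le {u : ChebVec} (hu : u.WF) {S : ℝ}
    (hS : ∀ x ∈ Set.Icc (-1 : ℝ) 1, |aeval x u.toPoly| ≤ S) (n : ℤ) : |u.seq n| ≤ S := by
  have hS0 : 0 ≤ S := (abs_nonneg _).trans (hS 0 (by norm_num))
  by_cases hn : n ∈ Finset.Icc (-(u.deg : ℤ)) u.deg
  · refine abs_le_of_sq_le_sq ?_ hS0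
    exact (Finset.single_le_sum (f := fun n : ℤ => (u.coeff n.natAbs : ℝ) ^ 2)
      (fun _ _ => sq_nonneg _) hn).trans (u.sum_sq_le hS)
  · rw [Finset.mem_Icc] at hn
    rw [seq, hu _ (by omega)]
    simpa using hS0

/-- The sum of the absolute values of the coefficients, split into low and high order terms. -/
lemma ChebVec.boundC_le {u : ChebVec} {S τ : ℝ} {N : ℕ}
    (hS : ∀ x ∈ Set.Icc (-1 : ℝ) 1, |aeval x u.toPoly| ≤ S)
    (hτ : ∑ n ∈ Finset.Icc (-(u.deg : ℤ)) u.deg \ Finset.Icc (-(N : ℤ)) N, |u.seq n| ≤ τ) :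
    (u.boundC.val : ℝ) ≤ Real.sqrt (2 * N + 1) * S + τ := by
  have hS0 : 0 ≤ S := (abs_nonneg _).trans (hS 0 (by norm_num))
  rw [u.boundC_val, ← Finset.sum_inter_add_sum_sdiff _ (Finset.Icc (-(N : ℤ)) N)]
  refine add_le_add ?_ hτ
  set B := Finset.Icc (-(u.deg : ℤ)) u.deg ∩ Finset.Icc (-(N : ℤ)) N with hB
  have h1 : ∑ n ∈ B, |u.seq n| ^ 2 ≤ S ^ 2 := by
    refine le_trans ?_ (u.sum_sq_le hS)
    refine le_trans (Finset.sum_le_sum_of_subset_of_nonneg Finset.inter_subset_left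
      fun _ _ _ => sq_nonneg _) (le_of_eq ?_)
    exact Finset.sum_congr rfl fun n _ => sq_abs _
  have h2 : (B.card : ℝ) ≤ 2 * N + 1 := by
    have : B.card ≤ 2 * N + 1 := by
      refine (Finset.card_le_card Finset.inter_subset_right).trans ?_
      rw [Int.card_Icc]
      omega
    exact_mod_cast this
  -- Cauchy–Schwarz on at most `2N + 1` indices, to be combined with Bessel's inequality.
  have h3 := sq_sum_le_card_mul_sum_sq (s := B) (f := fun n => |u.seq n|)
  have h4 : (∑ n ∈ B, |u.seq n|) ^ 2 ≤ (Real.sqrt (2 * N + 1) * S) ^ 2 := by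
    rw [mul_pow, Real.sq_sqrt (by positivity)]
    exact h3.trans (mul_le_mul h2 h1 (Finset.sum_nonneg fun _ _ => sq_nonneg _) (by positivity))
  exact (le_abs_self _).trans (abs_le_of_sq_le_sq h4 (by positivity))

namespace Preparation

variable {L : DiffOp} (P : Preparation L)

/-- The weighted norms of the iterates, for real weights. -/
lemma exists_wsum_iterC : ∃ Θ : ℝ, 1 < Θ ∧ ∀ k : ℕ, ∃ C : ℝ, 0 ≤ C ∧ ∀ (w : ℤ → ℝ) (Λ : ℝ),
    (∀ n, 0 ≤ w n) → (∀ n, w n ≤ Λ) → (∀ n k, w (n + k) ≤ Θ ^ k.natAbs * w n) →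
    (∀ n, w 0 ≤ w n) → ∀ (g p : ChebVec), g.WF → p.WF → ∀ ε : ℚ, 0 < ε →
      (P.iterC g p ε k).val.wsum w ≤ C * (g.wsum w + p.wsum w + Λ * ε) := by
  obtain ⟨Θ, hΘ, hE⟩ := P.expansion.exists_wnorm_invSeq P.noZero.ne_zero
  have hΘ0 : 0 ≤ Θ := by linarith
  refine ⟨Θ, hΘ, fun k => ?_⟩
  obtain ⟨C, hC, h⟩ := P.exists_wnorm_iterC P.noZero ENNReal.ofReal_ne_top hE k
  refine ⟨C.toReal, ENNReal.toReal_nonneg, fun w Λ hw hΛ hshift hzero g p hg hp ε hε => ?_⟩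
  have hΛ0 : 0 ≤ Λ := (hw 0).trans (hΛ 0)
  have hεR : (0 : ℝ) < ε := by exact_mod_cast hε
  have h1 := h (fun n => ENNReal.ofReal (w n)) (ENNReal.ofReal Λ)
    ⟨fun n k => by
      rw [← ENNReal.ofReal_pow hΘ0, ← ENNReal.ofReal_mul (by positivity)]
      exact ENNReal.ofReal_le_ofReal (hshift n k), fun n => ENNReal.ofReal_le_ofReal (hzero n)⟩
    (fun n => ENNReal.ofReal_le_ofReal (hΛ n)) g p hg hp ε hε
  have hg0 := g.wsum_nonneg hw
  have hp0 := p.wsum_nonneg hw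
  rw [ChebVec.wnorm_ofReal (P.iterC_wf g hp ε k) hw, ChebVec.wnorm_ofReal hg hw,
    ChebVec.wnorm_ofReal hp hw, ← ENNReal.ofReal_mul hΛ0, ← ENNReal.ofReal_add hg0 hp0,
    ← ENNReal.ofReal_add (by positivity) (by positivity), ← ENNReal.ofReal_toReal hC,
    ← ENNReal.ofReal_mul ENNReal.toReal_nonneg] at h1
  exact (ENNReal.ofReal_le_ofReal_iff (by positivity)).1 h1

/-- A bound for the weighted coefficients of `g`. -/
lemma exists_wsum_gC (Θ R : ℝ) (hΘ : 1 ≤ Θ) : ∃ G : ℝ, 0 ≤ G ∧ ∀ ell : Fin L.order → ℚ,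
    (∀ j, |(ell j : ℝ)| ≤ R) → ∀ w : ℤ → ℝ, (∀ n, w n ≤ Θ ^ n.natAbs) →
      (P.gC ell).val.wsum w ≤ G := by
  refine ⟨∑ n ∈ Finset.Icc (-(L.order : ℤ)) L.order, Θ ^ n.natAbs * ∑ j : Fin L.order,
    |R| * |((ChebVec.ofPoly (initPoly L.order P.α j)).coeff n.natAbs : ℝ)|,
    Finset.sum_nonneg fun n _ => by positivity, fun ell hell w hw => ?_⟩
  rw [ChebVec.wsum, P.gC_deg]
  refine Finset.sum_le_sum fun n _ => mul_le_mul (hw n) ?_ (abs_nonneg _) (by positivity)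
  rw [ChebVec.seq, P.gC_coeff]
  push_cast
  refine (Finset.abs_sum_le_sum_abs _ _).trans (Finset.sum_le_sum fun j _ => ?_)
  rw [abs_mul]
  exact mul_le_mul_of_nonneg_right ((hell j).trans (le_abs_self R)) (abs_nonneg _)

lemma exists_abs_inv_le : ∃ a : ℝ, 0 ≤ a ∧
    ∀ x ∈ Set.Icc (-1 : ℝ) 1, |(aeval x (P.α L.order))⁻¹| ≤ a := by
  have h : ContinuousOn (fun x : ℝ => (aeval x (P.α L.order))⁻¹) (Set.Icc (-1) 1) :=
    (Polynomial.continuous_aeval _).continuousOn.inv₀ P.noZero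
  exact ⟨_, supNorm_nonneg _, fun x hx => le_supNorm h hx⟩

/-- The solutions with initial values at most `R` are uniformly bounded. -/
lemma exists_abs_solution_le {L : DiffOp} (P : Preparation L) (R : ℝ) : ∃ Z : ℝ, 0 ≤ Z ∧ ∀ (ell : Fin L.order → ℚ) (y : ℝ → ℝ),
    IsSolution L ell y → (∀ j, |(ell j : ℝ)| ≤ R) → ∀ x ∈ Set.Icc (-1 : ℝ) 1, |y x| ≤ Z := by
  obtain ⟨a, ha, hinv⟩ := P.exists_abs_inv_le
  obtain ⟨G, hG, hg⟩ := P.exists_wsum_gC 1 R le_rfl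
  have hγ := one_le_gamma P.kernelBound.nonneg (le_refl 1)
  refine ⟨gamma P.A 1 * (a * G + Real.exp P.A * 0), by positivity, fun ell y hy hell x hx => ?_⟩
  -- The bootstrap with `i = 1` and `ε = 0` serves as a Gronwall inequality: `D 0 = y`, `D 1 = ∫ κ
  -- y`, and their difference is `g / α_r`.
  set D : ℕ → ℝ → ℝ := fun k x => if k = 0 then y x else ∫ t in (0 : ℝ)..x, P.fixKernel x t * y t
    with hD
  refine P.kernelBound.abs_le_gamma (D := D) le_rfl le_rfl ?_
    (fun x hx => le_supNorm (continuousOn_of_isSolution hy) hx) (fun x hx => ?_) hx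
  · intro k hk x hx
    obtain rfl : k = 0 := by omega
    simp [hD]
  · have h1 := P.solution_eq hy hx
    have h2 : D 0 x - D 1 x
        = (aeval x (P.α L.order))⁻¹ * aeval x (P.gC ell).val.toPoly := by
      simp only [hD, if_true, one_ne_zero, if_false]
      rw [sub_eq_iff_eq_add]
      exact h1
    rw [h2, abs_mul]
    refine mul_le_mul (hinv x hx) ?_ (abs_nonneg _) ha
    refine ((P.gC ell).val.abs_aeval_le hx).trans ?_
    rw [← ChebVec.wsum_one]
    exact hg ell hell _ fun n => by simp

/-- The iterates stay close to the solution if the initial approximation is. -/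
lemma abs_iterC_sub_le {ell : Fin L.order → ℚ} {y : ℝ → ℝ} (hy : IsSolution L ell y)
    {p : ChebVec} (hp : p.WF) {ε : ℚ} (hε : 0 < ε) (k : ℕ) {x : ℝ}
    (hx : x ∈ Set.Icc (-1 : ℝ) 1) :
    |y x - aeval x (P.iterC (P.gC ell).val p ε k).val.toPoly|
      ≤ Real.exp P.A * ε + (P.A : ℝ) ^ k * supNorm (fun x => y x - aeval x p.toPoly) := by
  set η := supNorm (fun x => y x - aeval x p.toPoly) with hη
  have hη0 : 0 ≤ η := supNorm_nonneg _
  have hA := P.kernelBound.nonneg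
  have h := P.kernelBound.iterate_bound (i := k) (ε := ε)
    (D := fun k x => y x - aeval x (P.iterC (P.gC ell).val p ε k).val.toPoly)
    (fun k _ x hx => P.iterC_error hy hp hε k hx) {0} (fun _ => η) (fun _ => 0)
    (fun x hx => by
      have h : |y x - aeval x p.toPoly| ≤ η := le_supNorm (continuousOn_error hy p.toPoly) hx
      simp only [Finset.sum_singleton, pow_zero, Nat.factorial_zero, Nat.cast_one, div_one, mul_one]
      exact h) k le_rfl x hx
  refine h.trans (add_le_add (sum_exp_le hA (by exact_mod_cast hε.le) (abs_nonneg x)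
    (abs_le.2 hx) k) ?_)
  rw [Finset.sum_singleton]
  refine mul_le_of_le_one_right (by positivity) ?_
  refine div_le_one_of_le₀ ?_ (by positivity)
  exact (pow_le_one₀ (abs_nonneg x) (abs_le.2 hx)).trans
    (by exact_mod_cast Nat.succ_le_of_lt (Nat.factorial_pos _))

end Preparation

/-- A weight equal to `1` for `|n| ≤ d`, then growing geometrically until it reaches `Θ ^ m`. -/
def stepWeight (Θ : ℝ) (d m : ℕ) (n : ℤ) : ℝ := Θ ^ min (n.natAbs - d) m

/-- The exponent is a 1-Lipschitz function of `n`: truncating it at `0` and capping it at `m`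
preserve this. -/
lemma stepWeight_shift {Θ : ℝ} (hΘ : 1 ≤ Θ) (d m : ℕ) (n k : ℤ) :
    stepWeight Θ d m (n + k) ≤ Θ ^ k.natAbs * stepWeight Θ d m n := by
  rw [stepWeight, stepWeight, ← pow_add]
  refine pow_le_pow_right₀ hΘ ?_
  omega

/-- The restriction `ε ≤ 1/2` keeps `log ε⁻¹` away from `0`, so additive constants can be absorbed
into `d + log ε⁻¹`. -/
lemma log_inv_bounds {ε : ℝ} (h0 : 0 < ε) (h1 : ε ≤ 1 / 2) :
    1 / 2 ≤ Real.log ε⁻¹ ∧ Real.log (1 + 1 / ε) ≤ 2 * Real.log ε⁻¹ := by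
  have h2 : 2 ≤ ε⁻¹ := by
    rw [le_inv_comm₀ (by norm_num) h0]
    simpa using h1
  constructor
  · have := Real.log_two_gt_d9
    have := Real.log_le_log (by norm_num) h2
    linarith
  · rw [← Nat.cast_ofNat, ← Real.log_pow, one_div]
    exact Real.log_le_log (by positivity) (by nlinarith)

namespace Preparation

variable {L : DiffOp} (P : Preparation L)

lemma sqrt_le_sqrt_mul_sqrt {T d m X : ℝ} (hX : 1 / 2 ≤ X) (hd : d ≤ X)
    (hm : m ≤ T * (6 * X)) :
    Real.sqrt (2 * (d + m) + 1) ≤ Real.sqrt (10 + 12 * T) * Real.sqrt X := by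
  rw [← Real.sqrt_mul' _ (by linarith)]
  refine Real.sqrt_le_sqrt ?_
  linarith

/-- The bound returned by the algorithm is tight up to a factor `O((d + log ε⁻¹) ^ (1 / 2))`. -/
lemma exists_validate_le (R : ℝ) : ∃ K : ℝ, 0 ≤ K ∧
    ∀ (ell : Fin L.order → ℚ) (y : ℝ → ℝ), IsSolution L ell y → (∀ j, |(ell j : ℝ)| ≤ R) →
    ∀ p : ChebVec, p.WF → ∀ ε : ℚ, 0 < ε → ε ≤ 1 / 2 →
      (P.validate ell p ε).val ≤ K * ((supNorm (fun x => y x - aeval x p.toPoly) + ε)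
        * Real.sqrt (p.deg + Real.log (ε : ℝ)⁻¹)) := by
  obtain ⟨Θ, hΘ, hiter⟩ := P.exists_wsum_iterC
  obtain ⟨C, hC, hiter⟩ := hiter P.i
  obtain ⟨G, hG, hg⟩ := P.exists_wsum_gC Θ R hΘ.le
  obtain ⟨Z, hZ, hsol⟩ := P.exists_abs_solution_le R
  obtain ⟨T, hT, hpow⟩ := exists_mul_pow_le_one (θ := Θ⁻¹) (by positivity) (inv_lt_one_of_one_lt₀ hΘ)
  have hA := P.kernelBound.nonneg
  have hγ := one_le_gamma hA P.one_le_i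
  set a₁ : ℝ := Real.exp P.A + (P.A : ℝ) ^ P.i + 1 with ha₁
  set a₂ : ℝ := C * (G + Z + 2) with ha₂
  set a₃ : ℝ := 10 + 12 * T
  have ha₁0 : 0 ≤ a₁ := by positivity
  have ha₂0 : 0 ≤ a₂ := by positivity
  have ha₃0 : 0 ≤ a₃ := by positivity
  refine ⟨gamma P.A P.i * (Real.sqrt a₃ * a₁ + 2 * (a₂ + Real.exp P.A)), by positivity,
    fun ell y hy hell p hp ε hε hε2 => ?_⟩
  set η := supNorm (fun x => y x - aeval x p.toPoly) with hη
  have hη0 : 0 ≤ η := supNorm_nonneg _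
  have hεR : (0 : ℝ) < ε := by exact_mod_cast hε
  have hεR2 : (ε : ℝ) ≤ 1 / 2 := by
    have := (Rat.cast_le (K := ℝ)).2 hε2
    push_cast at this
    exact this
  obtain ⟨hl1, hl2⟩ := log_inv_bounds hεR hεR2
  set d := p.deg with hd
  set X : ℝ := d + Real.log (ε : ℝ)⁻¹ with hX
  have hd0 : (0 : ℝ) ≤ d := by positivity
  have hX1 : 1 / 2 ≤ X := by linarith
  set s := Real.sqrt X with hs
  have hs1 : 1 ≤ 2 * s := by
    have : Real.sqrt (1 / 4) ≤ s := Real.sqrt_le_sqrt (by linarith)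
    rw [show (1 / 4 : ℝ) = (1 / 2) ^ 2 by norm_num, Real.sqrt_sq (by norm_num)] at this
    linarith
  have hs0 : 0 ≤ s := Real.sqrt_nonneg _
  -- The cap satisfies `Θ^m ε ≥ 2d + 1`. Dividing by `Θ^m` then makes the contributions of `g` and
  -- of the `2d + 1` coefficients of `p` at most constants times `η + ε`, while `m` stays `O(d + log
  -- ε⁻¹)`.
  obtain ⟨m, hm, hm'⟩ := hpow ((2 * d + 1) * (1 / ε)) (by positivity)
  set pi := (P.iterC (P.gC ell).val p ε P.i).val with hpi
  have hpiwf : pi.WF := P.iterC_wf _ hp ε _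
  set v := (p.subC pi).val with hv
  set w := stepWeight Θ d m with hw
  have hΛpos : 0 < Θ ^ m := by positivity
  have hΛ : (2 * d + 1) ≤ Θ ^ m * ε := by
    rw [inv_pow, ← div_eq_mul_inv, div_le_one hΛpos, mul_one_div, div_le_iff₀ hεR] at hm
    exact hm
  -- uniform bound for the difference
  have hS : ∀ x ∈ Set.Icc (-1 : ℝ) 1, |aeval x v.toPoly| ≤ a₁ * (η + ε) := by
    intro x hx
    have h1 := P.abs_iterC_sub_le hy hp hε P.i hx
    have h2 : |y x - aeval x p.toPoly| ≤ η := le_supNorm (continuousOn_error hy p.toPoly) hx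
    rw [ChebVec.subC_toPoly hp hpiwf, map_sub]
    have h3 : aeval x p.toPoly - aeval x pi.toPoly
        = (y x - aeval x pi.toPoly) - (y x - aeval x p.toPoly) := by ring
    rw [h3]
    refine (abs_sub _ _).trans ((add_le_add h1 h2).trans ?_)
    rw [← hη]
    have e1 : 0 ≤ Real.exp P.A * η := by positivity
    have e2 : 0 ≤ (P.A : ℝ) ^ P.i * ε := by positivity
    rw [ha₁]
    linarith
  -- high order coefficients
  have hpS : p.wsum w ≤ (2 * d + 1) * (η + Z) := by
    have h1 : ∀ x ∈ Set.Icc (-1 : ℝ) 1, |aeval x p.toPoly| ≤ η + Z := by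
      intro x hx
      have h2 : |y x - aeval x p.toPoly| ≤ η := le_supNorm (continuousOn_error hy p.toPoly) hx
      have h3 := hsol ell y hy hell x hx
      have h4 : aeval x p.toPoly = y x - (y x - aeval x p.toPoly) := by ring
      rw [h4]
      refine (abs_sub _ _).trans ?_
      linarith
    rw [ChebVec.wsum]
    refine (Finset.sum_le_sum (g := fun _ => η + Z) fun n hn => ?_).trans_eq ?_
    · have h5 : w n = 1 := by
        rw [Finset.mem_Icc] at hn
        rw [hw, stepWeight, show n.natAbs - d = 0 by omega]
        simp
      rw [h5, one_mul]
      exact ChebVec.abs_seq_le hp h1 n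
    · rw [Finset.sum_const, Int.card_Icc, nsmul_eq_mul,
        show ((p.deg : ℤ) + 1 - -(p.deg : ℤ)).toNat = 2 * d + 1 by omega]
      push_cast
      rfl
  have hgS : (P.gC ell).val.wsum w ≤ G :=
    hg ell hell w fun n => pow_le_pow_right₀ hΘ.le (by omega)
  have hwsum := hiter w (Θ ^ m) (fun n => by rw [hw, stepWeight]; positivity)
    (fun n => pow_le_pow_right₀ hΘ.le (min_le_right _ _)) (stepWeight_shift hΘ.le d m)
    (fun n => pow_le_pow_right₀ hΘ.le (by simp)) _ p (P.gC_wf ell) hp ε hε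
  -- Beyond `d + m` the weight has reached its cap and `p` has no coefficients, so the tail of `p -
  -- p_i` is that of `p_i`, at most `Θ^{-m}` times its weighted norm.
  have htail : ∑ n ∈ Finset.Icc (-(v.deg : ℤ)) v.deg \ Finset.Icc (-((d + m : ℕ) : ℤ)) (d + m : ℕ),
      |v.seq n| ≤ a₂ * (η + ε) := by
    have h1 : Θ ^ m * ∑ n ∈ Finset.Icc (-(v.deg : ℤ)) v.deg \
        Finset.Icc (-((d + m : ℕ) : ℤ)) (d + m : ℕ), |v.seq n| ≤ pi.wsum w := by
      rw [ChebVec.wsum_eq hpiwf w (le_max_right p.deg pi.deg), Finset.mul_sum]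
      refine le_trans ?_ (Finset.sum_le_sum_of_subset_of_nonneg
        (Finset.sdiff_subset (t := Finset.Icc (-((d + m : ℕ) : ℤ)) (d + m : ℕ)))
        fun n _ _ => mul_nonneg (by rw [hw, stepWeight]; positivity) (abs_nonneg _))
      refine Finset.sum_le_sum fun n hn => ?_
      rw [Finset.mem_sdiff, Finset.mem_Icc, Finset.mem_Icc] at hn
      have h2 : w n = Θ ^ m := by
        rw [hw, stepWeight, min_eq_right]
        omega
      have h3 : |v.seq n| = |pi.seq n| := by
        rw [hv, ChebVec.seq, ChebVec.subC_coeff hp hpiwf, hp n.natAbs (by omega), zero_sub,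
          Rat.cast_neg, abs_neg]
        rfl
      rw [h2, h3]
    have h4 : pi.wsum w ≤ Θ ^ m * (a₂ * (η + ε)) := by
      refine hwsum.trans ?_
      have h5 : (P.gC ell).val.wsum w + p.wsum w + Θ ^ m * ε
          ≤ Θ ^ m * ((G + Z + 2) * (η + ε)) := by
        have q1 : (1 : ℝ) ≤ Θ ^ m * ε := by linarith
        have q2 : G ≤ Θ ^ m * ε * G := le_mul_of_one_le_left hG q1
        have q3 : (2 * d + 1) * (η + Z) ≤ Θ ^ m * ε * (η + Z) :=
          mul_le_mul_of_nonneg_right hΛ (by positivity)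
        have q4 : Θ ^ m * ε * η ≤ Θ ^ m * η := by
          rw [mul_assoc]
          exact mul_le_mul_of_nonneg_left (by nlinarith) hΛpos.le
        have q5 : 0 ≤ Θ ^ m * (G * η) := by positivity
        have q6 : 0 ≤ Θ ^ m * (Z * η) := by positivity
        have q7 : 0 ≤ Θ ^ m * η := by positivity
        have q8 : 0 ≤ Θ ^ m * ε := by positivity
        linarith
      calc _ ≤ C * (Θ ^ m * ((G + Z + 2) * (η + ε))) := mul_le_mul_of_nonneg_left h5 hC
        _ = _ := by rw [ha₂]; ring
    exact le_of_mul_le_mul_left (h1.trans h4) hΛpos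
  have hbound := ChebVec.boundC_le hS htail
  have hsqrt : Real.sqrt (2 * ((d + m : ℕ) : ℝ) + 1) ≤ Real.sqrt a₃ * s := by
    have e1 := log_one_add_mul_le (x := 2 * (d : ℝ) + 1) (y := 1 / (ε : ℝ)) (by positivity)
      (by positivity)
    have e2 : Real.log (1 + (2 * (d : ℝ) + 1)) ≤ 2 * d + 1 := by
      have := Real.log_le_sub_one_of_pos (x := 1 + (2 * (d : ℝ) + 1)) (by positivity)
      linarith
    -- `1 + (2d + 1) + 2 log ε⁻¹ = 2 + 2X ≤ 6X`, because `X ≥ 1/2`.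
    have e3 : (m : ℝ) ≤ T * (6 * X) := by
      refine hm'.trans (mul_le_mul_of_nonneg_left ?_ hT)
      linarith
    push_cast
    exact sqrt_le_sqrt_mul_sqrt hX1 (by linarith) e3
  rw [validate_val]
  have hηε : 0 ≤ η + ε := by positivity
  rw [mul_assoc]
  refine mul_le_mul_of_nonneg_left ?_ (by positivity)
  have f1 : Real.sqrt (2 * ((d + m : ℕ) : ℝ) + 1) * (a₁ * (η + ε))
      ≤ Real.sqrt a₃ * s * (a₁ * (η + ε)) :=
    mul_le_mul_of_nonneg_right hsqrt (by positivity)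
  have f2 : a₂ * (η + ε) ≤ a₂ * (η + ε) * (2 * s) := le_mul_of_one_le_right (by positivity) hs1
  have f3 : Real.exp P.A * ε ≤ Real.exp P.A * (η + ε) * (2 * s) := by
    refine le_trans ?_ (le_mul_of_one_le_right (by positivity) hs1)
    exact mul_le_mul_of_nonneg_left (by linarith) (Real.exp_pos _).le
  calc _ ≤ Real.sqrt a₃ * s * (a₁ * (η + ε)) + a₂ * (η + ε) * (2 * s)
        + Real.exp P.A * (η + ε) * (2 * s) :=
        add_le_add (hbound.trans (add_le_add f1 f2)) f3
    _ = _ := by ring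

end Preparation

/-! ### Operation count -/

/-- The cost of a pass depends on the degree reached so far, so it is uniformly bounded only on
states satisfying the invariant. -/
lemma forLoop_ops_le_of_inv {σ : Type} (Inv : σ → Prop) (n : ℕ) (step : ℕ → σ → Counted σ)
    (s : σ) (c : ℕ∞) (h0 : Inv s) (hs : ∀ t < n, ∀ u, Inv u → Inv (step t u).val)
    (hc : ∀ t < n, ∀ u, Inv u → (step t u).ops ≤ c) : (forLoop n step s).ops ≤ n * c := by
  induction n with
  | zero => simp
  | succ n ih =>
    have h1 : Inv (forLoop n step s).val := forLoop_induct (fun _ => Inv) n step s h0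
      fun t ht u => hs t (by omega) u
    rw [forLoop_succ_ops, Nat.cast_add, Nat.cast_one, add_mul, one_mul]
    exact add_le_add (ih (fun t ht => hs t (by omega)) fun t ht => hc t (by omega))
      (hc n n.lt_succ_self _ h1)

lemma ChebVec.abs_coeff_le_boundC {u : ChebVec} (hu : u.WF) (j : ℕ) :
    |u.coeff j| ≤ u.boundC.val := by
  have h : u.boundC.val = ∑ n ∈ Finset.Icc (-(u.deg : ℤ)) u.deg, |u.coeff n.natAbs| := rfl
  rw [h]
  rcases le_or_gt j u.deg with hj | hj
  · have hmem : (j : ℤ) ∈ Finset.Icc (-(u.deg : ℤ)) u.deg :=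
      Finset.mem_Icc.2 ⟨by omega, by omega⟩
    have h1 := Finset.single_le_sum (f := fun n : ℤ => |u.coeff n.natAbs|)
      (fun _ _ => abs_nonneg _) hmem
    simpa only [Int.natAbs_natCast] using h1
  · rw [hu j hj, abs_zero]
    exact Finset.sum_nonneg fun _ _ => abs_nonneg _

namespace Preparation

variable {L : DiffOp} (P : Preparation L)

/-- A bound for the degrees occurring in the Volterra operator. -/
def volterraDeg : ℕ := ∑ j ∈ Finset.range L.order,
  ((kernelCoeff L.order P.α j).natDegree + j + 1)

lemma le_volterraDeg {j : ℕ} (hj : j < L.order) :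
    (kernelCoeff L.order P.α j).natDegree + j + 1 ≤ P.volterraDeg :=
  Finset.single_le_sum (f := fun j => (kernelCoeff L.order P.α j).natDegree + j + 1)
    (fun _ _ => Nat.zero_le _) (Finset.mem_range.2 hj)

lemma natDegree_X_pow_eq (j : ℕ) : (ChebVec.ofPoly (X ^ j)).deg = j := natDegree_X_pow j

lemma volterraC_deg_le (g p : ChebVec) :
    (P.volterraC g p).val.deg ≤ g.deg + p.deg + P.volterraDeg := by
  refine forLoop_induct (fun _ (u : ChebVec) => u.deg ≤ g.deg + p.deg + P.volterraDeg) _ _ _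
    (by omega) fun j hj u hu => ?_
  simp only [bind_val]
  rw [ChebVec.addC_deg, ChebVec.mulC_deg, ChebVec.intC_deg, ChebVec.mulC_deg, natDegree_X_pow_eq]
  have := P.le_volterraDeg hj
  have e : (ChebVec.ofPoly (kernelCoeff L.order P.α j)).deg
    = (kernelCoeff L.order P.α j).natDegree := rfl
  omega

/-- The constant in the linear bound for the cost of the Volterra operator. -/
def volterraCost : ℕ :=
  L.order * ((P.volterraDeg + 1) * ((2 * P.volterraDeg + 1) * 2) + ((P.volterraDeg + 2) * 5 + 1)
    + (2 * P.volterraDeg + 2) * ((2 * P.volterraDeg + 1) * 2) + (P.volterraDeg + 1))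

lemma volterraC_ops_le (g p : ChebVec) :
    (P.volterraC g p).ops ≤ (P.volterraCost * (g.deg + p.deg + 1) : ℕ) := by
  set e := P.volterraDeg with he
  set Y := g.deg + p.deg + 1 with hY
  rw [volterraCost, mul_assoc, Nat.cast_mul]
  refine forLoop_ops_le_of_inv (fun u : ChebVec => u.deg ≤ g.deg + p.deg + e) _ _ _ _
    (by omega) (fun j hj u hu => ?_) fun j hj u hu => ?_
  · simp only [bind_val]
    rw [ChebVec.addC_deg, ChebVec.mulC_deg, ChebVec.intC_deg, ChebVec.mulC_deg, natDegree_X_pow_eq]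
    have := P.le_volterraDeg hj
    have e : (ChebVec.ofPoly (kernelCoeff L.order P.α j)).deg
      = (kernelCoeff L.order P.α j).natDegree := rfl
    omega
  · have hj' := P.le_volterraDeg hj
    have e1 : (ChebVec.ofPoly (kernelCoeff L.order P.α j)).deg ≤ e := by
      change (kernelCoeff L.order P.α j).natDegree ≤ e
      omega
    have e2 : (ChebVec.ofPoly (X ^ j)).deg ≤ e := by rw [natDegree_X_pow_eq]; omega
    have e3 : (ChebVec.ofPoly (kernelCoeff L.order P.α j)).deg + j + 1 ≤ e := hj'
    simp only [bind_ops]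
    refine (add_le_add (ChebVec.mulC_ops_le _ _) (add_le_add (ChebVec.intC_ops_le _)
      (add_le_add (ChebVec.mulC_ops_le _ _) (ChebVec.addC_ops_le _ _)))).trans ?_
    simp only [ChebVec.mulC_deg, ChebVec.intC_deg, natDegree_X_pow_eq]
    set b := (ChebVec.ofPoly (kernelCoeff L.order P.α j)).deg
    norm_cast
    have a1 : (b + p.deg + 1) * ((2 * b + 1) * 2) ≤ (e + 1) * Y * ((2 * e + 1) * 2) :=
      Nat.mul_le_mul (by nlinarith) (by omega)
    have a2 : (b + p.deg + 2) * 5 + 1 ≤ ((e + 2) * 5 + 1) * Y := by nlinarith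
    have a3 : (j + (b + p.deg + 1) + 1) * ((2 * j + 1) * 2)
        ≤ (2 * e + 2) * Y * ((2 * e + 1) * 2) :=
      Nat.mul_le_mul (by nlinarith) (by omega)
    have a4 : max u.deg (j + (b + p.deg + 1)) + 1 ≤ (e + 1) * Y := by
      have : max u.deg (j + (b + p.deg + 1)) + 1 ≤ g.deg + p.deg + e + 1 := by omega
      nlinarith
    calc _ ≤ (e + 1) * Y * ((2 * e + 1) * 2) + (((e + 2) * 5 + 1) * Y
          + ((2 * e + 2) * Y * ((2 * e + 1) * 2) + (e + 1) * Y)) :=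
          add_le_add a1 (add_le_add a2 (add_le_add a3 a4))
      _ = _ := by ring

/-- A bound for the coefficients of the result of the Volterra operator. -/
lemma exists_boundC_volterraC : ∃ V : ℝ, 0 ≤ V ∧ ∀ g p : ChebVec, g.WF → p.WF →
    ((P.volterraC g p).val.boundC.val : ℝ) ≤ g.boundC.val + V * p.boundC.val := by
  refine ⟨(P.volterraConst 1).toReal, ENNReal.toReal_nonneg, fun g p hg hp => ?_⟩
  have hw : ∀ n : ℤ, (0 : ℝ) ≤ (fun _ => 1 : ℤ → ℝ) n := fun _ => zero_le_one
  have h := P.wnorm_volterraC_le (Θ := 1) (ω := fun _ => ENNReal.ofReal 1)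
    ⟨fun n k => by simp, fun n => le_rfl⟩ hg hp
  rw [ChebVec.wnorm_ofReal (P.volterraC_wf hg p) hw, ChebVec.wnorm_ofReal hg hw,
    ChebVec.wnorm_ofReal hp hw, ChebVec.wsum_one, ChebVec.wsum_one, ChebVec.wsum_one,
    ← ENNReal.ofReal_toReal (P.volterraConst_ne_top ENNReal.one_ne_top),
    ← ENNReal.ofReal_mul ENNReal.toReal_nonneg,
    ← ENNReal.ofReal_add (boundC_nonneg _) (mul_nonneg ENNReal.toReal_nonneg (boundC_nonneg _))] at h
  exact (ENNReal.ofReal_le_ofReal_iff (add_nonneg (boundC_nonneg _)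
    (mul_nonneg ENNReal.toReal_nonneg (boundC_nonneg _)))).1 h

/-- The size of the input of the iteration. -/
def inputSize (g p : ChebVec) (ε : ℚ) : ℝ :=
  g.deg + p.deg + 1 + Real.log (1 + ((g.boundC.val : ℝ) + p.boundC.val + ε))
    + Real.log (1 + 1 / (ε : ℝ))

lemma log_one_add_le_inputSize (g p : ChebVec) {ε : ℚ} (hε : 0 < ε) :
    0 ≤ Real.log (1 + ((g.boundC.val : ℝ) + p.boundC.val + ε)) ∧
    0 ≤ Real.log (1 + 1 / (ε : ℝ)) := by
  have hεR : (0 : ℝ) < ε := by exact_mod_cast hε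
  have h1 := boundC_nonneg g
  have h2 := boundC_nonneg p
  exact ⟨Real.log_nonneg (by linarith),
    Real.log_nonneg (by have : (0 : ℝ) < 1 / ε := by positivity
                        linarith)⟩

/-- The cost of the iteration is linear in the size of its input. -/
lemma exists_iterC_cost (k : ℕ) : ∃ c : ℝ, 0 ≤ c ∧ ∀ (g p : ChebVec), g.WF → p.WF →
    ∀ ε : ℚ, 0 < ε → ∃ N : ℕ, (P.iterC g p ε k).ops ≤ N ∧ (P.iterC g p ε k).val.deg ≤ N ∧
      (N : ℝ) ≤ c * inputSize g p ε := by
  obtain ⟨Θ, hΘ, hiter⟩ := P.exists_wsum_iterC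
  obtain ⟨V, hV, hvol⟩ := P.exists_boundC_volterraC
  obtain ⟨CE, hCE, hexp⟩ := P.expansion.exists_expandC_cost P.noZero.ne_zero
  induction k with
  | zero =>
    refine ⟨1, zero_le_one, fun g p _ _ ε hε => ⟨p.deg, ?_, le_rfl, ?_⟩⟩
    · exact zero_le
    · obtain ⟨h1, h2⟩ := log_one_add_le_inputSize g p hε
      have : (0 : ℝ) ≤ g.deg := by positivity
      rw [inputSize]
      linarith
  | succ k ih =>
    obtain ⟨c, hc, ih⟩ := ih
    obtain ⟨C, hC, hnorm⟩ := hiter k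
    set lV := Real.log (1 + (1 + V * C)) with hlV
    have hlV0 : 0 ≤ lV := Real.log_nonneg (by nlinarith [mul_nonneg hV hC])
    refine ⟨c + P.volterraCost * (1 + c) + CE * (3 + c + P.volterraDeg + lV), by positivity,
      fun g p hg hp ε hε => ?_⟩
    obtain ⟨N, hN, hNdeg, hNle⟩ := ih g p hg hp ε hε
    set u := (P.iterC g p ε k).val with hu
    have huwf : u.WF := P.iterC_wf g hp ε k
    set q := (P.volterraC g u).val with hq
    have hqwf : q.WF := P.volterraC_wf hg u
    -- The expansion cost involves the logarithm of the coefficients of its argument. Their sum is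
    -- used as the bound `M`, and it is controlled by the norm estimate for the constant weight `1`;
    -- each pass thus enlarges the size by a constant factor only.
    obtain ⟨N', hN', hNdeg', hNle', -⟩ := hexp q hqwf q.boundC.val
      (ChebVec.abs_coeff_le_boundC hqwf) ε hε
    have hεR : (0 : ℝ) < ε := by exact_mod_cast hε
    have hg0 := boundC_nonneg g
    have hp0 := boundC_nonneg p
    have hb : (u.boundC.val : ℝ) ≤ C * (g.boundC.val + p.boundC.val + ε) := by
      have := hnorm (fun _ => 1) 1 (fun _ => zero_le_one) (fun _ => le_rfl)
        (fun n k => by simpa using one_le_pow₀ hΘ.le) (fun _ => le_rfl) g p hg hp ε hε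
      simpa only [ChebVec.wsum_one, one_mul] using this
    have hqb : (q.boundC.val : ℝ) ≤ (1 + V * C) * (g.boundC.val + p.boundC.val + ε) := by
      refine (hvol g u hg huwf).trans ?_
      have := mul_le_mul_of_nonneg_left hb hV
      linarith
    obtain ⟨l1, l2⟩ := log_one_add_le_inputSize g p hε
    set S : ℝ := g.boundC.val + p.boundC.val + ε with hS
    have hlq : Real.log (1 + (q.boundC.val : ℝ)) ≤ lV + Real.log (1 + S) := by
      refine (Real.log_le_log (by linarith [boundC_nonneg q]) (add_le_add le_rfl hqb)).trans ?_
      exact log_one_add_mul_le (by positivity) (by positivity)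
    have hqdeg : (q.deg : ℝ) ≤ g.deg + N + P.volterraDeg := by
      have : q.deg ≤ g.deg + N + P.volterraDeg := (P.volterraC_deg_le g u).trans (by omega)
      exact_mod_cast this
    set H := inputSize g p ε with hH
    have hgd : (0 : ℝ) ≤ g.deg := by positivity
    have hpd : (0 : ℝ) ≤ p.deg := by positivity
    have hHdef : H = g.deg + p.deg + 1 + Real.log (1 + S) + Real.log (1 + 1 / (ε : ℝ)) := rfl
    have hH1 : 1 ≤ H := by linarith
    have hgH : (g.deg : ℝ) + 1 ≤ H := by linarith
    refine ⟨N + (P.volterraCost * (g.deg + N + 1) + N'), ?_, hNdeg'.trans (by omega), ?_⟩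
    · have e : (P.iterC g p ε (k + 1)).ops = (P.iterC g p ε k).ops
        + ((P.volterraC g u).ops + (P.expansion.expandC q ε).ops) := rfl
      rw [e, Nat.cast_add, Nat.cast_add]
      refine add_le_add hN (add_le_add ((P.volterraC_ops_le g u).trans ?_) hN')
      norm_cast
      gcongr
    · push_cast
      have f1 : (P.volterraCost : ℝ) * (g.deg + N + 1) ≤ P.volterraCost * ((1 + c) * H) :=
        mul_le_mul_of_nonneg_left (by linarith) (by positivity)
      have f2 : (N' : ℝ) ≤ CE * ((3 + c + P.volterraDeg + lV) * H) := by
        refine hNle'.trans (mul_le_mul_of_nonneg_left ?_ hCE)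
        have g1 : (P.volterraDeg : ℝ) ≤ P.volterraDeg * H := le_mul_of_one_le_right (by positivity) hH1
        have g2 : lV ≤ lV * H := le_mul_of_one_le_right hlV0 hH1
        linarith
      linarith

lemma gC_ops_le (ell : Fin L.order → ℚ) :
    (P.gC ell).ops ≤ ((L.order + 1) * (L.order * 2) : ℕ) := by
  refine (ChebVec.buildC_ops_le _ _ (L.order * 2 : ℕ) fun n _ => ?_).trans_eq (by push_cast; rfl)
  refine (sumC_ops_le _ _ 1 fun _ _ => le_rfl).trans_eq ?_
  rw [Finset.card_univ, Fintype.card_fin]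
  norm_num

lemma exists_validate_cost : ∃ c : ℝ, 0 ≤ c ∧ ∀ (ell : Fin L.order → ℚ) (p : ChebVec), p.WF →
    ∀ ε : ℚ, 0 < ε → ∃ N : ℕ, (P.validate ell p ε).ops = N ∧
      (N : ℝ) ≤ c * inputSize (P.gC ell).val p ε := by
  obtain ⟨c, hc, h⟩ := P.exists_iterC_cost P.i
  refine ⟨P.cost + (L.order + 1) * (L.order * 2) + 6 * c + 11, by positivity,
    fun ell p hp ε hε => ?_⟩
  obtain ⟨N, hN, hdeg, hle⟩ := h _ p (P.gC_wf ell) hp ε hε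
  set u := (P.iterC (P.gC ell).val p ε P.i).val with hu
  have e : (P.validate ell p ε).ops = (P.cost : ℕ∞) + ((P.gC ell).ops +
    ((P.iterC (P.gC ell).val p ε P.i).ops + ((p.subC u).ops + ((p.subC u).val.boundC.ops + 3)))) :=
    rfl
  have hops : (P.validate ell p ε).ops ≤ ((P.cost + ((L.order + 1) * (L.order * 2) + (N +
      ((p.deg + N + 1) + ((2 * (p.deg + N) + 1) * 2 + 3)))) : ℕ) : ℕ∞) := by
    rw [e]
    simp only [Nat.cast_add _ (_ + _), Nat.cast_add (_ * 2) 3]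
    refine add_le_add le_rfl (add_le_add (P.gC_ops_le ell) (add_le_add hN (add_le_add
      ((ChebVec.subC_ops_le p u).trans ?_) (add_le_add
        ((ChebVec.boundC_ops_le _).trans ?_) le_rfl))))
    · norm_cast
      omega
    · rw [ChebVec.subC_deg]
      norm_cast
      have : max p.deg u.deg ≤ p.deg + N := by omega
      omega
  -- A finite majorant excludes the value `⊤` reserved for divergent loops: this is termination.
  obtain ⟨n, hn⟩ := ENat.ne_top_iff_exists.1 (ne_top_of_le_ne_top (ENat.natCast_ne_top _) hops)
  refine ⟨n, hn.symm, ?_⟩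
  rw [← hn] at hops
  have hops' : (n : ℝ) ≤ (P.cost + ((L.order + 1) * (L.order * 2) + (N +
      ((p.deg + N + 1) + ((2 * (p.deg + N) + 1) * 2 + 3)))) : ℕ) := by
    exact_mod_cast hops
  refine hops'.trans ?_
  push_cast
  obtain ⟨l1, l2⟩ := log_one_add_le_inputSize (P.gC ell).val p hε
  set H := inputSize (P.gC ell).val p ε with hH
  have hHdef : H = (P.gC ell).val.deg + p.deg + 1
    + Real.log (1 + (((P.gC ell).val.boundC.val : ℝ) + p.boundC.val + ε))
    + Real.log (1 + 1 / (ε : ℝ)) := rfl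
  have hgd : (0 : ℝ) ≤ (P.gC ell).val.deg := by positivity
  have hpd : (0 : ℝ) ≤ p.deg := by positivity
  have hH1 : 1 ≤ H := by linarith
  have f1 : ((P.cost : ℝ) + (L.order + 1) * (L.order * 2))
      ≤ (P.cost + (L.order + 1) * (L.order * 2)) * H := le_mul_of_one_le_right (by positivity) hH1
  have f2 : (p.deg : ℝ) + 1 ≤ H := by linarith
  linarith

/-- Bounded initial values lead to inputs of size `O(d + log ε⁻¹ + log (1 + ‖y - p‖))`. -/
lemma exists_inputSize_le (R : ℝ) : ∃ c : ℝ, 0 ≤ c ∧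
    ∀ (ell : Fin L.order → ℚ) (y : ℝ → ℝ), IsSolution L ell y → (∀ j, |(ell j : ℝ)| ≤ R) →
    ∀ p : ChebVec, p.WF → ∀ ε : ℚ, 0 < ε → ε ≤ 1 / 2 →
      inputSize (P.gC ell).val p ε ≤ c * (p.deg + Real.log (ε : ℝ)⁻¹
        + Real.log (1 + supNorm (fun x => y x - aeval x p.toPoly))) := by
  obtain ⟨G, hG, hg⟩ := P.exists_wsum_gC 1 R le_rfl
  obtain ⟨Z, hZ, hsol⟩ := P.exists_abs_solution_le R
  set lG := Real.log (1 + (1 + G)) with hlG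
  set lZ := Real.log (1 + Z) with hlZ
  have hlG0 : 0 ≤ lG := Real.log_nonneg (by linarith)
  have hlZ0 : 0 ≤ lZ := Real.log_nonneg (by linarith)
  refine ⟨2 * (L.order + 2 + lG + lZ) + 3, by positivity, fun ell y hy hell p hp ε hε hε2 => ?_⟩
  set η := supNorm (fun x => y x - aeval x p.toPoly) with hη
  have hη0 : 0 ≤ η := supNorm_nonneg _
  have hεR : (0 : ℝ) < ε := by exact_mod_cast hε
  have hεR2 : (ε : ℝ) ≤ 1 / 2 := by
    have := (Rat.cast_le (K := ℝ)).2 hε2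
    push_cast at this
    exact this
  obtain ⟨hl1, hl2⟩ := log_inv_bounds hεR hεR2
  have hlη : 0 ≤ Real.log (1 + η) := Real.log_nonneg (by linarith)
  have hpd : (0 : ℝ) ≤ p.deg := by positivity
  have hgb : ((P.gC ell).val.boundC.val : ℝ) ≤ G := by
    rw [← ChebVec.wsum_one]
    exact hg ell hell _ fun n => by simp
  -- Each coefficient of `p` is at most its uniform norm, hence at most `η + Z`; this brings `log (1
  -- + η)` into the cost.
  have hpb : (p.boundC.val : ℝ) ≤ (2 * p.deg + 1) * (η + Z) := by
    have h1 : ∀ x ∈ Set.Icc (-1 : ℝ) 1, |aeval x p.toPoly| ≤ η + Z := by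
      intro x hx
      have h2 : |y x - aeval x p.toPoly| ≤ η := le_supNorm (continuousOn_error hy p.toPoly) hx
      have h3 := hsol ell y hy hell x hx
      have h4 : aeval x p.toPoly = y x - (y x - aeval x p.toPoly) := by ring
      rw [h4]
      refine (abs_sub _ _).trans ?_
      linarith
    rw [p.boundC_val]
    refine (Finset.sum_le_sum (g := fun _ => η + Z) fun n hn => ChebVec.abs_seq_le hp h1 n).trans_eq ?_
    rw [Finset.sum_const, Int.card_Icc, nsmul_eq_mul,
      show ((p.deg : ℤ) + 1 - -(p.deg : ℤ)).toNat = 2 * p.deg + 1 by omega]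
    push_cast
    rfl
  have hlog : Real.log (1 + (((P.gC ell).val.boundC.val : ℝ) + p.boundC.val + ε))
      ≤ lG + ((2 * p.deg + 1) + (Real.log (1 + η) + lZ)) := by
    have b0 := boundC_nonneg (P.gC ell).val
    have b1 := boundC_nonneg p
    have b2 : 0 ≤ (2 * (p.deg : ℝ) + 1) * (η + Z) := by positivity
    have e1 : Real.log (1 + (((P.gC ell).val.boundC.val : ℝ) + p.boundC.val + ε))
        ≤ Real.log ((1 + (1 + G)) * (1 + (2 * p.deg + 1) * (η + Z))) := by
      refine Real.log_le_log (by linarith) ?_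
      nlinarith [mul_nonneg hG b2]
    rw [Real.log_mul (by positivity) (by positivity)] at e1
    have e2 := log_one_add_mul_le (x := 2 * (p.deg : ℝ) + 1) (y := η + Z) (by positivity)
      (by positivity)
    have e3 : Real.log (1 + (2 * (p.deg : ℝ) + 1)) ≤ 2 * p.deg + 1 := by
      have := Real.log_le_sub_one_of_pos (x := 1 + (2 * (p.deg : ℝ) + 1)) (by positivity)
      linarith
    have e4 : Real.log (1 + (η + Z)) ≤ Real.log (1 + η) + lZ := by
      rw [hlZ, ← Real.log_mul (by positivity) (by positivity)]
      refine Real.log_le_log (by positivity) ?_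
      nlinarith [mul_nonneg hη0 hZ]
    linarith
  rw [inputSize, P.gC_deg]
  set X : ℝ := p.deg + Real.log (ε : ℝ)⁻¹ + Real.log (1 + η) with hX
  have hX1 : 1 ≤ 2 * X := by linarith
  have f1 : (L.order : ℝ) + 2 + lG + lZ ≤ (L.order + 2 + lG + lZ) * (2 * X) :=
    le_mul_of_one_le_right (by positivity) hX1
  have f2 : 3 * (p.deg : ℝ) + 2 * Real.log (ε : ℝ)⁻¹ + Real.log (1 + η) ≤ 3 * X := by linarith
  linarith

end Preparation

/-! ### Existence of the precomputed data -/

/-- The top coefficient must be `a_r`. By Leibniz, subtracting `∂^r a_r` leaves an operator of lower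
order, to which induction applies. -/
lemma exists_adjoint_coeff (r : ℕ) : ∀ a : ℕ → ℚ[X], ∃ α : ℕ → ℚ[X], ∀ f : ℚ[X],
    ∑ i ∈ Finset.range (r + 1), a i * derivative^[i] f
      = ∑ j ∈ Finset.range (r + 1), derivative^[j] (α j * f) := by
  induction r with
  | zero => exact fun a => ⟨a, fun f => by simp⟩
  | succ r ih =>
    intro a
    obtain ⟨α, hα⟩ := ih fun k =>
      a k - ((r + 1).choose k : ℚ[X]) * derivative^[r + 1 - k] (a (r + 1))
    refine ⟨Function.update α (r + 1) (a (r + 1)), fun f => ?_⟩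
    rw [Finset.sum_range_succ, Finset.sum_range_succ (n := r + 1), Function.update_self,
      iterate_derivative_mul, Finset.sum_range_succ (n := r + 1), Nat.choose_self, Nat.sub_self,
      one_smul, Function.iterate_zero_apply, ← add_assoc]
    congr 1
    have h1 : ∑ j ∈ Finset.range (r + 1),
        derivative^[j] (Function.update α (r + 1) (a (r + 1)) j * f)
        = ∑ j ∈ Finset.range (r + 1), derivative^[j] (α j * f) :=
      Finset.sum_congr rfl fun j hj => by
        rw [Function.update_of_ne (by have := Finset.mem_range.1 hj; omega)]
    rw [h1, ← hα f, ← Finset.sum_add_distrib]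
    refine Finset.sum_congr rfl fun k _ => ?_
    rw [nsmul_eq_mul]
    ring

lemma exists_rat_btwn_family {n : ℕ} (c : ℝ) (f : Fin n → ℝ) (h : ∀ k, c < f k) :
    ∃ q : ℚ, c < q ∧ ∀ k, q < f k := by
  have h1 : ∀ᶠ a in nhdsWithin c (Set.Ioi c), ∀ k, a < f k :=
    Filter.eventually_all.2 fun k => nhdsWithin_le_nhds (Iio_mem_nhds (h k))
  obtain ⟨a, ha, hca⟩ := (h1.and self_mem_nhdsWithin).exists
  obtain ⟨q, hq1, hq2⟩ := exists_rat_btwn hca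
  exact ⟨q, hq1, fun k => hq2.trans (ha k)⟩

lemma exists_rat_ge_family {n : ℕ} (f : Fin n → ℝ) : ∃ q : ℚ, ∀ k, f k ≤ q := by
  obtain ⟨M, hM⟩ := (Set.finite_range f).bddAbove
  obtain ⟨q, hq⟩ := exists_rat_gt M
  exact ⟨q, fun k => (hM ⟨k, rfl⟩).trans hq.le⟩

lemma exists_gaussRat_near (w : ℂ) {ε : ℝ} (hε : 0 < ε) :
    ∃ q : GaussRat, ‖q.toComplex - w‖ < ε := by
  obtain ⟨a, ha⟩ := exists_rat_near w.re (half_pos hε)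
  obtain ⟨b, hb⟩ := exists_rat_near w.im (half_pos hε)
  refine ⟨⟨a, b⟩, (Complex.norm_le_abs_re_add_abs_im _).trans_lt ?_⟩
  simp only [GaussRat.toComplex, Complex.sub_re, Complex.sub_im]
  rw [abs_sub_comm] at ha hb
  linarith

/-- The derivative of a Taylor coefficient with respect to the base point. -/
lemma hasDerivAt_taylor_coeff (β : ℂ[X]) (l : ℕ) (z : ℂ) :
    HasDerivAt (fun z => (taylor z β).coeff l) ((l + 1 : ℕ) * (taylor z β).coeff (l + 1)) z := by
  simp only [taylor_coeff]
  have h := (hasseDeriv l β).hasDerivAt z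
  refine h.congr_deriv ?_
  have h2 := congr_arg (fun φ : ℂ[X] →ₗ[ℂ] ℂ[X] => φ β) (hasseDeriv_comp (R := ℂ) 1 l)
  simp only [LinearMap.comp_apply, LinearMap.smul_apply, hasseDeriv_one] at h2
  rw [h2, add_comm 1 l, Nat.choose_one_right, nsmul_eq_mul, eval_mul, eval_natCast]

/-- The properties of a disk around a root that the expansion procedure uses. -/
lemma eventually_near_root {b : ℚ[X]} (hb : b ≠ 0) {ζ : ℂ} (hζ : (liftPoly b).IsRoot ζ)
    (h1 : 1 < ‖ζ‖) {ρ : ℝ} (hρ : ρ < ‖ζ‖) :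
    ∃ slope : GaussRat, ∃ S : ℝ, ∀ᶠ z in nhds ζ,
      ‖1 - slope.toComplex * (((liftPoly b).rootMultiplicity ζ : ℂ)
        * (taylor z (liftPoly b)).coeff ((liftPoly b).rootMultiplicity ζ))‖ ≤ 1 / 2 ∧
      (taylor z (liftPoly b)).coeff ((liftPoly b).rootMultiplicity ζ) ≠ 0 ∧ ρ ≤ ‖z‖ ∧
      ∀ j ∈ Finset.Icc 1 ((liftPoly b).rootMultiplicity ζ), ∀ s ∈ Finset.range b.natDegree,
        ‖deriv (pfNum (liftPoly b) (basisNum b.natDegree s) ((liftPoly b).rootMultiplicity ζ) j) z‖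
          + ‖z⁻¹ * pfNum (liftPoly b) (basisNum b.natDegree s)
            ((liftPoly b).rootMultiplicity ζ) j z‖ ≤ S := by
  set β := liftPoly b with hβdef
  have hβ : β ≠ 0 := liftPoly_ne_zero hb
  set μ := β.rootMultiplicity ζ with hμdef
  have hμ : 0 < μ := (rootMultiplicity_pos hβ).2 hζ
  set c := (taylor ζ β).coeff μ with hcdef
  have hc : c ≠ 0 := taylor_coeff_rootMultiplicity_ne_zero hβ ζ
  have hμC : (μ : ℂ) ≠ 0 := by exact_mod_cast hμ.ne'
  have hd : (μ : ℂ) * c ≠ 0 := mul_ne_zero hμC hc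
  have hζ0 : ζ ≠ 0 := by
    rintro rfl
    rw [norm_zero] at h1
    linarith
  have hcont : ContinuousAt (fun z => (taylor z β).coeff μ) ζ :=
    (analyticAt_taylor_coeff β μ ζ).continuousAt
  -- The Taylor coefficient of order `μ - 1` has a simple zero at `ζ` with derivative `μ c`. The
  -- slope inverts it up to relative error `1/4`, which leaves room for the contraction factor `1/2`
  -- nearby.
  obtain ⟨slope, hslope⟩ := exists_gaussRat_near ((μ : ℂ) * c)⁻¹
    (ε := 1 / (4 * ‖(μ : ℂ) * c‖)) (by positivity)
  set F : ℕ → ℕ → ℂ → ℝ := fun j s z =>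
    ‖deriv (pfNum β (basisNum b.natDegree s) μ j) z‖
      + ‖z⁻¹ * pfNum β (basisNum b.natDegree s) μ j z‖ with hF
  have hFc : ∀ j s, ContinuousAt (F j s) ζ := by
    intro j s
    have ha := analyticAt_pfNum β (basisNum b.natDegree s) μ j hc
    exact ha.deriv.continuousAt.norm.add
      ((continuousAt_id.inv₀ hζ0).mul ha.continuousAt).norm
  have hF0 : ∀ j s, 0 ≤ F j s ζ := fun j s => by positivity
  set S : ℝ := ∑ j ∈ Finset.Icc 1 μ, ∑ s ∈ Finset.range b.natDegree, (F j s ζ + 1) with hS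
  refine ⟨slope, S, ?_⟩
  have e1 : ∀ᶠ z in nhds ζ, ‖1 - slope.toComplex * ((μ : ℂ) * (taylor z β).coeff μ)‖ < 1 / 2 := by
    have : ContinuousAt (fun z => ‖1 - slope.toComplex * ((μ : ℂ) * (taylor z β).coeff μ)‖) ζ :=
      (continuousAt_const.sub (continuousAt_const.mul (continuousAt_const.mul hcont))).norm
    refine this.eventually (gt_mem_nhds ?_)
    have h2 : 1 - slope.toComplex * ((μ : ℂ) * c)
        = -((slope.toComplex - ((μ : ℂ) * c)⁻¹) * ((μ : ℂ) * c)) := by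
      rw [sub_mul, inv_mul_cancel₀ hd]
      ring
    change ‖1 - slope.toComplex * ((μ : ℂ) * c)‖ < 1 / 2
    rw [h2, norm_neg, norm_mul]
    have h3 : 0 < ‖(μ : ℂ) * c‖ := norm_pos_iff.2 hd
    calc _ ≤ 1 / (4 * ‖(μ : ℂ) * c‖) * ‖(μ : ℂ) * c‖ := mul_le_mul_of_nonneg_right hslope.le h3.le
      _ = 1 / 4 := by field_simp
      _ < 1 / 2 := by norm_num
  have e2 : ∀ᶠ z in nhds ζ, (taylor z β).coeff μ ≠ 0 := hcont.eventually_ne hc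
  have e3 : ∀ᶠ z in nhds ζ, ρ < ‖z‖ := continuous_norm.continuousAt.eventually (lt_mem_nhds hρ)
  have e4 : ∀ᶠ z in nhds ζ, ∀ j ∈ Finset.Icc 1 μ, ∀ s ∈ Finset.range b.natDegree,
      F j s z < F j s ζ + 1 :=
    (Filter.eventually_all_finset _).2 fun j _ => (Filter.eventually_all_finset _).2 fun s _ =>
      (hFc j s).eventually (gt_mem_nhds (by linarith))
  filter_upwards [e1, e2, e3, e4] with z h2 h3 h4 h5
  refine ⟨h2.le, h3, h4.le, fun j hj s hs => (h5 j hj s hs).le.trans ?_⟩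
  have hnn : ∀ j, 0 ≤ ∑ s ∈ Finset.range b.natDegree, (F j s ζ + 1) := fun j =>
    Finset.sum_nonneg fun s _ => by linarith [hF0 j s]
  refine le_trans ?_ (Finset.single_le_sum (f := fun j => ∑ s ∈ Finset.range b.natDegree,
    (F j s ζ + 1)) (fun j _ => hnn j) hj)
  exact Finset.single_le_sum (f := fun s => F j s ζ + 1) (fun s _ => by linarith [hF0 j s]) hs

/-- All requirements hold in a neighbourhood of each root, and there are finitely many roots, so one
rational radius serves them all. The halving property is the mean value inequality on a disk, where
the derivative of the iteration map is at most `1/2`. -/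
lemma nonempty_expansionData {b : ℚ[X]} (hb : b ≠ 0) : Nonempty (ExpansionData b) := by
  classical
  set β := liftPoly b with hβdef
  have hβ : β ≠ 0 := liftPoly_ne_zero hb
  set S := β.roots.toFinset.filter (fun z => 1 < ‖z‖) with hS
  set root : Fin S.card → ℂ := fun k => S.equivFin.symm k with hroot
  have hSmem : ∀ z, z ∈ S ↔ β.IsRoot z ∧ 1 < ‖z‖ := fun z => by
    rw [hS, Finset.mem_filter, Multiset.mem_toFinset, mem_roots hβ]
  have hmem : ∀ k, β.IsRoot (root k) ∧ 1 < ‖root k‖ := fun k =>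
    (hSmem _).1 (S.equivFin.symm k).2
  obtain ⟨ρ, hρ1, hρ⟩ := exists_rat_btwn_family 1 (fun k => ‖root k‖) fun k => (hmem k).2
  choose slope B hev using fun k => eventually_near_root hb (hmem k).1 (hmem k).2 (hρ k)
  choose rk hrk0 hrk using fun k => Metric.nhds_basis_closedBall.eventually_iff.1 (hev k)
  obtain ⟨rad, hrad0, hrad⟩ := exists_rat_btwn_family 0 rk hrk0
  obtain ⟨ρ', hρ'⟩ := exists_rat_ge_family fun k => ‖root k‖ + rad
  obtain ⟨B', hB'⟩ := exists_rat_ge_family B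
  choose start hstart using fun k => exists_gaussRat_near (root k) hrad0
  have hball : ∀ k, ∀ z : ℂ, ‖z - root k‖ ≤ rad → z ∈ Metric.closedBall (root k) (rk k) := by
    intro k z hz
    rw [Metric.mem_closedBall, dist_eq_norm]
    exact hz.trans (hrad k).le
  refine ⟨{
    numRoots := S.card
    root := root
    root_injective := fun k l h => S.equivFin.symm.injective (Subtype.ext h)
    mem_range_root := fun z => ⟨fun ⟨k, hk⟩ => hk ▸ hmem k, fun h => ?_⟩
    mult := fun k => β.rootMultiplicity (root k)
    mult_eq := fun k => rfl
    rad := rad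
    rad_pos := by exact_mod_cast hrad0
    start := start
    start_mem := fun k => (hstart k).le
    slope := slope
    newton := fun k z hz => ?_
    coeff_ne_zero := fun k z hz => (hrk k (hball k z hz)).2.1
    rhoLow := ρ
    rhoHigh := ρ'
    one_lt_rhoLow := by exact_mod_cast hρ1
    annulus := fun k z hz => ⟨(hrk k (hball k z hz)).2.2.1, ?_⟩
    pfBound := B'
    pfBound_spec := fun k j hj s hs z hz =>
      ((hrk k (hball k z hz)).2.2.2 j hj s (Finset.mem_range.2 hs)).trans (hB' k) }⟩
  · exact ⟨S.equivFin ⟨z, (hSmem z).2 h⟩, by simp [hroot]⟩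
  · set μ := β.rootMultiplicity (root k) with hμdef
    have hμ : 0 < μ := (rootMultiplicity_pos hβ).2 (hmem k).1
    -- Taylor coefficients below the multiplicity vanish at the root, so the root is a fixed point
    -- of the iteration map.
    have h0 : (taylor (root k) β).coeff (μ - 1) = 0 := by
      rw [taylor_eq_X_pow_mul, coeff_X_pow_mul', if_neg (by omega)]
    set N : ℂ → ℂ := fun z => z - (slope k).toComplex * (taylor z β).coeff (μ - 1) with hN
    have hNroot : N (root k) = root k := by simp only [hN, h0, mul_zero, sub_zero]
    have hderiv : ∀ w, HasDerivAt N (1 - (slope k).toComplex * ((μ : ℂ) * (taylor w β).coeff μ))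
        w := by
      intro w
      have h := hasDerivAt_taylor_coeff β (μ - 1) w
      rw [Nat.sub_add_cancel hμ] at h
      exact (hasDerivAt_id w).sub (h.const_mul _)
    have h := (convex_closedBall (root k) (rk k)).norm_image_sub_le_of_norm_hasDerivWithin_le
      (f := N) (C := 1 / 2) (fun w _ => (hderiv w).hasDerivWithinAt)
      (fun w hw => (hrk k hw).1) (Metric.mem_closedBall_self (hrk0 k).le) (hball k z hz)
    rw [hNroot] at h
    refine h.trans_eq ?_
    ring
  · refine le_trans ?_ (hρ' k)
    have := norm_add_le (root k) (z - root k)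
    rw [add_sub_cancel] at this
    linarith

/-- `A` exists because the kernel divided by `α_r` is continuous on the compact square, and `i`
exists because `A^n / n!` tends to `0`. -/
theorem nonempty_preparation (L : DiffOp) : Nonempty (Preparation L) := by
  obtain ⟨α, hα⟩ := exists_adjoint_coeff L.order L.coeff
  have hno : NoZero (α L.order) := by
    rw [lead_eq_of_operator_eq hα]
    exact L.lead_ne_zero
  obtain ⟨E⟩ := nonempty_expansionData hno.ne_zero
  have hcont : ContinuousOn (fun p : ℝ × ℝ => (aeval p.1 (α L.order))⁻¹ * kernel L.order α p.1 p.2)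
      (Set.Icc (-1 : ℝ) 1 ×ˢ Set.Icc (-1 : ℝ) 1) := by
    refine ContinuousOn.mul (ContinuousOn.inv₀ ?_ fun p hp => hno p.1 hp.1)
      (continuous_kernel _ _).continuousOn
    exact ((Polynomial.continuous_aeval _).comp continuous_fst).continuousOn
  obtain ⟨M, hM⟩ := ((isCompact_Icc.prod isCompact_Icc).image_of_continuousOn hcont.abs).bddAbove
  obtain ⟨A, hA⟩ := exists_rat_gt M
  have hex : {i : ℕ | A ^ i / (i.factorial : ℚ) ≤ 1 / 2}.Nonempty := by
    obtain ⟨n, hn⟩ := ((FloorSemiring.tendsto_pow_div_factorial_atTop (A : ℝ)).eventually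
      (gt_mem_nhds (by norm_num : (0 : ℝ) < 1 / 2))).exists
    refine ⟨n, ?_⟩
    have h : ((A ^ n / (n.factorial : ℚ) : ℚ) : ℝ) ≤ ((1 / 2 : ℚ) : ℝ) := by
      push_cast
      exact hn.le
    exact (Rat.cast_le (K := ℝ)).1 h
  refine ⟨{
    -- No other field constrains `cost`, so any value is a witness.
    cost := 0
    α := α
    α_spec := hα
    A := A
    A_spec := fun x t h => ?_
    i := sInf {i : ℕ | A ^ i / (i.factorial : ℚ) ≤ 1 / 2}
    i_spec := ⟨Nat.sInf_mem hex, fun _ h => Nat.sInf_le h⟩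
    expansion := E }⟩
  refine le_trans (hM ⟨(x, t), ?_, rfl⟩) hA.le
  rcases h with ⟨h1, h2, h3⟩ | ⟨h1, h2, h3⟩
  · exact ⟨⟨by linarith, h3⟩, ⟨by linarith, by linarith⟩⟩
  · exact ⟨⟨h1, by linarith⟩, ⟨by linarith, by linarith⟩⟩

end ChebValid

end

/-! ### The main theorem -/

theorem mainTheorem2 (L : ChebValid.DiffOp) :
    Nonempty (ChebValid.Preparation L) ∧
    ∀ P : ChebValid.Preparation L,
      -- termination and correctness
      (∀ (ell : Fin L.order → ℚ) (y : ℝ → ℝ), ChebValid.IsSolution L ell y →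
        ∀ (d : ℕ) (c : Fin (d + 1) → ℚ) (ε : ℚ), 0 < ε →
          (P.validate ell (ChebValid.ChebVec.ofFin c) ε).ops ≠ ⊤ ∧
          0 < (P.validate ell (ChebValid.ChebVec.ofFin c) ε).val ∧
          ChebValid.supNorm
              (fun x => y x - Polynomial.aeval x (ChebValid.ChebVec.ofFin c).toPoly)
            ≤ (P.validate ell (ChebValid.ChebVec.ofFin c) ε).val) ∧
      -- tightness and complexity
      ∀ R : ℝ, ∃ K : ℝ,
        ∀ (ell : Fin L.order → ℚ) (y : ℝ → ℝ), ChebValid.IsSolution L ell y →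
          (∀ j, |(ell j : ℝ)| ≤ R) →
          ∀ (d : ℕ) (c : Fin (d + 1) → ℚ) (ε : ℚ), 0 < ε → ε ≤ 1 / 2 →
            (P.validate ell (ChebValid.ChebVec.ofFin c) ε).val
              ≤ K * ((ChebValid.supNorm
                    (fun x => y x - Polynomial.aeval x (ChebValid.ChebVec.ofFin c).toPoly) + ε)
                  * Real.sqrt (d + Real.log (ε : ℝ)⁻¹)) ∧
            ∃ N : ℕ, (P.validate ell (ChebValid.ChebVec.ofFin c) ε).ops = N ∧
              (N : ℝ) ≤ K * (d + Real.log (ε : ℝ)⁻¹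
                + Real.log (1 + ChebValid.supNorm
                    (fun x => y x - Polynomial.aeval x (ChebValid.ChebVec.ofFin c).toPoly))) := by
  refine ⟨ChebValid.nonempty_preparation L, fun P => ⟨fun ell y hy d c ε hε => ?_, fun R => ?_⟩⟩
  · have hp := ChebValid.ChebVec.ofFin_wf c
    obtain ⟨_, -, hcost⟩ := P.exists_validate_cost
    obtain ⟨N, hN, -⟩ := hcost ell _ hp ε hε
    refine ⟨?_, P.validate_pos ell _ hε, P.supNorm_le_validate hy hp hε⟩
    rw [hN]
    exact ENat.natCast_ne_top N
  · obtain ⟨K₁, hK₁, htight⟩ := P.exists_validate_le R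
    obtain ⟨K₂, hK₂, hcost⟩ := P.exists_validate_cost
    obtain ⟨K₃, hK₃, hsize⟩ := P.exists_inputSize_le R
    refine ⟨max K₁ (K₂ * K₃), fun ell y hy hell d c ε hε hε2 => ?_⟩
    have hp := ChebValid.ChebVec.ofFin_wf c
    have hεR : (0 : ℝ) < ε := by exact_mod_cast hε
    have hη := ChebValid.supNorm_nonneg
      (fun x => y x - Polynomial.aeval x (ChebValid.ChebVec.ofFin c).toPoly)
    refine ⟨(htight ell y hy hell _ hp ε hε hε2).trans
      (mul_le_mul_of_nonneg_right (le_max_left _ _) (by positivity)), ?_⟩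
    obtain ⟨N, hN, hNle⟩ := hcost ell _ hp ε hε
    refine ⟨N, hN, hNle.trans ?_⟩
    have hlog : 0 ≤ Real.log (ε : ℝ)⁻¹ := by
      have hεR2 : (ε : ℝ) ≤ 1 / 2 := by
        have := (Rat.cast_le (K := ℝ)).2 hε2
        push_cast at this
        exact this
      linarith [(ChebValid.log_inv_bounds hεR hεR2).1]
    have hlogη := Real.log_nonneg (le_add_of_nonneg_right hη)
    calc _ ≤ K₂ * (K₃ * _) := mul_le_mul_of_nonneg_left (hsize ell y hy hell _ hp ε hε hε2) hK₂
      _ = K₂ * K₃ * _ := (mul_assoc _ _ _).symm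
      _ ≤ _ := mul_le_mul_of_nonneg_right (le_max_right _ _) (by positivity)
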